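/- **Notation.** We work in the field $\mathbb{Q}(q^{1/2},a^{1/2})$ of rational functions. For $d\ge 1$ let $\Psi_d f(q,a)=f(q^d,a^d)$ (that is, $q^{1/2}\mapsto q^{d/2}$, $a^{1/2}\mapsto a^{d/2}$). For $n\in\mathbb{Z}$ put $\{n\}_x=x^{n/2}-x^{-n/2}$ and $\{n\}=\{n\}_q$; for a partition $\mu$ put $\{\mu\}_x=\prod_i\{\mu_i\}_x$, $\{\mu\}=\{\mu\}_q$ and $\mathfrak{z}_\mu=|\mathrm{Aut}(\mu)|\prod_i\mu_i$. Let $\mu(d)$ be the Möbius function. Let $s_\lambda(\mathbf{x})$ and $p_\mu(\mathbf{x})$ be the Schur and power sum symmetric functions in infinitely many variables $\mathbf{x}$. For a partition $\lambda$ let $\kappa_\lambda=\sum_i\lambda_i(\lambda_i-2i+1)$, and let the colored HOMFLY-PT invariant of the unknot $U$ and of the unknot $U_\tau$ with framing $\tau\in\mathbb{Z}$ be $$W_\lambda(U;q,a)=\prod_{x\in\lambda}\frac{a^{1/2}q^{cn(x)/2}-a^{-1/2}q^{-cn(x)/2}}{q^{hl(x)/2}-q^{-hl(x)/2}},\qquad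 \mathcal{H}_\lambda(U_\tau;q,a)=(-1)^{|\lambda|\tau}q^{\kappa_\lambda\tau/2}\,W_\lambda(U;q,a),$$ where a box $x=(i,j)$ has content $cn(x)=j-i$ and hook length $hl(x)=\lambda_i+\lambda^t_j-i-j+1$. Put $Z_{CS}=\sum_\lambda \mathcal{H}_\lambda(U_\tau;q,a)\,s_\lambda(\mathbf{x})$, the sum over all partitions. For $m\ge 1$ put $$\mathcal{Z}_m(q,a)=(-1)^{m\tau}\sum_{|\nu|=m}\frac{1}{\mathfrak{z}_\nu}\,\frac{\{m\nu\tau\}}{\{m\}\{m\tau\}}\,\frac{\{\nu\}_a}{\{\nu\}},\qquad \{m\nu\tau\}=\prod_i\{m\nu_i\tau\},$$ where for $\tau=0$ the quotient $\{m\nu\tau\}/\{m\tau\}$ is read as the value at $X=1$ of the Laurent polynomial $\{m\nu\}_X/\{m\}_X$ in $X^{1/2}$: it is $m$ if $\nu=(m)$ and $0$ otherwise. **Theorem.** Let $\tau\in\mathbb{Z}$. The free energy of $U_\tau$ has a unique expansion $\log Z_{CS}=\sum_{\mu\ne\emptyset}F_\mu\,p_\mu(\mathbf{x})$ with $F_\mu\in\mathbb{Q}(q^{1/2},a^{1/2})$.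 Put $\hat F_\mu=F_\mu/\{\mu\}$ and $\hat g_\mu=\sum_{d\mid\mu}\frac{\mu(d)}{d}\Psi_d(\hat F_{\mu/d})$, and let $g_m=\mathfrak{z}_{(m)}\,\hat g_{(m)}$, for $m\ge 1$, be the one-hole LMOV generating function of $U_\tau$. Then for every $m\ge 1$ $$g_m(q,a)=\sum_{d\mid m}\mu(d)\,\mathcal{Z}_{m/d}(q^d,a^d).$$ Moreover, with $z=q^{1/2}-q^{-1/2}$, one has $g_m(q,a)\in z^{-2}\mathbb{Z}[z^2,a^{\pm 1/2}]$, that is, $$g_m(q,a)=\sum_{g\ge 0}\ \sum_{Q\in\frac12\mathbb{Z}}n_{m,g,Q}(\tau)\,z^{2g-2}a^Q$$ for unique integers $n_{m,g,Q}(\tau)$, almost all of them zero. So the one-hole LMOV invariant $n_{m,g,Q}(\tau)$ is the coefficient of $z^{2g-2}a^Q$ in $g_m(q,a)$. -/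

import Mathlib

noncomputable section

namespace FramedUnknot

/-! ### The coefficient field and its Adams operators -/

/-- The field `ℚ(q^{1/2}, a^{1/2})` of rational functions in `q^{1/2}` and `a^{1/2}`. -/
abbrev QA : Type := FractionRing (MvPolynomial (Fin 2) ℚ)

/-- The variable `q^{1/2}`. -/
def qHalf : QA := algebraMap (MvPolynomial (Fin 2) ℚ) QA (MvPolynomial.X 0)

/-- The variable `a^{1/2}`. -/
def aHalf : QA := algebraMap (MvPolynomial (Fin 2) ℚ) QA (MvPolynomial.X 1)

/-- The Adams operator `Ψ_d f(q, a) = f(q^d, a^d)`, for `d ≥ 1`: the endomorphism of the field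
`ℚ(q^{1/2}, a^{1/2})` with `q^{1/2} ↦ q^{d/2}`, `a^{1/2} ↦ a^{d/2}`
(the value at `d = 0` is never used). -/
def adams (d : ℕ) : QA →+* QA :=
  if h : 0 < d then
    IsFractionRing.map (A := MvPolynomial (Fin 2) ℚ) (B := MvPolynomial (Fin 2) ℚ)
      (j := (MvPolynomial.expand d : MvPolynomial (Fin 2) ℚ →ₐ[ℚ] MvPolynomial (Fin 2) ℚ).toRingHom)
      (MvPolynomial.expand_injective h)
  else RingHom.id QA

/-- `{n} = {n}_q = q^{n/2} - q^{-n/2}`. -/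
def bq (n : ℤ) : QA := qHalf ^ n - qHalf ^ (-n)

/-- `{n}_a = a^{n/2} - a^{-n/2}`. -/
def ba (n : ℤ) : QA := aHalf ^ n - aHalf ^ (-n)

/-! ### Partitions -/

/-- The `i`-th part of a partition in decreasing order, counted from `i = 0`
(`0` when there is no such part). -/
def row {n : ℕ} (lam : n.Partition) (i : ℕ) : ℕ := (lam.parts.sort (· ≥ ·)).getD i 0

/-- The `j`-th part of the transposed partition, counted from `j = 0`: the number of parts that
are greater than `j`. -/
def col {n : ℕ} (lam : n.Partition) (j : ℕ) : ℕ := (lam.parts.filter (j < ·)).card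

/-- `𝔷_μ = |Aut μ| ∏ μ_i`, with `|Aut μ|` the product of the factorials of the multiplicities. -/
def zee {n : ℕ} (mu : n.Partition) : ℕ :=
  (∏ k ∈ mu.parts.toFinset, (mu.parts.count k).factorial) * mu.parts.prod

/-- `κ_λ = ∑ λ_i (λ_i - 2 i + 1)`, the sum over `i = 1, …, l(λ)` (below, `i` starts at `0`). -/
def kappa {n : ℕ} (lam : n.Partition) : ℤ :=
  ∑ i ∈ Finset.range lam.parts.card, (row lam i : ℤ) * ((row lam i : ℤ) - 2 * (i : ℤ) - 1)

/-! ### Symmetric functions in the variables `x_0, x_1, x_2, …` -/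

/-- The complete homogeneous symmetric function `h_k(x)`, the sum of all monomials of degree `k`;
it is `0` for `k < 0`. -/
def completeH (k : ℤ) : MvPowerSeries ℕ QA :=
  fun α => if ((Finsupp.degree α : ℕ) : ℤ) = k then 1 else 0

/-- The power sum `p_k(x) = ∑ x_i ^ k`, for `k ≥ 1`. -/
def powerSum (k : ℕ) : MvPowerSeries ℕ QA :=
  open Classical in fun α => if ∃ i, α = Finsupp.single i k then 1 else 0

/-- `p_μ(x) = ∏ p_{μ_i}(x)`. -/
def powerSumP {n : ℕ} (mu : n.Partition) : MvPowerSeries ℕ QA :=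
  (mu.parts.map powerSum).prod

/-- The Schur function `s_λ(x)`, by the Jacobi–Trudi formula `s_λ = det (h_{λ_i - i + j})`. -/
def schur {n : ℕ} (lam : n.Partition) : MvPowerSeries ℕ QA :=
  Matrix.det (Matrix.of fun i j : Fin lam.parts.card =>
    completeH ((row lam i : ℤ) - (i : ℤ) + (j : ℤ)))

/-! ### Chern–Simons theory of the unknot with framing `τ` -/

/-- The colored HOMFLY-PT invariant of the unknot,
`W_λ(U; q, a) = ∏_x (a^{1/2} q^{cn(x)/2} - a^{-1/2} q^{-cn(x)/2}) / (q^{hl(x)/2} - q^{-hl(x)/2})`,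
the product over the boxes `x = (i, j)` of `λ`, with content `cn(x) = j - i` and hook length
`hl(x) = λ_i + λᵗ_j - i - j + 1` (below, `i` and `j` start at `0`). -/
def unknotW {n : ℕ} (lam : n.Partition) : QA :=
  ∏ i ∈ Finset.range lam.parts.card, ∏ j ∈ Finset.range (row lam i),
    (aHalf * qHalf ^ ((j : ℤ) - (i : ℤ)) - aHalf⁻¹ * qHalf ^ (-((j : ℤ) - (i : ℤ)))) /
      bq ((row lam i : ℤ) + (col lam j : ℤ) - (i : ℤ) - (j : ℤ) - 1)

/-- The framed invariant `H_λ(U_τ; q, a) = (-1)^{|λ|τ} q^{κ_λ τ / 2} W_λ(U; q, a)`. -/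
def framedH (τ : ℤ) {n : ℕ} (lam : n.Partition) : QA :=
  (-1) ^ ((n : ℤ) * τ) * qHalf ^ (kappa lam * τ) * unknotW lam

/-- The Chern–Simons partition function `Z_CS = ∑_λ H_λ(U_τ; q, a) s_λ(x)`, the sum over all
partitions. As `s_λ` is homogeneous of degree `|λ|`, only the `λ` with `|λ| = |α|` contribute to
the coefficient of `x^α`. -/
def csPartitionFunction (τ : ℤ) : MvPowerSeries ℕ QA :=
  fun α => ∑ lam : (Finsupp.degree α).Partition, framedH τ lam * MvPowerSeries.coeff α (schur lam)

/-- The Chern–Simons free energy `F_CS = log Z_CS`, i.e. `log (1 + X)` at `X = Z_CS - 1`. -/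
def csFreeEnergy (τ : ℤ) : MvPowerSeries ℕ QA :=
  PowerSeries.subst (csPartitionFunction τ - 1) (PowerSeries.log QA)

/-- The family `F = (F_μ)` is the family of the coefficients of the power sum expansion
`F_CS = ∑_μ F_μ p_μ(x)`, compared coefficient by coefficient (`p_μ` is homogeneous of degree
`|μ|`). The empty partition is allowed as an index; its coefficient is forced to be `0`. -/
def IsPowerSumExpansion (τ : ℤ) (F : (n : ℕ) → n.Partition → QA) : Prop :=
  ∀ α : ℕ →₀ ℕ, MvPowerSeries.coeff α (csFreeEnergy τ) =
    ∑ mu : (Finsupp.degree α).Partition, F _ mu * MvPowerSeries.coeff α (powerSumP mu)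

/-! ### The LMOV generating functions -/

/-- `F̂_μ = F_μ / {μ}`, with `{μ} = ∏ {μ_i}`. -/
def fHat (F : (n : ℕ) → n.Partition → QA) {n : ℕ} (mu : n.Partition) : QA :=
  F n mu / (mu.parts.map fun k => bq (k : ℤ)).prod

/-- The partition `μ / d` with the parts `μ_i / d`, for a common divisor `d` of the parts. -/
def divPart {n : ℕ} (mu : n.Partition) (d : ℕ) : ((mu.parts.map (· / d)).sum).Partition :=
  Nat.Partition.ofMultiset (mu.parts.map (· / d))

/-- `ĝ_μ = ∑_{d ∣ μ} (μ(d) / d) Ψ_d (F̂_{μ/d})`, the sum over the common divisors `d ≥ 1` of the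
parts of a nonempty partition. -/
def gHat (F : (n : ℕ) → n.Partition → QA) {n : ℕ} (mu : n.Partition) : QA :=
  ∑ d ∈ n.divisors with ∀ k ∈ mu.parts, d ∣ k,
    ((ArithmeticFunction.moebius d : ℤ) : QA) / (d : QA) * adams d (fHat F (divPart mu d))

/-- The one-hole LMOV generating function `g_m = 𝔷_{(m)} ĝ_{(m)}`, where `(m)` is the partition
with the single part `m`. -/
def oneHoleG (F : (n : ℕ) → n.Partition → QA) (m : ℕ) : QA :=
  (zee (Nat.Partition.indiscrete m) : QA) * gHat F (Nat.Partition.indiscrete m)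

/-! ### The explicit formula -/

/-- The quotient `{mντ} / {mτ}`, with `{mντ} = ∏ {m ν_i τ}`, for a partition `ν` of `m ≥ 1`. For
`τ = 0` it is the value at `X = 1` of the Laurent polynomial `{mν}_X / {m}_X` in `X^{1/2}`, of which
it is the value at `X = q^τ` in general: this is `m` if `ν = (m)`, and `0` otherwise. -/
def bracketQuot (τ : ℤ) {m : ℕ} (nu : m.Partition) : QA :=
  if τ = 0 then (if nu.parts.card = 1 then (m : QA) else 0)
  else (nu.parts.map fun k => bq ((m : ℤ) * (k : ℤ) * τ)).prod / bq ((m : ℤ) * τ)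

/-- `Z_m(q, a) = (-1)^{mτ} ∑_{|ν| = m} (1 / 𝔷_ν) ({mντ} / ({m}{mτ})) ({ν}_a / {ν})`. -/
def explicitZ (τ : ℤ) (m : ℕ) : QA :=
  (-1) ^ ((m : ℤ) * τ) * ∑ nu : m.Partition,
    1 / (zee nu : QA) * (bracketQuot τ nu / bq (m : ℤ)) *
      ((nu.parts.map fun k => ba (k : ℤ)).prod / (nu.parts.map fun k => bq (k : ℤ)).prod)

end FramedUnknot

end

/-! Everything rests on Newton's relation t H'(t) = P(t) H(t) between the generating series of power
sums and of complete symmetric functions. It is used over fields, over power series and over rings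
with infinitesimals.

The formula for g_m. The free energy is lifted to a power series ring whose variables stand for p_1,
p_2, …; this lift and the linear independence of the p_μ give existence and uniqueness of the F_μ.
The logarithm does not change the coefficient of the single variable p_m, so F_(m) is the
coefficient of p_m in ∑ H_λ s_λ over |λ| = m. Modulo the square of that variable, the Jacobi–Trudi
determinant vanishes unless λ is a hook (a+1, 1^b), which contributes (-1)^b / m; on hooks κ = m(a -
b). On the other side, for τ ≠ 0, 𝒵_m is a multiple of h_m at p_k = {mkτ}{k}_a/{k}, which is the
coefficient of t^m in H(xt)/H(t/x) with x = q^{mτ/2}. Pieri's rule for h_{a+1} e_{b+1} and summation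
by parts turn it into the same sum over hooks (`explicitZ_eq_sum_hookW`, which also covers τ = 0).
Hence F_(m) = ({m}/m) 𝒵_m (`freeEnergyCoeff_indiscrete`), and the Möbius formula follows.

Integrality. Let τ ≠ 0, t = |τ|, y = q^{1/2}, and [M] = (y^M - y^{-M})/(y - y⁻¹). Since Ψ_d turns
{m/d}{mt/d} into {m}{mt}, g_m = ± N / (z² [m][mt]) with N a Laurent polynomial in y over ℤ[a^{±1/2}]
(`numerator`). To prove [m][mt] ∣ N it is enough to count zeros over an algebraically closed field,
at points where y² has order e ≠ 1 with e ∣ mt: a zero is needed if e ∤ m, a double zero if e ∣ m.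
So N is evaluated at y + ε with ε² = 0. There the power sums p_k with e ∤ k are infinitesimal, and
those with e ∣ k have no first-order term. In Newton's recursion for e ∣ m the infinitesimal ones
always meet in pairs and drop out (`IsNewton.coeff_congr`), so the d-th summand of N depends only on
lcm(d, e) and a sign. For a prime p ∣ e the divisors d and pd with p ∤ d agree in both and have
opposite Möbius values: N vanishes (`IsTangentPoint.numerator_eq_zero`). The quotient is invariant
under y ↦ y⁻¹ and y ↦ -y, hence a polynomial in z². Uniqueness of the integers is the algebraic
independence of z and a^{1/2}. -/

namespace FramedUnknot

/-! ### Newton's relation between power sums and complete symmetric functions -/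

section Newton

open PowerSeries

variable {R S : Type*} [CommRing R] [CommRing S]

/-- `H` is the generating series of the complete symmetric functions whose power sums have the
generating series `P`: `t H'(t) = P(t) H(t)` and `H(0) = 1`. -/
structure IsNewton (P H : R⟦X⟧) : Prop where
  eq : X * derivative R H = P * H
  constantCoeff : constantCoeff H = 1

theorem coeff_X_mul_derivative (H : R⟦X⟧) (n : ℕ) :
    coeff n (X * derivative R H) = n * coeff n H := by
  cases n with
  | zero => simp
  | succ n => rw [coeff_succ_X_mul, coeff_derivative]; push_cast; ring

theorem IsNewton.constantCoeff_left {P H : R⟦X⟧} (h : IsNewton P H) :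
    PowerSeries.constantCoeff P = 0 := by
  have := congrArg PowerSeries.constantCoeff h.eq
  simpa [h.constantCoeff] using this.symm

theorem IsNewton.coeff_eq {P H : R⟦X⟧} (h : IsNewton P H) (n : ℕ) :
    n * coeff n H = ∑ k ∈ Finset.Icc 1 n, coeff k P * coeff (n - k) H := by
  rw [← coeff_X_mul_derivative, h.eq, coeff_mul, Finset.Nat.sum_antidiagonal_eq_sum_range_succ
    (fun i j => coeff i P * coeff j H), Finset.sum_range_succ', Nat.sub_zero,
    coeff_zero_eq_constantCoeff_apply (φ := P), h.constantCoeff_left, zero_mul, add_zero]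
  rw [Finset.range_eq_Ico, Finset.sum_Ico_add' (fun k => coeff k P * coeff (n - k) H) 0 n 1]
  rfl

/-- Division by n comes from the ℚ-algebra structure, since the dual numbers have zero divisors. -/
theorem natCast_mul_cancel [Algebra ℚ R] {n : ℕ} (hn : n ≠ 0) {x y : R}
    (h : (n : R) * x = n * y) : x = y := by
  have h1 : algebraMap ℚ R (1 / n) * (n : R) = 1 := by
    rw [← map_natCast (algebraMap ℚ R), ← map_mul]
    have : (n : ℚ) ≠ 0 := by exact_mod_cast hn
    rw [one_div, inv_mul_cancel₀ this, map_one]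
  have := congrArg (algebraMap ℚ R (1 / n) * ·) h
  simp only [← mul_assoc, h1, one_mul] at this
  exact this

/-- If the power sums `p_k`, `p_k'` lie in an ideal of square zero for `e ∤ k` and agree for
`e ∣ k`, then the complete symmetric functions agree in all degrees divisible by `e`, and those of
other degrees lie in the ideal. -/
theorem IsNewton.coeff_congr [Algebra ℚ R] {P H P' H' : R⟦X⟧} (h : IsNewton P H)
    (h' : IsNewton P' H') {I : Ideal R} (hI : ∀ x ∈ I, ∀ y ∈ I, x * y = 0) {e : ℕ}
    (hP : ∀ k, ¬ e ∣ k → coeff k P ∈ I) (hP' : ∀ k, ¬ e ∣ k → coeff k P' ∈ I)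
    (hPP : ∀ k, e ∣ k → coeff k P = coeff k P') (n : ℕ) :
    (¬ e ∣ n → coeff n H ∈ I ∧ coeff n H' ∈ I) ∧ (e ∣ n → coeff n H = coeff n H') := by
  -- For e ∤ n each term p_k h_{n-k} of n h_n lies in I: either e ∤ k, or e ∤ n - k and induction
  -- applies.
  have aux : ∀ {P H : R⟦X⟧}, IsNewton P H → (∀ k, ¬ e ∣ k → coeff k P ∈ I) →
      ∀ n, ¬ e ∣ n → coeff n H ∈ I := by
    intro P H h hP n
    induction n using Nat.strong_induction_on with
    | _ n ih =>
      intro hn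
      have hn0 : n ≠ 0 := by rintro rfl; simp at hn
      have key : (n : R) * coeff n H ∈ I := by
        rw [h.coeff_eq]
        refine Ideal.sum_mem _ fun k hk => ?_
        rw [Finset.mem_Icc] at hk
        by_cases hek : e ∣ k
        · refine Ideal.mul_mem_left _ _ (ih _ (by omega) fun h1 => hn ?_)
          have := dvd_add h1 hek
          rwa [Nat.sub_add_cancel hk.2] at this
        · exact Ideal.mul_mem_right _ _ (hP k hek)
      have h1 : coeff n H = algebraMap ℚ R (1 / n) * (n * coeff n H) := by
        refine natCast_mul_cancel hn0 ?_
        rw [← mul_assoc (n : R), ← map_natCast (algebraMap ℚ R), ← map_mul]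
        have : (n : ℚ) ≠ 0 := by exact_mod_cast hn0
        rw [one_div, mul_inv_cancel₀ this, map_one, one_mul]
      rw [h1]
      exact Ideal.mul_mem_left _ _ key
  refine ⟨fun hn => ⟨aux h hP n hn, aux h' hP' n hn⟩, ?_⟩
  induction n using Nat.strong_induction_on with
  | _ n ih =>
    intro hn
    rcases eq_or_ne n 0 with rfl | hn0
    · rw [coeff_zero_eq_constantCoeff_apply, coeff_zero_eq_constantCoeff_apply, h.constantCoeff,
        h'.constantCoeff]
    refine natCast_mul_cancel hn0 ?_
    rw [h.coeff_eq, h'.coeff_eq]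
    refine Finset.sum_congr rfl fun k hk => ?_
    rw [Finset.mem_Icc] at hk
    by_cases hek : e ∣ k
    · rw [hPP k hek, ih _ (by omega) (Nat.dvd_sub hn hek)]
    -- Both factors p_k and h_{n-k} lie in I, so the term is zero on either side.
    · have h1 : ¬ e ∣ n - k := fun h1 => hek ((Nat.dvd_sub_iff_right hk.2 hn).1 h1)
      rw [hI _ (hP k hek) _ (aux h hP _ h1), hI _ (hP' k hek) _ (aux h' hP' _ h1)]

theorem IsNewton.unique [Algebra ℚ R] {P H H' : R⟦X⟧} (h : IsNewton P H) (h' : IsNewton P H') :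
    H = H' := by
  ext n
  exact (h.coeff_congr h' (I := ⊥) (e := 1) (by simp) (by simp) (by simp) (by simp) n).2
    (one_dvd n)

theorem IsNewton.one : IsNewton (0 : R⟦X⟧) 1 := ⟨by simp, by simp⟩

theorem IsNewton.mul {P H P' H' : R⟦X⟧} (h : IsNewton P H) (h' : IsNewton P' H') :
    IsNewton (P + P') (H * H') := by
  refine ⟨?_, by simp [h.constantCoeff, h'.constantCoeff]⟩
  rw [Derivation.leibniz, smul_eq_mul, smul_eq_mul]
  linear_combination H' * h.eq + H * h'.eq

theorem IsNewton.prod {ι : Type*} (s : Finset ι) {P H : ι → R⟦X⟧}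
    (h : ∀ i ∈ s, IsNewton (P i) (H i)) : IsNewton (∑ i ∈ s, P i) (∏ i ∈ s, H i) := by
  classical
  induction s using Finset.induction_on with
  | empty => simpa using IsNewton.one
  | insert a s ha ih =>
    rw [Finset.sum_insert ha, Finset.prod_insert ha]
    exact (h a (by simp)).mul (ih fun i hi => h i (by simp [hi]))

theorem IsNewton.rescale (c : R) {P H : R⟦X⟧} (h : IsNewton P H) :
    IsNewton (PowerSeries.rescale c P) (PowerSeries.rescale c H) := by
  refine ⟨?_, ?_⟩
  · rw [← map_mul, ← h.eq]
    ext n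
    rw [coeff_X_mul_derivative, coeff_rescale, coeff_rescale, coeff_X_mul_derivative]
    ring
  · rw [← coeff_zero_eq_constantCoeff_apply, coeff_rescale]
    simp [h.constantCoeff]

theorem IsNewton.neg_of_mul_eq_one {P H G : R⟦X⟧} (h : IsNewton P H) (hG : H * G = 1) :
    IsNewton (-P) G := by
  have h0 : PowerSeries.constantCoeff G = 1 := by
    have := congrArg PowerSeries.constantCoeff hG
    simpa [h.constantCoeff] using this
  refine ⟨?_, h0⟩
  have h1 : derivative R (H * G) = 0 := by rw [hG, derivative_one]
  rw [Derivation.leibniz, smul_eq_mul, smul_eq_mul] at h1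
  linear_combination X * G * h1 - G * G * h.eq - (X * derivative R G + G * P) * hG

theorem isNewton_geometric {c : R} {d : ℕ} (hd : d ≠ 0) {H : R⟦X⟧}
    (hH : H * (1 - C c * X ^ d) = 1) : IsNewton ((d : R⟦X⟧) * (H - 1)) H := by
  have h1 : derivative R (H * (1 - C c * X ^ d)) = 0 := by rw [hH, derivative_one]
  have h0 : PowerSeries.constantCoeff H = 1 := by
    have := congrArg PowerSeries.constantCoeff hH
    simpa [hd] using this
  refine ⟨?_, h0⟩
  obtain ⟨d, rfl⟩ := Nat.exists_eq_succ_of_ne_zero hd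
  have h2 : derivative R (1 - C c * X ^ (d + 1) : R⟦X⟧) = - (C c * (((d + 1 : ℕ) : R⟦X⟧) * X ^ d)) := by
    rw [map_sub, derivative_one, Derivation.leibniz, derivative_C, smul_zero, add_zero,
      derivative_pow, derivative_X, smul_eq_mul]
    simp
  rw [Derivation.leibniz, smul_eq_mul, smul_eq_mul, h2] at h1
  simp only [Nat.succ_eq_add_one, pow_succ] at *
  linear_combination X * H * h1 - (X * derivative R H + ((d + 1 : ℕ) : R⟦X⟧) * H) * hH

/-- The geometric series `1 / (1 - c t^d)`. -/
def geom (d : ℕ) (c : R) : R⟦X⟧ := PowerSeries.mk fun n => if d ∣ n then c ^ (n / d) else 0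

theorem geom_mul {d : ℕ} (hd : d ≠ 0) (c : R) : geom d c * (1 - C c * X ^ d) = 1 := by
  ext n
  rw [mul_sub, mul_one, map_sub, mul_left_comm, coeff_C_mul, coeff_mul_X_pow', geom, coeff_mk,
    coeff_mk, coeff_one]
  rcases lt_or_ge n d with h | h
  · rw [if_neg (show ¬ d ≤ n by omega), mul_zero, sub_zero]
    rcases eq_or_ne n 0 with rfl | h0
    · simp
    · rw [if_neg (fun h1 => absurd (Nat.le_of_dvd (by omega) h1) (by omega)), if_neg h0]
  · rw [if_pos h, if_neg (show ¬ n = 0 by omega)]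
    by_cases hdn : d ∣ n
    · obtain ⟨k, rfl⟩ := hdn
      obtain ⟨k, rfl⟩ : ∃ j, k = j + 1 :=
        ⟨k - 1, by rcases k with _ | k <;> [simp at h; simp]; omega⟩
      have h1 : d * (k + 1) - d = d * k := by rw [mul_add, mul_one, Nat.add_sub_cancel]
      rw [h1, if_pos (dvd_mul_right d k), if_pos (dvd_mul_right d (k + 1)),
        Nat.mul_div_cancel_left _ (by omega), Nat.mul_div_cancel_left _ (by omega), pow_succ']
      ring
    · rw [if_neg hdn, if_neg (fun h1 => hdn ((Nat.dvd_sub_iff_left h (dvd_refl d)).1 h1))]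
      simp

theorem isNewton_geom {d : ℕ} (hd : d ≠ 0) (c : R) :
    IsNewton ((d : R⟦X⟧) * (geom d c - 1)) (geom d c) :=
  isNewton_geometric hd (geom_mul hd c)

theorem isNewton_one_sub {d : ℕ} (hd : d ≠ 0) (c : R) :
    IsNewton (-((d : R⟦X⟧) * (geom d c - 1))) (1 - C c * X ^ d) :=
  (isNewton_geom hd c).neg_of_mul_eq_one (geom_mul hd c)

theorem coeff_natCast_mul_geom_sub_one {d : ℕ} (c : R) {k : ℕ} (hk : k ≠ 0) :
    coeff k ((d : R⟦X⟧) * (geom d c - 1)) = if d ∣ k then d * c ^ (k / d) else 0 := by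
  rw [← map_natCast (C (R := R)), coeff_C_mul, map_sub, coeff_one, if_neg hk, sub_zero, geom,
    coeff_mk, mul_ite, mul_zero]

end Newton

/-! ### Sums over partitions -/

section PartitionSum

/-- The number `𝔷` of a multiset of parts. -/
def zeeMultiset (s : Multiset ℕ) : ℕ :=
  (∏ k ∈ s.toFinset, (s.count k).factorial) * s.prod

theorem zeeMultiset_cons (k : ℕ) (s : Multiset ℕ) :
    zeeMultiset (k ::ₘ s) = k * (s.count k + 1) * zeeMultiset s := by
  have h1 : ∏ j ∈ s.toFinset, (s.count j).factorial =
      ∏ j ∈ insert k s.toFinset, (s.count j).factorial := by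
    refine Finset.prod_subset (Finset.subset_insert _ _) fun j _ hj => ?_
    rw [Multiset.mem_toFinset] at hj
    rw [Multiset.count_eq_zero_of_notMem hj, Nat.factorial_zero]
  rw [zeeMultiset, zeeMultiset, h1, Multiset.toFinset_cons, Multiset.prod_cons,
    ← Finset.mul_prod_erase _ _ (Finset.mem_insert_self k _),
    ← Finset.mul_prod_erase _ (fun j => (s.count j).factorial) (Finset.mem_insert_self k _),
    Multiset.count_cons_self, Nat.factorial_succ]
  have h2 : ∏ j ∈ (insert k s.toFinset).erase k, ((k ::ₘ s).count j).factorial =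
      ∏ j ∈ (insert k s.toFinset).erase k, (s.count j).factorial :=
    Finset.prod_congr rfl fun j hj => by rw [Multiset.count_cons_of_ne (Finset.ne_of_mem_erase hj)]
  rw [h2]
  ring

theorem zeeMultiset_ne_zero {s : Multiset ℕ} (hs : ∀ k ∈ s, 0 < k) : zeeMultiset s ≠ 0 := by
  refine mul_ne_zero (Finset.prod_ne_zero_iff.2 fun k _ => Nat.factorial_ne_zero _) ?_
  exact Multiset.prod_ne_zero fun h => absurd (hs 0 h) (lt_irrefl 0)

theorem zee_ne_zero {n : ℕ} (nu : n.Partition) : zee nu ≠ 0 :=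
  zeeMultiset_ne_zero fun _ h => nu.parts_pos h

/-- `h_n = ∑_{ν ⊢ n} p_ν / 𝔷_ν`, over a `ℚ`-algebra. -/
theorem IsNewton.coeff_eq_sum_partition' {R : Type*} [CommRing R] [Algebra ℚ R]
    {P H : PowerSeries R}
    (h : IsNewton P H) (n : ℕ) :
    PowerSeries.coeff n H = ∑ nu : n.Partition,
      algebraMap ℚ R (1 / zee nu) * (nu.parts.map fun k => PowerSeries.coeff k P).prod := by
  induction n using Nat.strong_induction_on with
  | _ n ih =>
    rcases eq_or_ne n 0 with rfl | hn
    · rw [PowerSeries.coeff_zero_eq_constantCoeff_apply, h.constantCoeff, Fintype.sum_unique]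
      simp [zee]
    refine natCast_mul_cancel hn ?_
    rw [h.coeff_eq, Finset.mul_sum]
    -- Writing n as the sum of k times the multiplicity of k in ν splits the sum by a chosen part k;
    -- removing that part leaves p_k times the formula for n - k.
    have h1 : ∀ nu : n.Partition,
        (n : R) * (algebraMap ℚ R (1 / zee nu) * (nu.parts.map fun k => PowerSeries.coeff k P).prod) =
        ∑ k ∈ Finset.Icc 1 n, if k ∈ nu.parts then ((k * nu.parts.count k : ℕ) : R) *
          (algebraMap ℚ R (1 / zee nu) * (nu.parts.map fun k => PowerSeries.coeff k P).prod) else 0 := by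
      intro nu
      rw [← Finset.sum_filter, ← Finset.sum_mul, ← Nat.cast_sum]
      congr 2
      have h2 : (Finset.Icc 1 n).filter (· ∈ nu.parts) = nu.parts.toFinset := by
        ext k
        simp only [Finset.mem_filter, Finset.mem_Icc, Multiset.mem_toFinset]
        exact ⟨fun h => h.2, fun h => ⟨⟨nu.parts_pos h, nu.le_of_mem_parts h⟩, h⟩⟩
      rw [h2]
      conv_lhs => rw [← nu.parts_sum, Finset.sum_multiset_count]
      exact Finset.sum_congr rfl fun k _ => by rw [smul_eq_mul, mul_comm]
    rw [Finset.sum_congr rfl fun nu _ => h1 nu, Finset.sum_comm]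
    refine Finset.sum_congr rfl fun k hk => ?_
    rw [Finset.mem_Icc] at hk
    rw [ih (n - k) (by omega), Finset.mul_sum, ← Finset.sum_filter,
      ← Finset.sum_subtype_eq_sum_filter]
    refine Finset.sum_bij' (fun nu _ => ⟨((Nat.Partition.partitionWithPartEquiv hk.1 hk.2).symm nu).1, ?_⟩)
      (fun nu _ => Nat.Partition.partitionWithPartEquiv hk.1 hk.2 ⟨nu.1, nu.2⟩) ?_ ?_ ?_ ?_ ?_
    · exact ((Nat.Partition.partitionWithPartEquiv hk.1 hk.2).symm nu).2
    · intro nu _; simp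
    · intro nu _; simp
    · intro nu _; simp
    · intro nu _; simp
    · intro nu _
      have hz : (zee ((Nat.Partition.partitionWithPartEquiv hk.1 hk.2).symm nu).1 : ℚ) =
          k * (nu.parts.count k + 1) * zee nu := by
        have := zeeMultiset_cons k nu.parts
        rw [← Nat.Partition.partitionWithPartEquiv_symm_apply_parts hk.1 hk.2 nu] at this
        change ((zeeMultiset _ : ℕ) : ℚ) = _
        rw [this]
        push_cast
        rfl
      have hzn : (zee nu : ℚ) ≠ 0 := by exact_mod_cast zee_ne_zero nu
      have hkn : (k : ℚ) ≠ 0 := by exact_mod_cast (by omega : k ≠ 0)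
      have hc : (nu.parts.count k + 1 : ℚ) ≠ 0 := by
        exact_mod_cast Nat.succ_ne_zero (nu.parts.count k)
      rw [hz, Nat.Partition.partitionWithPartEquiv_symm_apply_parts, Multiset.map_cons,
        Multiset.prod_cons, Multiset.count_cons_self, ← mul_assoc,
        ← map_natCast (algebraMap ℚ R)]
      have h3 : ((k * (nu.parts.count k + 1) : ℕ) : ℚ) *
          (1 / (k * (nu.parts.count k + 1) * zee nu)) = 1 / zee nu := by
        push_cast
        field_simp
      rw [← h3, map_mul]
      ring

/-- `h_n = ∑_{ν ⊢ n} p_ν / 𝔷_ν`, over a field. -/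
theorem IsNewton.coeff_eq_sum_partition {K : Type*} [Field K] [CharZero K] {P H : PowerSeries K}
    (h : IsNewton P H) (n : ℕ) :
    PowerSeries.coeff n H = ∑ nu : n.Partition,
      1 / (zee nu : K) * (nu.parts.map fun k => PowerSeries.coeff k P).prod := by
  rw [h.coeff_eq_sum_partition']
  simp

end PartitionSum

/-! ### The principal specialization and hook shapes -/

section Hooks

open PowerSeries

variable {K : Type*} [Field K]

/-- `y^n - y^{-n}`. -/
def br (y : K) (n : ℤ) : K := y ^ n - y ^ (-n)

/-- `A y^c - A⁻¹ y^{-c}`. -/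
def brShift (y A : K) (c : ℤ) : K := A * y ^ c - A⁻¹ * y ^ (-c)

/-- The specialization of `h_n` at `p_k = (A^k - A^{-k}) / (y^k - y^{-k})`. -/
def hSpec (y A : K) (n : ℕ) : K :=
  ∏ c ∈ Finset.range n, brShift y A c / br y (c + 1 : ℕ)

/-- The generating series of the power sums `p_k = (A^k - A^{-k}) / (y^k - y^{-k})`. -/
def pSpec (y A : K) : K⟦X⟧ := PowerSeries.mk fun k => br A k / br y k

/-- The specialization of the Schur function of the hook `(a + 1, 1^b)`. -/
def hookW (y A : K) (a b : ℕ) : K :=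
  (∏ c ∈ Finset.range (a + 1), brShift y A c) * (∏ c ∈ Finset.range b, brShift y A (-(c + 1 : ℕ))) /
    (br y (a + b + 1 : ℕ) * (∏ c ∈ Finset.range a, br y (c + 1 : ℕ)) *
      ∏ c ∈ Finset.range b, br y (c + 1 : ℕ))

theorem br_inv (y : K) (n : ℤ) : br y⁻¹ n = -br y n := by
  simp [br]

theorem brShift_inv (y A : K) (c : ℤ) : brShift y A⁻¹ c = -brShift y A (-c) := by
  simp [brShift]

/-- Negating all power sums inverts the generating series, so h_n at A⁻¹ is (-1)^n e_n at A. -/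
theorem pSpec_inv (y A : K) : pSpec y A⁻¹ = -pSpec y A := by
  ext k
  simp [pSpec, br_inv, neg_div]

theorem exists_isNewton {H : K⟦X⟧} (h : constantCoeff H = 1) : ∃ P, IsNewton P H :=
  ⟨X * derivative K H * H⁻¹, by
    rw [mul_assoc, PowerSeries.inv_mul_cancel _ (by rw [h]; exact one_ne_zero), mul_one], h⟩

theorem IsNewton.left_unique {P P' H : K⟦X⟧} (h : IsNewton P H) (h' : IsNewton P' H) : P = P' := by
  have hH : H ≠ 0 := by
    rintro rfl
    simpa using h.constantCoeff
  exact mul_right_cancel₀ hH (h.eq.symm.trans h'.eq)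

/-- The q-binomial theorem. The recursion of the products is the functional equation (1 - A t) H(y
t) = (1 - A⁻¹ t) H(y⁻¹ t); comparing logarithmic derivatives of both sides determines the power
sums. -/
theorem isNewton_hSpec {y : K} (A : K) (hy' : ∀ n : ℕ, n ≠ 0 → br y n ≠ 0) :
    IsNewton (pSpec y A) (PowerSeries.mk (hSpec y A)) := by
  obtain ⟨P, hP⟩ := exists_isNewton (H := PowerSeries.mk (hSpec y A))
    (by rw [← coeff_zero_eq_constantCoeff_apply, coeff_mk]; simp [hSpec])
  have key : (1 - C A * X ^ 1) * rescale y (PowerSeries.mk (hSpec y A)) =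
      (1 - C A⁻¹ * X ^ 1) * rescale y⁻¹ (PowerSeries.mk (hSpec y A)) := by
    ext n
    rw [sub_mul, sub_mul, one_mul, one_mul, map_sub, map_sub, mul_assoc, mul_assoc, coeff_C_mul,
      coeff_C_mul, pow_one]
    cases n with
    | zero => simp
    | succ n =>
      rw [coeff_succ_X_mul, coeff_succ_X_mul]
      simp only [coeff_rescale, coeff_mk]
      have h1 : hSpec y A (n + 1) * br y (n + 1 : ℕ) = hSpec y A n * brShift y A n := by
        rw [hSpec, Finset.prod_range_succ, hSpec, mul_assoc,
          div_mul_cancel₀ _ (hy' _ n.succ_ne_zero)]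
      simp only [br, brShift, zpow_neg, zpow_natCast] at h1
      rw [inv_pow, inv_pow]
      linear_combination h1
  have h2 := ((isNewton_one_sub one_ne_zero A).mul (hP.rescale y))
  rw [key] at h2
  have h3 := h2.left_unique ((isNewton_one_sub one_ne_zero A⁻¹).mul (hP.rescale y⁻¹))
  have h4 : P = pSpec y A := by
    ext k
    rcases eq_or_ne k 0 with rfl | hk
    · rw [coeff_zero_eq_constantCoeff_apply, hP.constantCoeff_left]
      simp [pSpec, br]
    · have h5 := congrArg (coeff k) h3
      rw [map_add, map_neg, coeff_natCast_mul_geom_sub_one _ hk, map_add, map_neg,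
        coeff_natCast_mul_geom_sub_one _ hk] at h5
      simp only [one_dvd, if_true, Nat.div_one, Nat.cast_one, one_mul, coeff_rescale] at h5
      rw [pSpec, coeff_mk, eq_div_iff (hy' k hk)]
      simp only [br, zpow_neg, zpow_natCast]
      rw [inv_pow, inv_pow] at h5
      linear_combination h5
  rwa [← h4]

/-! ### Pieri's rule for hooks -/

theorem hSpec_inv (y A : K) (n : ℕ) :
    hSpec y A⁻¹ n = (-1) ^ n * ∏ c ∈ Finset.range n, brShift y A (-c) / br y (c + 1 : ℕ) := by
  rw [hSpec, ← Finset.card_range n, ← Finset.prod_const, Finset.card_range,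
    ← Finset.prod_mul_distrib]
  refine Finset.prod_congr rfl fun c _ => ?_
  rw [brShift_inv]
  ring

theorem hookW_zero_right {y : K} (A : K) (a : ℕ) : hookW y A a 0 = hSpec y A (a + 1) := by
  rw [hookW, hSpec, Finset.prod_div_distrib, Finset.prod_range_succ (fun c => br y (c + 1 : ℕ))]
  simp only [Finset.range_zero, Finset.prod_empty, mul_one, add_zero]
  rw [mul_comm (br y _)]

theorem hookW_zero_left {y : K} (A : K) (b : ℕ) :
    hookW y A 0 b = ∏ c ∈ Finset.range (b + 1), brShift y A (-c) / br y (c + 1 : ℕ) := by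
  rw [hookW, Finset.prod_div_distrib, Finset.prod_range_succ (fun c => br y (c + 1 : ℕ)),
    Finset.prod_range_succ' (fun c : ℕ => brShift y A (-c))]
  simp only [zero_add, Finset.range_one, Finset.prod_singleton, Finset.range_zero,
    Finset.prod_empty, mul_one, Nat.cast_zero, neg_zero]
  rw [mul_comm (br y _), mul_comm (brShift y A 0)]

/-- Pieri's rule: h_{a+1} e_{b+1} is the sum of the Schur functions of (a+1, 1^{b+1}) and (a+2,
1^b). The product on the right is e_{b+1}; after cancelling common factors only the three-term
identity `key` remains. -/
theorem hookW_add_hookW {y : K} {A : K} (hy : y ≠ 0) (hA : A ≠ 0)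
    (hy' : ∀ n : ℕ, n ≠ 0 → br y n ≠ 0) (a b : ℕ) :
    hookW y A a (b + 1) + hookW y A (a + 1) b = hSpec y A (a + 1) *
      ∏ c ∈ Finset.range (b + 1), brShift y A (-c) / br y (c + 1 : ℕ) := by
  have ha : ∏ c ∈ Finset.range a, br y (c + 1 : ℕ) ≠ 0 :=
    Finset.prod_ne_zero_iff.2 fun c _ => hy' _ c.succ_ne_zero
  have hb : ∏ c ∈ Finset.range b, br y (c + 1 : ℕ) ≠ 0 :=
    Finset.prod_ne_zero_iff.2 fun c _ => hy' _ c.succ_ne_zero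
  have h1 := hy' (a + 1) a.succ_ne_zero
  have h2 := hy' (b + 1) b.succ_ne_zero
  have h3 := hy' (a + b + 1 + 1) (Nat.succ_ne_zero _)
  have h4 : br y (a + (b + 1) + 1 : ℕ) = br y (a + b + 1 + 1 : ℕ) := rfl
  have h5 : br y (a + 1 + b + 1 : ℕ) = br y (a + b + 1 + 1 : ℕ) := by congr 2; omega
  have key : br y (a + 1 : ℕ) * brShift y A (-(b + 1 : ℕ)) +
      br y (b + 1 : ℕ) * brShift y A (a + 1 : ℕ) =
      brShift y A 0 * br y (a + b + 1 + 1 : ℕ) := by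
    simp only [br, brShift, neg_neg, zpow_neg, zpow_natCast, zpow_zero, neg_zero, pow_succ, pow_add]
    field_simp
    ring
  rw [hookW, hookW, hSpec, Finset.prod_div_distrib, Finset.prod_div_distrib, h4, h5,
    Finset.prod_range_succ (fun c => br y (c + 1 : ℕ)) a,
    Finset.prod_range_succ (fun c => br y (c + 1 : ℕ)) b,
    Finset.prod_range_succ (fun c : ℕ => brShift y A c) (a + 1),
    Finset.prod_range_succ (fun c : ℕ => brShift y A (-(c + 1 : ℕ))) b,
    Finset.prod_range_succ' (fun c : ℕ => brShift y A (-c)) b]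
  simp only [Nat.cast_zero, neg_zero]
  generalize ∏ c ∈ Finset.range (a + 1), brShift y A c = u1
  generalize ∏ c ∈ Finset.range b, brShift y A (-(c + 1 : ℕ)) = u2
  rw [div_add_div _ _ (by positivity) (by positivity), div_mul_div_comm,
    div_eq_div_iff (by positivity) (by positivity)]
  generalize ∏ c ∈ Finset.range a, br y (c + 1 : ℕ) = u3
  generalize ∏ c ∈ Finset.range b, br y (c + 1 : ℕ) = u4
  linear_combination u1 * u2 * u3 ^ 2 * u4 ^ 2 * br y (a + b + 1 + 1 : ℕ) *
    br y (a + 1 : ℕ) * br y (b + 1 : ℕ) * key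

/-- Summation by parts over the hooks of size `m`. -/
theorem sum_hSpec_mul_hSpec_inv {y : K} {A : K} (hy : y ≠ 0) (hA : A ≠ 0)
    (hy' : ∀ n : ℕ, n ≠ 0 → br y n ≠ 0) (w : ℕ → K) (n : ℕ) :
    ∑ i ∈ Finset.range (n + 2), w i * (hSpec y A i * hSpec y A⁻¹ (n + 1 - i)) =
      ∑ a ∈ Finset.range (n + 1), (w (a + 1) - w a) * ((-1) ^ (n - a) * hookW y A a (n - a)) := by
  have h0 : hSpec y A 0 = 1 := by simp [hSpec]
  have h0' : hSpec y A⁻¹ 0 = 1 := by simp [hSpec]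
  -- By Pieri's rule every inner term is a difference of neighbouring signed hooks; the end terms i
  -- = 0 and i = n + 1 are single hooks.
  have h1 : ∀ i ∈ Finset.range n, w (i + 1) * (hSpec y A (i + 1) * hSpec y A⁻¹ (n + 1 - (i + 1))) =
      w (i + 1) * ((-1) ^ (n - i) * hookW y A i (n - i)) -
      w (i + 1) * ((-1) ^ (n - (i + 1)) * hookW y A (i + 1) (n - (i + 1))) := by
    intro i hi
    rw [Finset.mem_range] at hi
    obtain ⟨b, rfl⟩ : ∃ b, n = i + (b + 1) := ⟨n - i - 1, by omega⟩
    rw [show i + (b + 1) + 1 - (i + 1) = b + 1 by omega, show i + (b + 1) - i = b + 1 by omega,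
      show i + (b + 1) - (i + 1) = b by omega, hSpec_inv]
    have := hookW_add_hookW hy hA hy' i b
    rw [pow_succ]
    linear_combination w (i + 1) * (-1) ^ b * this
  rw [Finset.sum_range_succ, Finset.sum_range_succ', Finset.sum_congr rfl h1,
    Finset.sum_sub_distrib]
  simp only [sub_mul, Finset.sum_sub_distrib]
  rw [Finset.sum_range_succ (fun a => w (a + 1) * _), Finset.sum_range_succ' (fun a => w a * _),
    h0, Nat.sub_self, Nat.sub_self, Nat.sub_zero, Nat.sub_zero, h0', hookW_zero_right,
    hookW_zero_left, hSpec_inv]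
  ring

end Hooks

/-! ### Closed forms of `𝒵_m` -/

section ExplicitZ

open PowerSeries

theorem qHalf_ne_zero : qHalf ≠ 0 := by
  rw [qHalf, Ne, FaithfulSMul.algebraMap_eq_zero_iff]
  exact MvPolynomial.X_ne_zero _

theorem aHalf_ne_zero : aHalf ≠ 0 := by
  rw [aHalf, Ne, FaithfulSMul.algebraMap_eq_zero_iff]
  exact MvPolynomial.X_ne_zero _

theorem qHalf_pow_ne_one {n : ℕ} (hn : n ≠ 0) : qHalf ^ n ≠ 1 := by
  intro h
  rw [qHalf, ← map_pow, ← map_one (algebraMap (MvPolynomial (Fin 2) ℚ) QA)] at h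
  have h1 := congrArg (MvPolynomial.eval fun _ => (2 : ℚ))
    (FaithfulSMul.algebraMap_injective (MvPolynomial (Fin 2) ℚ) QA h)
  rw [map_pow, MvPolynomial.eval_X, map_one, pow_eq_one_iff_of_nonneg (by norm_num) hn] at h1
  norm_num at h1

theorem bq_eq_br (n : ℤ) : bq n = br qHalf n := rfl

theorem ba_eq_br (n : ℤ) : ba n = br aHalf n := rfl

theorem bq_natCast_ne_zero {n : ℕ} (hn : n ≠ 0) : bq n ≠ 0 := by
  rw [bq, sub_ne_zero, zpow_neg, zpow_natCast]
  intro h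
  apply qHalf_pow_ne_one (n := n + n) (by omega)
  have h1 : qHalf ^ n ≠ 0 := pow_ne_zero _ qHalf_ne_zero
  rw [pow_add]
  nth_rewrite 1 [h]
  exact inv_mul_cancel₀ h1

theorem bq_neg (n : ℤ) : bq (-n) = -bq n := by simp [bq]

theorem bq_ne_zero {n : ℤ} (hn : n ≠ 0) : bq n ≠ 0 := by
  rcases Int.natAbs_eq n with h | h <;> rw [h]
  · exact bq_natCast_ne_zero (by omega)
  · rw [bq_neg, neg_ne_zero]
    exact bq_natCast_ne_zero (by omega)

theorem isNewton_pSpec (A : QA) : IsNewton (pSpec qHalf A) (PowerSeries.mk (hSpec qHalf A)) :=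
  isNewton_hSpec A fun _ hn => bq_natCast_ne_zero hn

theorem prod_map_natCast (s : Multiset ℕ) (f : ℤ → QA) :
    (Multiset.map f (s >>= fun a => pure (a : ℤ))).prod = (s.map fun k : ℕ => f k).prod := by
  simp [Multiset.bind_def, Multiset.pure_def, Multiset.bind_singleton]

/-- For `τ ≠ 0`, `𝒵_m` is a specialization of `h_m`. -/
theorem explicitZ_eq_coeff {τ : ℤ} (hτ : τ ≠ 0) (m : ℕ) {P H : QA⟦X⟧} (h : IsNewton P H)
    (hP : ∀ k : ℕ, k ≠ 0 → coeff k P = bq (m * k * τ) * ba k / bq k) :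
    explicitZ τ m = (-1) ^ ((m : ℤ) * τ) * coeff m H / (bq m * bq (m * τ)) := by
  rw [h.coeff_eq_sum_partition, explicitZ, mul_div_assoc, Finset.sum_div]
  congr 1
  refine Finset.sum_congr rfl fun nu _ => ?_
  have h1 : (nu.parts.map fun k => coeff k P) =
      nu.parts.map fun k : ℕ => bq (m * k * τ) * (ba k / bq k) :=
    Multiset.map_congr rfl fun k hk => by rw [hP k (nu.parts_pos hk).ne', mul_div_assoc]
  rw [h1, Multiset.prod_map_mul, Multiset.prod_map_div, bracketQuot, if_neg hτ]
  simp only [prod_map_natCast, div_eq_mul_inv, mul_inv]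
  ring

theorem explicitZ_zero {m : ℕ} (hm : m ≠ 0) : explicitZ 0 m = ba m / bq m ^ 2 := by
  have hm' : (m : QA) ≠ 0 := by exact_mod_cast hm
  rw [explicitZ, Finset.sum_eq_single (Nat.Partition.indiscrete m)]
  · rw [bracketQuot, if_pos rfl, Nat.Partition.indiscrete_parts hm, Multiset.card_singleton,
      if_pos rfl, prod_map_natCast, prod_map_natCast, Multiset.map_singleton,
      Multiset.map_singleton, Multiset.prod_singleton, Multiset.prod_singleton, zee, Nat.Partition.indiscrete_parts hm]
    simp only [mul_zero, zpow_zero, Multiset.toFinset_singleton, Finset.prod_singleton,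
      Multiset.count_singleton_self, Nat.factorial_one, Multiset.prod_singleton, one_mul]
    field_simp
  · intro nu _ hnu
    rw [bracketQuot, if_pos rfl, if_neg, zero_div, mul_zero, zero_mul]
    intro h
    rw [Multiset.card_eq_one] at h
    obtain ⟨k, hk⟩ := h
    apply hnu
    ext1
    rw [hk, Nat.Partition.indiscrete_parts hm, ← nu.parts_sum, hk, Multiset.sum_singleton]
  · simp

/-- `𝒵_m` as a sum over hooks. -/
theorem explicitZ_eq_sum_hookW (τ : ℤ) (n : ℕ) :
    explicitZ τ (n + 1) = (-1) ^ (((n + 1 : ℕ) : ℤ) * τ) / bq (n + 1 : ℕ) *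
      ∑ a ∈ Finset.range (n + 1), qHalf ^ (((n + 1 : ℕ) : ℤ) * τ * ((a : ℤ) - (n - a : ℕ))) *
        ((-1) ^ (n - a) * hookW qHalf aHalf a (n - a)) := by
  have hN := isNewton_pSpec aHalf
  have hN' := isNewton_pSpec aHalf⁻¹
  rw [pSpec_inv] at hN'
  have hsum := sum_hSpec_mul_hSpec_inv qHalf_ne_zero aHalf_ne_zero
    fun _ hn => bq_natCast_ne_zero hn
  by_cases hτ : τ = 0
  · subst hτ
    rw [explicitZ_zero n.succ_ne_zero]
    -- For τ = 0 the weights are w_i = i, with differences 1: the coefficients of P = t H' · H⁻¹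
    -- become sums over hooks.
    have h1 : PowerSeries.mk (hSpec qHalf aHalf) * PowerSeries.mk (hSpec qHalf aHalf⁻¹) = 1 := by
      have := hN.mul hN'
      rw [add_neg_cancel] at this
      exact this.unique IsNewton.one
    have h2 : X * derivative QA (PowerSeries.mk (hSpec qHalf aHalf)) *
        PowerSeries.mk (hSpec qHalf aHalf⁻¹) = pSpec qHalf aHalf := by
      rw [hN.eq, mul_assoc, h1, mul_one]
    have h3 := congrArg (coeff (n + 1)) h2
    rw [coeff_mul, Finset.Nat.sum_antidiagonal_eq_sum_range_succ (fun i j =>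
      coeff i (X * derivative QA (PowerSeries.mk (hSpec qHalf aHalf))) *
        coeff j (PowerSeries.mk (hSpec qHalf aHalf⁻¹)))] at h3
    simp only [coeff_X_mul_derivative, coeff_mk, mul_assoc] at h3
    rw [hsum (fun i => (i : QA)), pSpec, coeff_mk, ← bq_eq_br, ← ba_eq_br] at h3
    simp only [Nat.cast_succ, add_sub_cancel_left, one_mul] at h3
    simp only [mul_zero, zero_mul, zpow_zero, one_mul, Nat.cast_succ]
    rw [h3]
    ring
  -- Here p_k = (x^k - x^{-k}) {k}_a / {k}, so the series is H(x t) times the inverse of H at t / x.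
  -- The weights x^i x^{-(n+1-i)} have differences x^{a-(n-a)} (x - x⁻¹), and x - x⁻¹ cancels {mτ}.
  · set x : QA := qHalf ^ (((n + 1 : ℕ) : ℤ) * τ) with hx
    have hx0 : x ≠ 0 := zpow_ne_zero _ qHalf_ne_zero
    have hbx : bq (((n + 1 : ℕ) : ℤ) * τ) = x - x⁻¹ := by rw [bq, hx, zpow_neg]
    have hbx0 : x - x⁻¹ ≠ 0 := by
      rw [← hbx]
      exact bq_ne_zero (mul_ne_zero (by exact_mod_cast n.succ_ne_zero) hτ)
    rw [explicitZ_eq_coeff hτ (n + 1) ((hN.rescale x).mul (hN'.rescale x⁻¹)), coeff_mul,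
      Finset.Nat.sum_antidiagonal_eq_sum_range_succ (fun i j =>
      coeff i (rescale x (PowerSeries.mk (hSpec qHalf aHalf))) *
        coeff j (rescale x⁻¹ (PowerSeries.mk (hSpec qHalf aHalf⁻¹))))]
    · have h1 := hsum (fun i => x ^ i * x⁻¹ ^ (n + 1 - i)) n
      have h2 : ∀ i : ℕ, coeff i (rescale x (PowerSeries.mk (hSpec qHalf aHalf))) *
          coeff (n + 1 - i) (rescale x⁻¹ (PowerSeries.mk (hSpec qHalf aHalf⁻¹))) =
          x ^ i * x⁻¹ ^ (n + 1 - i) * (hSpec qHalf aHalf i * hSpec qHalf aHalf⁻¹ (n + 1 - i)) := by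
        intro i
        rw [coeff_rescale, coeff_rescale, coeff_mk, coeff_mk]
        ring
      rw [Finset.sum_congr rfl fun i _ => h2 i, h1]
      have h3 : ∀ a ∈ Finset.range (n + 1), (x ^ (a + 1) * x⁻¹ ^ (n + 1 - (a + 1)) -
          x ^ a * x⁻¹ ^ (n + 1 - a)) * ((-1) ^ (n - a) * hookW qHalf aHalf a (n - a)) =
          (x - x⁻¹) * (qHalf ^ (((n + 1 : ℕ) : ℤ) * τ * ((a : ℤ) - (n - a : ℕ))) *
            ((-1) ^ (n - a) * hookW qHalf aHalf a (n - a))) := by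
        intro a ha
        rw [Finset.mem_range] at ha
        rw [zpow_mul, ← hx, zpow_sub₀ hx0, zpow_natCast, zpow_natCast,
          show n + 1 - (a + 1) = n - a by omega, show n + 1 - a = n - a + 1 by omega, pow_succ x,
          pow_succ x⁻¹, inv_pow]
        ring
      rw [Finset.sum_congr rfl h3, ← Finset.mul_sum, hbx]
      generalize x - x⁻¹ = u at hbx0
      field_simp
    · intro k hk
      have hb : bq (((n + 1 : ℕ) : ℤ) * k * τ) = x ^ k - x⁻¹ ^ k := by
        rw [bq, zpow_neg, mul_right_comm, zpow_mul, ← hx, zpow_natCast, inv_pow]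
      rw [map_add, coeff_rescale, coeff_rescale, map_neg, pSpec, coeff_mk, hb, ← bq_eq_br,
        ← ba_eq_br]
      ring

end ExplicitZ

/-! ### Power sum expansions of symmetric power series -/

section PowerSums

open MvPowerSeries

/-- The product of the power sums of the elements of a multiset. -/
noncomputable def powerSumM (s : Multiset ℕ) : MvPowerSeries ℕ QA := (s.map powerSum).prod

/-- The power sum with natural number coefficients. -/
noncomputable def powerSumNat (k : ℕ) : MvPowerSeries ℕ ℕ :=
  open Classical in fun α => if ∃ i, α = Finsupp.single i k then 1 else 0

open Classical in
theorem coeff_powerSum (k : ℕ) (α : ℕ →₀ ℕ) :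
    coeff α (powerSum k) = if ∃ i, α = Finsupp.single i k then 1 else 0 := rfl

open Classical in
theorem coeff_powerSumNat (k : ℕ) (α : ℕ →₀ ℕ) :
    coeff α (powerSumNat k) = if ∃ i, α = Finsupp.single i k then 1 else 0 := rfl

theorem map_powerSumNat (k : ℕ) :
    MvPowerSeries.map (Nat.castRingHom QA) (powerSumNat k) = powerSum k := by
  ext α
  rw [coeff_map, coeff_powerSum, coeff_powerSumNat]
  split_ifs <;> simp

theorem coeff_powerSumM (s : Multiset ℕ) (α : ℕ →₀ ℕ) :
    coeff α (powerSumM s) = ((coeff α (s.map powerSumNat).prod : ℕ) : QA) := by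
  have h : powerSumM s = MvPowerSeries.map (Nat.castRingHom QA) (s.map powerSumNat).prod := by
    rw [map_multiset_prod, Multiset.map_map, powerSumM]
    congr 1
    exact Multiset.map_congr rfl fun k _ => (map_powerSumNat k).symm
  rw [h, coeff_map]
  rfl

/-- The multiset of the nonzero exponents. -/
def shape (α : ℕ →₀ ℕ) : Multiset ℕ := α.support.val.map α

theorem card_shape (α : ℕ →₀ ℕ) : Multiset.card (shape α) = α.support.card := by
  rw [shape, Multiset.card_map]
  rfl

theorem sum_shape (α : ℕ →₀ ℕ) : (shape α).sum = Finsupp.degree α := by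
  rw [Finsupp.degree_apply]
  rfl

theorem support_single_add {i k : ℕ} (hk : k ≠ 0) (α : ℕ →₀ ℕ) :
    (Finsupp.single i k + α).support = insert i α.support := by
  ext j
  rw [Finset.mem_insert, Finsupp.mem_support_iff, Finsupp.mem_support_iff, Finsupp.add_apply,
    Finsupp.single_apply]
  split_ifs with h
  · simp [h, hk]
  · simp [Ne.symm h]

theorem shape_single_add {i k : ℕ} (hk : k ≠ 0) {α : ℕ →₀ ℕ} (hi : i ∉ α.support) :
    shape (Finsupp.single i k + α) = k ::ₘ shape α := by
  rw [shape, support_single_add hk, Finset.insert_val_of_notMem hi, Multiset.map_cons]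
  congr 1
  · rw [Finsupp.notMem_support_iff] at hi
    simp [hi]
  · refine Multiset.map_congr rfl fun j hj => ?_
    have : i ≠ j := by rintro rfl; exact hi hj
    simp [this]

theorem exists_shape_eq (s : Multiset ℕ) (hs : ∀ k ∈ s, 0 < k) : ∃ α, shape α = s := by
  induction s using Multiset.induction_on with
  | empty => exact ⟨0, by simp [shape]⟩
  | cons k s ih =>
    obtain ⟨α, rfl⟩ := ih fun j hj => hs j (Multiset.mem_cons_of_mem hj)
    obtain ⟨i, hi⟩ := Infinite.exists_notMem_finset α.support
    exact ⟨_, shape_single_add (hs k (Multiset.mem_cons_self _ _)).ne' hi⟩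

/-- A monomial of p_s comes from choosing one variable for each part. Coinciding choices merge
parts, so the number of variables reaches the number of parts only when nothing merges. This is the
triangularity behind linear independence. -/
theorem card_support_le_of_coeff_ne_zero (s : Multiset ℕ) (hs : ∀ k ∈ s, 0 < k) (α : ℕ →₀ ℕ)
    (h : coeff α (s.map powerSumNat).prod ≠ 0) :
    Finsupp.degree α = s.sum ∧ α.support.card ≤ Multiset.card s ∧
      (α.support.card = Multiset.card s → shape α = s) := by
  induction s using Multiset.induction_on generalizing α with
  | empty =>
    classical
    rw [Multiset.map_zero, Multiset.prod_zero, coeff_one] at h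
    have : α = 0 := by by_contra h1; exact h (if_neg h1)
    subst this
    simp [shape]
  | cons k s ih =>
    rw [Multiset.map_cons, Multiset.prod_cons, coeff_mul] at h
    obtain ⟨⟨β, γ⟩, hβγ, hne⟩ := Finset.exists_ne_zero_of_sum_ne_zero h
    rw [Finset.HasAntidiagonal.mem_antidiagonal] at hβγ
    simp only at hβγ hne
    obtain ⟨i, rfl⟩ : ∃ i, β = Finsupp.single i k := by
      by_contra h1
      apply left_ne_zero_of_mul hne
      rw [coeff_powerSumNat, if_neg h1]
    have hk := (hs k (Multiset.mem_cons_self _ _)).ne'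
    obtain ⟨h1, h2, h3⟩ := ih (fun j hj => hs j (Multiset.mem_cons_of_mem hj)) γ
      (right_ne_zero_of_mul hne)
    subst hβγ
    rw [map_add, Finsupp.degree_single, h1, Multiset.sum_cons, support_single_add hk,
      Multiset.card_cons]
    refine ⟨rfl, (Finset.card_insert_le _ _).trans (by omega), fun h4 => ?_⟩
    have hi : i ∉ γ.support := fun hi => by rw [Finset.insert_eq_of_mem hi] at h4; omega
    rw [Finset.card_insert_of_notMem hi] at h4
    rw [shape_single_add hk hi, h3 (by omega)]

/-- Over ℕ nothing cancels, so a single nonzero term of the product is enough. -/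
theorem coeff_prod_powerSumNat_shape_ne_zero (s : Multiset ℕ) (α : ℕ →₀ ℕ) (h : shape α = s) :
    coeff α (s.map powerSumNat).prod ≠ 0 := by
  induction s using Multiset.induction_on generalizing α with
  | empty =>
    have : α = 0 := by
      rw [← Finsupp.support_eq_empty, ← Finset.card_eq_zero, ← card_shape, h, Multiset.card_zero]
    subst this
    simp
  | cons k s ih =>
    obtain ⟨i, hi, rfl⟩ := Multiset.mem_map.1 (h ▸ Multiset.mem_cons_self k s : k ∈ shape α)
    have hi' : α i ≠ 0 := Finsupp.mem_support_iff.1 hi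
    have hα : Finsupp.single i (α i) + α.erase i = α := Finsupp.single_add_erase i α
    have h1 : shape (α.erase i) = s := by
      have h2 := shape_single_add hi' (α := α.erase i) (i := i) (by simp)
      rw [hα, h, Multiset.cons_inj_right] at h2
      exact h2.symm
    rw [Multiset.map_cons, Multiset.prod_cons, coeff_mul]
    have hmem : (Finsupp.single i (α i), α.erase i) ∈ Finset.HasAntidiagonal.antidiagonal α := by
      rw [Finset.HasAntidiagonal.mem_antidiagonal]; exact hα
    have h3 := Finset.single_le_sum (f := fun p : (ℕ →₀ ℕ) × (ℕ →₀ ℕ) =>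
      coeff p.1 (powerSumNat (α i)) * coeff p.2 (s.map powerSumNat).prod)
      (fun _ _ => Nat.zero_le _) hmem
    have h4 : coeff (Finsupp.single i (α i)) (powerSumNat (α i)) = 1 := by
      rw [coeff_powerSumNat, if_pos ⟨i, rfl⟩]
    simp only [h4, one_mul] at h3
    have := ih _ h1
    omega

theorem degree_eq_of_coeff_powerSumM_ne_zero {s : Multiset ℕ} (hs : ∀ k ∈ s, 0 < k) {α : ℕ →₀ ℕ}
    (h : coeff α (powerSumM s) ≠ 0) : Finsupp.degree α = s.sum := by
  rw [coeff_powerSumM, Nat.cast_ne_zero] at h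
  exact (card_support_le_of_coeff_ne_zero s hs α h).1

/-- The `p_μ` with `|μ| = n` are linearly independent. -/
theorem eq_zero_of_sum_powerSumP {n : ℕ} (c : n.Partition → QA)
    (h : ∀ α : ℕ →₀ ℕ, Finsupp.degree α = n → ∑ mu, c mu * coeff α (powerSumP mu) = 0) :
    c = 0 := by
  by_contra hc
  obtain ⟨mu1, hmu1⟩ := Function.ne_iff.1 hc
  classical
  -- With the maximal number of parts among the μ with c_μ ≠ 0, a monomial of shape μ occurs in no
  -- other p_ν with c_ν ≠ 0.
  obtain ⟨mu, hmu, hmax⟩ := Finset.exists_max_image (Finset.univ.filter fun mu => c mu ≠ 0)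
    (fun mu : n.Partition => Multiset.card mu.parts) ⟨mu1, by simpa using hmu1⟩
  rw [Finset.mem_filter] at hmu
  obtain ⟨α, hα⟩ := exists_shape_eq mu.parts fun k hk => mu.parts_pos hk
  have h1 := h α (by rw [← sum_shape, hα, mu.parts_sum])
  rw [Finset.sum_eq_single mu] at h1
  · refine mul_ne_zero hmu.2 ?_ h1
    change coeff α (powerSumM _) ≠ 0
    rw [coeff_powerSumM, Nat.cast_ne_zero]
    exact coeff_prod_powerSumNat_shape_ne_zero _ _ hα
  · intro nu _ hne
    by_contra h2
    have h3 : coeff α (powerSumM nu.parts) ≠ 0 := right_ne_zero_of_mul h2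
    rw [coeff_powerSumM, Nat.cast_ne_zero] at h3
    obtain ⟨-, h4, h5⟩ := card_support_le_of_coeff_ne_zero _ (fun k hk => nu.parts_pos hk) α h3
    have h6 := hmax nu (by simpa using left_ne_zero_of_mul h2)
    rw [← card_shape, hα] at h4 h5
    exact hne (Nat.Partition.ext (h5 (le_antisymm h4 h6)).symm)
  · simp

/-- The substitution of the power sum `p_{k+1}` for the `k`-th variable. -/
noncomputable def powerSumVar (k : ℕ) : MvPowerSeries ℕ QA := powerSum (k + 1)

/-- Infinitely many variables may be substituted because x^α occurs in p_{k+1} only if k + 1 = |α|.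
-/
theorem hasSubst_powerSumVar : HasSubst powerSumVar where
  const_coeff k := by
    rw [← coeff_zero_eq_constantCoeff_apply, powerSumVar, coeff_powerSum, if_neg]
    · exact IsNilpotent.zero
    · rintro ⟨i, hi⟩
      have := congrArg Finsupp.degree hi
      rw [Finsupp.degree_single] at this
      simp at this
  coeff_zero α := by
    refine Set.Finite.subset (Set.finite_singleton (Finsupp.degree α - 1)) fun k hk => ?_
    rw [Set.mem_ofPred_eq, powerSumVar, coeff_powerSum] at hk
    have h1 : ∃ i, α = Finsupp.single i (k + 1) := by by_contra h; exact hk (if_neg h)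
    obtain ⟨i, rfl⟩ := h1
    simp

/-- The multiset of parts of the monomial `∏ p_{k+1}^{d_k}`. -/
noncomputable def partsOf (d : ℕ →₀ ℕ) : Multiset ℕ := (Finsupp.toMultiset d).map Nat.succ

/-- The exponent vector of the monomial `p_s`. -/
noncomputable def expOf (s : Multiset ℕ) : ℕ →₀ ℕ := Multiset.toFinsupp (s.map Nat.pred)

theorem partsOf_expOf {s : Multiset ℕ} (hs : ∀ k ∈ s, 0 < k) : partsOf (expOf s) = s := by
  rw [partsOf, expOf, Multiset.toFinsupp_toMultiset, Multiset.map_map]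
  conv_rhs => rw [← Multiset.map_id s]
  exact Multiset.map_congr rfl fun k hk => Nat.succ_pred_eq_of_pos (hs k hk)

theorem expOf_partsOf (d : ℕ →₀ ℕ) : expOf (partsOf d) = d := by
  rw [partsOf, expOf, Multiset.map_map]
  simp

theorem partsOf_pos {d : ℕ →₀ ℕ} : ∀ k ∈ partsOf d, 0 < k := by
  intro k hk
  obtain ⟨j, -, rfl⟩ := Multiset.mem_map.1 hk
  exact Nat.succ_pos j

theorem prod_powerSumVar (d : ℕ →₀ ℕ) :
    (d.prod fun k e => powerSumVar k ^ e) = powerSumM (partsOf d) := by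
  rw [powerSumM, partsOf, Multiset.map_map, Finsupp.toMultiset_apply, Finsupp.sum, Finsupp.prod,
    ← Multiset.coe_mapAddMonoidHom, map_sum, Multiset.prod_sum]
  refine Finset.prod_congr rfl fun k _ => ?_
  rw [Multiset.coe_mapAddMonoidHom, Multiset.map_nsmul, Multiset.prod_nsmul, Multiset.map_singleton, Multiset.prod_singleton]
  rfl

/-- By homogeneity only monomials of weight |α| contribute, and these correspond to the partitions
of |α|. Thus a preimage under the substitution yields a power sum expansion. -/
theorem coeff_subst_powerSumVar (f : MvPowerSeries ℕ QA) (α : ℕ →₀ ℕ) :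
    coeff α (subst powerSumVar f) =
      ∑ mu : (Finsupp.degree α).Partition, coeff (expOf mu.parts) f * coeff α (powerSumP mu) := by
  classical
  have hinj : Function.Injective fun mu : (Finsupp.degree α).Partition => expOf mu.parts := by
    intro mu nu h
    ext1
    rw [← partsOf_expOf fun k hk => mu.parts_pos hk, ← partsOf_expOf fun k hk => nu.parts_pos hk]
    exact congrArg partsOf h
  rw [coeff_subst hasSubst_powerSumVar, finsum_eq_sum_of_support_subset _
    (s := Finset.univ.image fun mu : (Finsupp.degree α).Partition => expOf mu.parts),
    Finset.sum_image fun _ _ _ _ h => hinj h]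
  · refine Finset.sum_congr rfl fun mu _ => ?_
    rw [prod_powerSumVar, partsOf_expOf fun k hk => mu.parts_pos hk, smul_eq_mul]
    rfl
  · intro d hd
    rw [Function.mem_support, prod_powerSumVar, smul_eq_mul] at hd
    have h1 := degree_eq_of_coeff_powerSumM_ne_zero partsOf_pos (right_ne_zero_of_mul hd)
    rw [Finset.coe_image, Finset.coe_univ, Set.image_univ]
    exact ⟨⟨partsOf d, fun hk => partsOf_pos _ hk, h1.symm⟩, expOf_partsOf d⟩

end PowerSums

/-! ### Complete symmetric functions -/

section CompleteH

open MvPowerSeries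

theorem coeff_completeH (k : ℤ) (α : ℕ →₀ ℕ) :
    coeff α (completeH k) = if ((Finsupp.degree α : ℕ) : ℤ) = k then 1 else 0 := rfl

theorem coeff_powerSum_mul {k : ℕ} (hk : k ≠ 0) (f : MvPowerSeries ℕ QA) (α : ℕ →₀ ℕ) :
    coeff α (powerSum k * f) =
      ∑ i ∈ α.support with k ≤ α i, coeff (α - Finsupp.single i k) f := by
  classical
  rw [coeff_mul]
  symm
  refine Finset.sum_of_injOn (fun i => (Finsupp.single i k, α - Finsupp.single i k)) ?_ ?_ ?_ ?_
  · intro i _ j _ h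
    exact Finsupp.single_left_injective hk (Prod.ext_iff.1 h).1
  · intro i hi
    rw [Finset.mem_coe, Finset.mem_filter] at hi
    rw [Finset.mem_coe, Finset.HasAntidiagonal.mem_antidiagonal]
    exact add_tsub_cancel_of_le (Finsupp.single_le_iff.2 hi.2)
  · rintro ⟨β, γ⟩ h1 h2
    rw [Finset.HasAntidiagonal.mem_antidiagonal] at h1
    rw [coeff_powerSum, if_neg, zero_mul]
    rintro ⟨i, rfl⟩
    simp only at h1
    subst h1
    refine h2 ⟨i, ?_, by simp⟩
    rw [Finset.mem_coe, Finset.mem_filter, support_single_add hk]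
    simp
  · intro i _
    rw [coeff_powerSum, if_pos ⟨i, rfl⟩, one_mul]

/-- Newton's identity for the complete symmetric functions. -/
theorem isNewton_completeH :
    IsNewton (PowerSeries.mk fun k => if k = 0 then 0 else powerSum k)
      (PowerSeries.mk fun n : ℕ => completeH n) := by
  have h0 : completeH (0 : ℕ) = 1 := by
    classical
    ext α
    rw [coeff_completeH, coeff_one]
    simp [Finsupp.degree_eq_zero_iff]
  refine ⟨?_, by rw [← PowerSeries.coeff_zero_eq_constantCoeff_apply, PowerSeries.coeff_mk, h0]⟩
  ext1 n
  rw [coeff_X_mul_derivative, PowerSeries.coeff_mul,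
    Finset.Nat.sum_antidiagonal_eq_sum_range_succ (fun i j =>
      PowerSeries.coeff i (PowerSeries.mk fun k => if k = 0 then 0 else powerSum k) *
      PowerSeries.coeff j (PowerSeries.mk fun n : ℕ => completeH n))]
  simp only [PowerSeries.coeff_mk]
  ext α
  rw [map_sum, ← map_natCast (MvPowerSeries.C (σ := ℕ) (R := QA)), coeff_C_mul, coeff_completeH]
  have h1 : ∀ k ∈ Finset.range (n + 1),
      coeff α ((if k = 0 then 0 else powerSum k) * completeH (n - k : ℕ)) =
      ((∑ i ∈ α.support, if k ≠ 0 ∧ k ≤ α i ∧ Finsupp.degree α = n then 1 else 0 : ℕ) : QA) := by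
    intro k hk
    rw [Finset.mem_range] at hk
    by_cases hk0 : k = 0
    · simp [hk0]
    · rw [if_neg hk0, coeff_powerSum_mul hk0, Finset.sum_filter]
      push_cast
      refine Finset.sum_congr rfl fun i _ => ?_
      by_cases hki : k ≤ α i
      · have h2 : Finsupp.degree (α - Finsupp.single i k) + k = Finsupp.degree α := by
          have := congrArg Finsupp.degree
            (tsub_add_cancel_of_le (Finsupp.single_le_iff.2 hki))
          rwa [map_add, Finsupp.degree_single] at this
        rw [if_pos hki, coeff_completeH]
        by_cases hd : Finsupp.degree α = n
        · rw [if_pos (by omega), if_pos ⟨hk0, hki, hd⟩]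
        · rw [if_neg (by omega), if_neg (fun h => hd h.2.2)]
      · rw [if_neg hki, if_neg (fun h => hki h.2.1)]
  -- Counted with i outside, the pairs (i, k) with 1 ≤ k ≤ α_i number ∑ α_i = |α|, which is n in the
  -- only degree that matters.
  rw [Finset.sum_congr rfl h1, ← Nat.cast_sum, Finset.sum_comm]
  by_cases hd : Finsupp.degree α = n
  · have h2 : ∀ i ∈ α.support, (∑ k ∈ Finset.range (n + 1),
        if k ≠ 0 ∧ k ≤ α i ∧ Finsupp.degree α = n then 1 else 0) = α i := by
      intro i _
      have h3 : α i ≤ n := hd ▸ Finsupp.le_degree i α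
      rw [← Finset.card_filter]
      have h4 : (Finset.range (n + 1)).filter
          (fun k => k ≠ 0 ∧ k ≤ α i ∧ Finsupp.degree α = n) = Finset.Icc 1 (α i) := by
        ext k
        simp only [Finset.mem_filter, Finset.mem_range, Finset.mem_Icc]
        omega
      rw [h4, Nat.card_Icc, Nat.add_sub_cancel]
    rw [Finset.sum_congr rfl h2, ← Finsupp.degree_apply, hd, if_pos rfl, mul_one]
  · have h2 : ∀ i ∈ α.support, (∑ k ∈ Finset.range (n + 1),
        if k ≠ 0 ∧ k ≤ α i ∧ Finsupp.degree α = n then 1 else 0) = 0 :=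
      fun i _ => Finset.sum_eq_zero fun k _ => if_neg fun h => hd h.2.2
    rw [Finset.sum_congr rfl h2, if_neg (by exact_mod_cast hd)]
    simp

/-- `h_k`, as a power series in the power sums. -/
noncomputable def completeHP (k : ℤ) : MvPowerSeries ℕ QA :=
  fun d => if ((partsOf d).sum : ℤ) = k then 1 / (zeeMultiset (partsOf d) : QA) else 0

theorem coeff_completeHP (k : ℤ) (d : ℕ →₀ ℕ) : coeff d (completeHP k) =
    if ((partsOf d).sum : ℤ) = k then 1 / (zeeMultiset (partsOf d) : QA) else 0 := rfl

theorem subst_completeHP (k : ℤ) : subst powerSumVar (completeHP k) = completeH k := by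
  ext α
  rw [coeff_subst_powerSumVar, coeff_completeH]
  have h1 : ∀ mu : (Finsupp.degree α).Partition, coeff (expOf mu.parts) (completeHP k) =
      if ((Finsupp.degree α : ℕ) : ℤ) = k then 1 / (zee mu : QA) else 0 := by
    intro mu
    rw [coeff_completeHP, partsOf_expOf fun k hk => mu.parts_pos hk, mu.parts_sum]
    rfl
  simp only [h1]
  split_ifs with hk
  · have h2 := congrArg (coeff α) (isNewton_completeH.coeff_eq_sum_partition' (Finsupp.degree α))
    rw [PowerSeries.coeff_mk, coeff_completeH, if_pos rfl, map_sum] at h2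
    refine Eq.trans (Finset.sum_congr rfl fun mu _ => ?_) h2.symm
    rw [MvPowerSeries.algebraMap_apply, coeff_C_mul]
    congr 1
    · simp
    · rw [powerSumP]
      congr 2
      refine Multiset.map_congr rfl fun k hk => ?_
      rw [PowerSeries.coeff_mk, if_neg (mu.parts_pos hk).ne']
  · simp

end CompleteH

/-! ### The free energy as a power series in the power sums -/

section FreeEnergy

open MvPowerSeries

/-- `s_λ`, as a power series in the power sums. -/
noncomputable def schurP {n : ℕ} (lam : n.Partition) : MvPowerSeries ℕ QA :=
  Matrix.det (Matrix.of fun i j : Fin lam.parts.card =>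
    completeHP ((row lam i : ℤ) - (i : ℤ) + (j : ℤ)))

theorem subst_schurP {n : ℕ} (lam : n.Partition) : subst powerSumVar (schurP lam) = schur lam := by
  rw [← substAlgHom_apply hasSubst_powerSumVar, schurP, AlgHom.map_det, schur]
  congr 1
  ext1 i j
  rw [AlgHom.mapMatrix_apply, Matrix.map_apply, Matrix.of_apply, Matrix.of_apply,
    substAlgHom_apply, subst_completeHP]

/-- The component of degree `n` of the partition function. -/
noncomputable def csComponentP (τ : ℤ) (n : ℕ) : MvPowerSeries ℕ QA :=
  ∑ lam : n.Partition, C (framedH τ lam) * schurP lam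

/-- The partition function, as a power series in the power sums. -/
noncomputable def csPartitionFunctionP (τ : ℤ) : MvPowerSeries ℕ QA :=
  fun d => coeff d (csComponentP τ (partsOf d).sum)

theorem coeff_csPartitionFunctionP (τ : ℤ) (d : ℕ →₀ ℕ) :
    coeff d (csPartitionFunctionP τ) = coeff d (csComponentP τ (partsOf d).sum) := rfl

theorem subst_csPartitionFunctionP (τ : ℤ) :
    subst powerSumVar (csPartitionFunctionP τ) = csPartitionFunction τ := by
  ext α
  rw [coeff_subst_powerSumVar]
  have h1 : ∀ mu : (Finsupp.degree α).Partition, coeff (expOf mu.parts) (csPartitionFunctionP τ) =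
      coeff (expOf mu.parts) (csComponentP τ (Finsupp.degree α)) := by
    intro mu
    rw [coeff_csPartitionFunctionP, partsOf_expOf fun k hk => mu.parts_pos hk, mu.parts_sum]
  simp only [h1]
  rw [← coeff_subst_powerSumVar, csComponentP, ← substAlgHom_apply hasSubst_powerSumVar, map_sum,
    map_sum]
  change _ = ∑ lam : (Finsupp.degree α).Partition, _
  refine Finset.sum_congr rfl fun lam _ => ?_
  rw [map_mul, substAlgHom_apply, substAlgHom_apply, subst_schurP, subst_C, coeff_C_mul]

theorem constantCoeff_csPartitionFunctionP (τ : ℤ) :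
    constantCoeff (csPartitionFunctionP τ) = 1 := by
  rw [← coeff_zero_eq_constantCoeff_apply, coeff_csPartitionFunctionP]
  have h : (partsOf 0).sum = 0 := by simp [partsOf]
  rw [h, csComponentP, Fintype.sum_unique, coeff_C_mul, schurP]
  have h2 : ((default : (0 : ℕ).Partition).parts).card = 0 := by simp
  have : IsEmpty (Fin ((default : (0 : ℕ).Partition).parts).card) := by rw [h2]; infer_instance
  rw [Matrix.det_isEmpty]
  simp [framedH, kappa, unknotW]

/-- The free energy, as a power series in the power sums. -/
noncomputable def csFreeEnergyP (τ : ℤ) : MvPowerSeries ℕ QA :=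
  PowerSeries.subst (csPartitionFunctionP τ - 1) (PowerSeries.log QA)

theorem hasSubst_csPartitionFunctionP (τ : ℤ) :
    PowerSeries.HasSubst (csPartitionFunctionP τ - 1) :=
  PowerSeries.HasSubst.of_constantCoeff_zero
    (by rw [map_sub, constantCoeff_csPartitionFunctionP, map_one, sub_self])

/-- Substitutions compose, so the logarithm may be taken before or after inserting the power sums.
-/
theorem subst_csFreeEnergyP (τ : ℤ) : subst powerSumVar (csFreeEnergyP τ) = csFreeEnergy τ := by
  rw [csFreeEnergyP, csFreeEnergy, PowerSeries.subst, PowerSeries.subst,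
    subst_comp_subst_apply (hasSubst_csPartitionFunctionP τ).const hasSubst_powerSumVar]
  congr 1
  funext _
  rw [subst_sub hasSubst_powerSumVar, subst_csPartitionFunctionP,
    ← substAlgHom_apply hasSubst_powerSumVar, map_one]

/-- The coefficients of the power sum expansion of the free energy. -/
noncomputable def freeEnergyCoeff (τ : ℤ) (n : ℕ) (mu : n.Partition) : QA :=
  coeff (expOf mu.parts) (csFreeEnergyP τ)

/-- Existence comes from the lift of the free energy, uniqueness from the linear independence of the
p_μ in each degree. -/
theorem isPowerSumExpansion_iff (τ : ℤ) (F : (n : ℕ) → n.Partition → QA) :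
    IsPowerSumExpansion τ F ↔ F = freeEnergyCoeff τ := by
  have h : ∀ α : ℕ →₀ ℕ, coeff α (csFreeEnergy τ) =
      ∑ mu : (Finsupp.degree α).Partition, freeEnergyCoeff τ _ mu * coeff α (powerSumP mu) := by
    intro α
    rw [← subst_csFreeEnergyP, coeff_subst_powerSumVar]
    rfl
  constructor
  · intro hF
    funext n
    rw [← sub_eq_zero]
    refine eq_zero_of_sum_powerSumP _ ?_
    rintro α rfl
    have h1 := (hF α).symm.trans (h α)
    simp only [Pi.sub_apply, sub_mul, Finset.sum_sub_distrib]
    rw [h1, sub_self]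
  · rintro rfl
    exact h

theorem coeff_single_one_mul (j : ℕ) (f g : MvPowerSeries ℕ QA) :
    coeff (Finsupp.single j 1) (f * g) =
      constantCoeff f * coeff (Finsupp.single j 1) g +
      coeff (Finsupp.single j 1) f * constantCoeff g := by
  classical
  rw [coeff_mul, Finsupp.antidiagonal_single, Finset.sum_map]
  simp [Finset.Nat.antidiagonal_succ]

/-- The part of degree at most one in the `j`-th variable. -/
noncomputable def linPart (j : ℕ) : MvPowerSeries ℕ QA →+* DualNumber QA where
  toFun f := TrivSqZeroExt.inl (constantCoeff f) +
    TrivSqZeroExt.inr (coeff (Finsupp.single j 1) f)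
  map_one' := by
    classical
    ext <;> simp [coeff_one]
  map_zero' := by ext <;> simp
  map_add' f g := by ext <;> simp
  map_mul' f g := by
    ext
    · simp
    · simp [coeff_single_one_mul, mul_comm]

theorem fst_linPart (j : ℕ) (f : MvPowerSeries ℕ QA) :
    (linPart j f).fst = constantCoeff f := by simp [linPart]

theorem snd_linPart (j : ℕ) (f : MvPowerSeries ℕ QA) :
    (linPart j f).snd = coeff (Finsupp.single j 1) f := by simp [linPart]

/-- The powers Y^n with n ≥ 2 have no term linear in a single variable, and the linear coefficient
of the logarithm is 1. -/
theorem coeff_single_one_log {Y : MvPowerSeries ℕ QA} (hY : constantCoeff Y = 0) (j : ℕ) :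
    coeff (Finsupp.single j 1) (PowerSeries.subst Y (PowerSeries.log QA)) =
      coeff (Finsupp.single j 1) Y := by
  rw [PowerSeries.coeff_subst (PowerSeries.HasSubst.of_constantCoeff_zero hY),
    finsum_eq_single _ 1]
  · rw [PowerSeries.coeff_one_log, one_smul, pow_one]
  · intro n hn
    rcases n with _ | _ | n
    · simp
    · simp at hn
    · rw [pow_succ, coeff_single_one_mul, hY, mul_zero, add_zero, pow_succ, map_mul, hY, mul_zero,
        zero_mul, smul_zero]

/-- The variable with index n stands for p_{n+1}; besides 1 it is the only monomial that survives,
with 𝔷 = n + 1. -/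
theorem linPart_completeHP (n : ℕ) (k : ℤ) : linPart n (completeHP k) =
    if k = 0 then 1 else if k = n + 1 then TrivSqZeroExt.inr (1 / (n + 1 : QA)) else 0 := by
  have h0 : (partsOf 0) = 0 := by simp [partsOf]
  have h1 : partsOf (Finsupp.single n 1) = {n + 1} := by simp [partsOf]
  ext
  · rw [fst_linPart, ← coeff_zero_eq_constantCoeff_apply, coeff_completeHP, h0]
    rcases eq_or_ne k 0 with rfl | hk
    · simp [zeeMultiset]
    · rw [if_neg (by simpa using hk.symm), if_neg hk]
      split_ifs <;> simp
  · rw [snd_linPart, coeff_completeHP, h1, Multiset.sum_singleton]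
    rcases eq_or_ne k 0 with rfl | hk
    · rw [if_neg (by omega)]
      simp
    · rw [if_neg hk]
      by_cases hkn : k = n + 1
      · rw [if_pos (by simp [hkn]), if_pos hkn]
        simp [zeeMultiset]
      · rw [if_neg (by push_cast; exact fun h => hkn h.symm), if_neg hkn]
        simp

end FreeEnergy

/-! ### Hooks -/

section HookSum

open TrivSqZeroExt

/-- A determinant over the dual numbers with two infinitesimal rows vanishes. -/
theorem det_eq_zero_of_two_rows {l : ℕ} (M : Matrix (Fin l) (Fin l) (DualNumber QA))
    (i i' : Fin l) (hii : i ≠ i') (h : ∀ j, (M i j).fst = 0) (h' : ∀ j, (M i' j).fst = 0) :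
    M.det = 0 := by
  rw [← Matrix.det_transpose, Matrix.det_apply']
  refine Finset.sum_eq_zero fun σ _ => ?_
  rw [← Finset.mul_prod_erase _ _ (Finset.mem_univ i),
    ← Finset.mul_prod_erase _ _ (Finset.mem_erase.2 ⟨hii.symm, Finset.mem_univ i'⟩), ← mul_assoc (M.transpose (σ i) i)]
  have h1 : M.transpose (σ i) i * M.transpose (σ i') i' = 0 := by
    ext
    · simp [h]
    · simp [h, h']
  rw [h1, zero_mul, mul_zero]

/-- The form of the Jacobi–Trudi matrix of a hook over the dual numbers. The first row has its only
entry in the last column, and the complementary minor is an identity matrix. -/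
theorem det_hook {b : ℕ} (x : DualNumber QA) (M : Matrix (Fin (b + 1)) (Fin (b + 1)) (DualNumber QA))
    (h0 : ∀ j : Fin (b + 1), M 0 j = if (j : ℕ) = b then x else 0)
    (h1 : ∀ (i : Fin b) (j : Fin (b + 1)), M i.succ j = if (j : ℕ) = i then 1 else 0) :
    M.det = (-1) ^ b * x := by
  rw [Matrix.det_succ_row_zero, Finset.sum_eq_single (Fin.last b)]
  · have h2 : M.submatrix Fin.succ (Fin.last b).succAbove = 1 := by
      ext1 i j
      rw [Matrix.submatrix_apply, h1, Fin.succAbove_last, Fin.val_castSucc, Matrix.one_apply]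
      simp only [Fin.ext_iff, eq_comm]
    rw [h2, Matrix.det_one, h0, Fin.val_last, if_pos rfl, mul_one]
  · intro j _ hj
    rw [h0, if_neg (show ¬ (j : ℕ) = b from fun h => hj (Fin.ext h)), mul_zero, zero_mul]
  · simp

/-- The hook `(a + 1, 1^(n-a))`. -/
def hookPartition (n a : ℕ) : (n + 1).Partition where
  -- The minimum makes this a partition of n + 1 for every a; only a ≤ n is meaningful.
  parts := (min a n + 1) ::ₘ Multiset.replicate (n - a) 1
  parts_pos := by
    intro i hi
    rw [Multiset.mem_cons] at hi
    rcases hi with rfl | hi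
    · exact Nat.succ_pos _
    · rw [Multiset.eq_of_mem_replicate hi]; exact Nat.one_pos
  parts_sum := by
    rw [Multiset.sum_cons, Multiset.sum_replicate, smul_eq_mul]
    omega

theorem parts_hookPartition (a b : ℕ) :
    (hookPartition (a + b) a).parts = (a + 1) ::ₘ Multiset.replicate b 1 := by
  change (min a (a + b) + 1) ::ₘ Multiset.replicate (a + b - a) 1 = _
  rw [min_eq_left (by omega), Nat.add_sub_cancel_left]

theorem sort_replicate_one (b : ℕ) :
    (Multiset.replicate b 1).sort (· ≥ ·) = List.replicate b 1 := by
  refine List.eq_replicate_iff.2 ⟨by simp, fun k hk => ?_⟩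
  rw [Multiset.mem_sort] at hk
  exact Multiset.eq_of_mem_replicate hk

theorem row_hookPartition {a b : ℕ} (i : ℕ) :
    row (hookPartition (a + b) a) i = if i = 0 then a + 1 else if i ≤ b then 1 else 0 := by
  rw [row, parts_hookPartition, Multiset.sort_cons,
    sort_replicate_one]
  · rcases i with _ | i
    · simp
    · rw [List.getD_cons_succ, if_neg i.succ_ne_zero, List.getD_eq_getElem?_getD,
        List.getElem?_replicate]
      split_ifs <;> first | rfl | omega
  · intro j hj
    rw [Multiset.eq_of_mem_replicate hj]
    omega

theorem card_hookPartition {a b : ℕ} : (hookPartition (a + b) a).parts.card = b + 1 := by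
  rw [parts_hookPartition, Multiset.card_cons, Multiset.card_replicate]

theorem col_hookPartition {a b : ℕ} (j : ℕ) :
    col (hookPartition (a + b) a) j = if j = 0 then b + 1 else if j ≤ a then 1 else 0 := by
  rw [col, parts_hookPartition]
  rcases j with _ | j
  · rw [Multiset.filter_eq_self.2, if_pos rfl, Multiset.card_cons, Multiset.card_replicate]
    intro k hk
    rw [Multiset.mem_cons] at hk
    rcases hk with rfl | hk
    · omega
    · rw [Multiset.eq_of_mem_replicate hk]; exact Nat.one_pos
  · have h1 : (Multiset.replicate b 1).filter (j + 1 < ·) = 0 := by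
      rw [Multiset.filter_eq_nil]
      intro k hk
      rw [Multiset.eq_of_mem_replicate hk]
      omega
    rw [if_neg j.succ_ne_zero, Multiset.filter_cons, h1, add_zero]
    by_cases hj : j + 1 ≤ a
    · rw [if_pos (by omega), if_pos hj, Multiset.card_singleton]
    · rw [if_neg (by omega), if_neg hj, Multiset.card_zero]

theorem kappa_hookPartition (a b : ℕ) :
    kappa (hookPartition (a + b) a) = ((a + b + 1 : ℕ) : ℤ) * ((a : ℤ) - b) := by
  rw [kappa, card_hookPartition, Finset.sum_range_succ']
  have h1 : ∀ i ∈ Finset.range b, (row (hookPartition (a + b) a) (i + 1) : ℤ) *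
      ((row (hookPartition (a + b) a) (i + 1) : ℤ) - 2 * ((i + 1 : ℕ) : ℤ) - 1) =
      -2 * ((i : ℤ) + 1) := by
    intro i hi
    rw [Finset.mem_range] at hi
    rw [row_hookPartition, if_neg i.succ_ne_zero, if_pos (by omega)]
    push_cast
    ring
  have h2 : ∀ c : ℕ, ∑ i ∈ Finset.range c, -2 * ((i : ℤ) + 1) = -(c * (c + 1)) := by
    intro c
    induction c with
    | zero => simp
    | succ c ih => rw [Finset.sum_range_succ, ih]; push_cast; ring
  rw [Finset.sum_congr rfl h1, h2, row_hookPartition, if_pos rfl]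
  push_cast
  ring

theorem unknotW_hookPartition (a b : ℕ) :
    unknotW (hookPartition (a + b) a) = hookW qHalf aHalf a b := by
  rw [unknotW, card_hookPartition, Finset.prod_range_succ', row_hookPartition, if_pos rfl]
  have h1 : ∀ i ∈ Finset.range b,
      ∏ j ∈ Finset.range (row (hookPartition (a + b) a) (i + 1)),
      (aHalf * qHalf ^ ((j : ℤ) - ((i + 1 : ℕ) : ℤ)) -
        aHalf⁻¹ * qHalf ^ (-((j : ℤ) - ((i + 1 : ℕ) : ℤ)))) /
      bq ((row (hookPartition (a + b) a) (i + 1) : ℤ) + (col (hookPartition (a + b) a) j : ℤ) -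
        ((i + 1 : ℕ) : ℤ) - (j : ℤ) - 1) =
      brShift qHalf aHalf (-(i + 1 : ℕ)) / br qHalf (b - 1 - i + 1 : ℕ) := by
    intro i hi
    rw [Finset.mem_range] at hi
    rw [row_hookPartition, if_neg i.succ_ne_zero, if_pos (by omega), Finset.prod_range_one,
      col_hookPartition, if_pos rfl, bq_eq_br, brShift]
    congr 2
    push_cast
    omega
  have h2 : ∀ j ∈ Finset.range a,
      (aHalf * qHalf ^ (((j + 1 : ℕ) : ℤ) - ((0 : ℕ) : ℤ)) -
        aHalf⁻¹ * qHalf ^ (-(((j + 1 : ℕ) : ℤ) - ((0 : ℕ) : ℤ)))) /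
      bq (((a + 1 : ℕ) : ℤ) + (col (hookPartition (a + b) a) (j + 1) : ℤ) -
        ((0 : ℕ) : ℤ) - ((j + 1 : ℕ) : ℤ) - 1) =
      brShift qHalf aHalf (j + 1 : ℕ) / br qHalf (a - 1 - j + 1 : ℕ) := by
    intro j hj
    rw [Finset.mem_range] at hj
    rw [col_hookPartition, if_neg j.succ_ne_zero, if_pos (by omega), bq_eq_br, brShift]
    congr 2
    push_cast
    omega
  -- Hook lengths decrease along the arm and the leg, hence the reflected products.
  rw [Finset.prod_congr rfl h1, Finset.prod_range_succ', Finset.prod_congr rfl h2,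
    Finset.prod_div_distrib, Finset.prod_div_distrib,
    Finset.prod_range_reflect (fun i => br qHalf (i + 1 : ℕ)),
    Finset.prod_range_reflect (fun i => br qHalf (i + 1 : ℕ)), hookW, Finset.prod_range_succ',
    col_hookPartition, if_pos rfl, bq_eq_br]
  have h3 : ((a + 1 : ℕ) : ℤ) + ((b + 1 : ℕ) : ℤ) - ((0 : ℕ) : ℤ) - ((0 : ℕ) : ℤ) - 1 =
      (a + b + 1 : ℕ) := by push_cast; ring
  rw [h3, div_mul_div_comm, div_mul_div_comm]
  congr 1
  · simp only [brShift, Nat.cast_zero, sub_zero]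
    ring
  · ring

/-- Only hooks have a part that is linear in `p_m`, `m = |λ|`. -/
theorem linPart_schurP_hookPartition (a b : ℕ) :
    linPart (a + b) (schurP (hookPartition (a + b) a)) =
      (-1) ^ b * inr (1 / ((a + b : ℕ) + 1 : QA)) := by
  rw [schurP, RingHom.map_det]
  have key : ∀ l : ℕ, l = b + 1 → ((linPart (a + b)).mapMatrix (Matrix.of fun i j : Fin l =>
      completeHP ((row (hookPartition (a + b) a) i : ℤ) - (i : ℤ) + (j : ℤ)))).det =
      (-1) ^ b * inr (1 / ((a + b : ℕ) + 1 : QA)) := by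
    rintro l rfl
    refine det_hook _ _ (fun j => ?_) fun i j => ?_
    · rw [RingHom.mapMatrix_apply, Matrix.map_apply, Matrix.of_apply, row_hookPartition,
        linPart_completeHP]
      have := j.2
      simp only [Fin.val_zero, if_true]
      rw [if_neg (by push_cast; omega)]
      by_cases h : (j : ℕ) = b
      · rw [if_pos (by push_cast; omega), if_pos h]
      · rw [if_neg (by push_cast; omega), if_neg h]
    · rw [RingHom.mapMatrix_apply, Matrix.map_apply, Matrix.of_apply, row_hookPartition,
        linPart_completeHP, Fin.val_succ]
      have := j.2
      have := i.2
      rw [if_neg (show ¬ (i : ℕ) + 1 = 0 by omega), if_pos (show (i : ℕ) + 1 ≤ b by omega)]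
      by_cases h : (j : ℕ) = i
      · rw [if_pos (by push_cast; omega), if_pos h]
      · rw [if_neg (by push_cast; omega), if_neg (by push_cast; omega), if_neg h]
  exact key _ card_hookPartition

/-- A partition that is not a hook has second part at least 2, so the first two rows of its
Jacobi–Trudi matrix contain only h_k with k > 0, all infinitesimal. -/
theorem linPart_schurP_eq_zero {n : ℕ} (lam : (n + 1).Partition)
    (h : ∀ a, a ≤ n → lam ≠ hookPartition n a) : linPart n (schurP lam) = 0 := by
  have hsort := lam.parts.sort_eq (· ≥ ·)
  have hpair := lam.parts.pairwise_sort (· ≥ ·)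
  have hcard : lam.parts.card = (lam.parts.sort (· ≥ ·)).length := (Multiset.length_sort _).symm
  have hrow : ∀ i, row lam i = (lam.parts.sort (· ≥ ·)).getD i 0 := fun i => rfl
  have hsum := lam.parts_sum
  have hpos : ∀ k ∈ lam.parts.sort (· ≥ ·), 0 < k := fun k hk =>
    lam.parts_pos ((Multiset.mem_sort (· ≥ ·)).1 hk)
  generalize lam.parts.sort (· ≥ ·) = l at *
  rw [← hsort, Multiset.sum_coe] at hsum
  rcases l with _ | ⟨x, t⟩
  · simp at hsum
  rw [List.pairwise_cons] at hpair
  have hx : 0 < x := hpos x (by simp)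
  by_cases ht : ∀ y ∈ t, y = 1
  · exfalso
    have ht' : t = List.replicate t.length 1 := List.eq_replicate_iff.2 ⟨rfl, ht⟩
    have hst : t.sum = t.length := by
      conv_lhs => rw [ht', List.sum_replicate, smul_eq_mul, mul_one]
    rw [List.sum_cons, hst] at hsum
    obtain ⟨a, rfl⟩ : ∃ a, x = a + 1 := ⟨x - 1, by omega⟩
    obtain rfl : n = a + t.length := by omega
    apply h a (by omega)
    ext1
    rw [← hsort, parts_hookPartition, ← Multiset.cons_coe, ← Multiset.coe_replicate, ← ht']
  · push Not at ht
    obtain ⟨y, hy, hy1⟩ := ht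
    rcases t with _ | ⟨z, t⟩
    · simp at hy
    have hyz : y ≤ z := by
      rcases List.mem_cons.1 hy with rfl | hy'
      · exact le_refl _
      · exact (List.pairwise_cons.1 hpair.2).1 y hy'
    have hy0 : 0 < y := hpos y (List.mem_cons_of_mem _ hy)
    rw [List.length_cons, List.length_cons] at hcard
    have hr0 : row lam 0 = x := by rw [hrow]; rfl
    have hr1 : row lam 1 = z := by rw [hrow]; rfl
    rw [schurP, RingHom.map_det]
    have hfst : ∀ k : ℤ, 0 < k → (linPart n (completeHP k)).fst = 0 := by
      intro k hk
      rw [linPart_completeHP, if_neg hk.ne']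
      split_ifs <;> simp
    refine det_eq_zero_of_two_rows _ ⟨0, by omega⟩ ⟨1, by omega⟩ (by simp) (fun j => ?_)
      fun j => ?_
    · rw [RingHom.mapMatrix_apply, Matrix.map_apply, Matrix.of_apply]
      refine hfst _ ?_
      simp only [hr0]
      push_cast
      omega
    · rw [RingHom.mapMatrix_apply, Matrix.map_apply, Matrix.of_apply]
      refine hfst _ ?_
      simp only [hr1]
      push_cast
      omega

/-- The logarithm keeps the coefficient of p_m, only hooks contribute to it, and κ = m(a - b) makes
the framing factors the powers of q^{1/2} in the hook form of 𝒵_m. -/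
theorem freeEnergyCoeff_indiscrete (τ : ℤ) (n : ℕ) :
    freeEnergyCoeff τ (n + 1) (Nat.Partition.indiscrete (n + 1)) =
      bq (n + 1 : ℕ) / ((n : QA) + 1) * explicitZ τ (n + 1) := by
  have h0 : expOf {n + 1} = Finsupp.single n 1 := by simp [expOf]
  have h1 : partsOf (Finsupp.single n 1) = {n + 1} := by simp [partsOf]
  rw [freeEnergyCoeff, Nat.Partition.indiscrete_parts n.succ_ne_zero, h0, csFreeEnergyP,
    coeff_single_one_log
      (by rw [map_sub, constantCoeff_csPartitionFunctionP, map_one, sub_self]), map_sub,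
    coeff_csPartitionFunctionP, h1, Multiset.sum_singleton, csComponentP, map_sum]
  have h2 : MvPowerSeries.coeff (Finsupp.single n 1) (1 : MvPowerSeries ℕ QA) = 0 := by
    classical
    rw [MvPowerSeries.coeff_one, if_neg]
    simp
  have h3 : ∀ lam : (n + 1).Partition, MvPowerSeries.coeff (Finsupp.single n 1)
      (MvPowerSeries.C (framedH τ lam) * schurP lam) =
      framedH τ lam * (linPart n (schurP lam)).snd := by
    intro lam
    rw [MvPowerSeries.coeff_C_mul, snd_linPart]
  rw [h2, sub_zero, Finset.sum_congr rfl fun lam _ => h3 lam, explicitZ_eq_sum_hookW,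
    Finset.mul_sum, Finset.mul_sum]
  symm
  refine Finset.sum_of_injOn (fun a => hookPartition n a) ?_ (fun _ _ => Finset.mem_coe.2 (Finset.mem_univ _)) ?_ ?_
  · intro a ha a' ha' h
    rw [Finset.mem_coe, Finset.mem_range] at ha ha'
    have := congrArg (fun p : (n + 1).Partition => p.parts.card) h
    simp only [hookPartition, Multiset.card_cons, Multiset.card_replicate] at this
    omega
  · intro lam _ hlam
    rw [linPart_schurP_eq_zero, snd_zero, mul_zero]
    rintro a ha rfl
    exact hlam ⟨a, by rw [Finset.mem_coe, Finset.mem_range]; omega, rfl⟩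
  · intro a ha
    rw [Finset.mem_range] at ha
    obtain ⟨b, rfl⟩ : ∃ b, n = a + b := ⟨n - a, by omega⟩
    have hs : ((-1) ^ b * inr (1 / ((a + b : ℕ) + 1 : QA)) : DualNumber QA).snd =
        (-1) ^ b * (1 / ((a + b : ℕ) + 1 : QA)) := by
      rw [snd_mul, snd_inr, fst_inr]
      simp
    rw [linPart_schurP_hookPartition, hs, framedH, unknotW_hookPartition, kappa_hookPartition,
      Nat.add_sub_cancel_left, mul_right_comm (((a + b + 1 : ℕ) : ℤ))]
    have := bq_natCast_ne_zero (a + b).succ_ne_zero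
    field_simp

end HookSum

/-! ### The numerator of the one-hole generating function -/

section Numerator

open PowerSeries

variable {R S : Type*} [CommRing R] [CommRing S]

/-- `(y^M - y^{-M}) / (y - y⁻¹) = ∑_{j < M} y^{M - 1 - 2 j}`. -/
noncomputable def balancedSum (y : Rˣ) (M : ℕ) : R :=
  ∑ j ∈ Finset.range M, ((y ^ ((M : ℤ) - 1 - 2 * j) : Rˣ) : R)

theorem balancedSum_mul (y : Rˣ) (M : ℕ) :
    balancedSum y M * ((y : R) - ((y⁻¹ : Rˣ) : R)) =
      ((y ^ (M : ℤ) : Rˣ) : R) - ((y ^ (-(M : ℤ)) : Rˣ) : R) := by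
  have h : ∀ j : ℕ, ((y ^ ((M : ℤ) - 1 - 2 * j) : Rˣ) : R) * ((y : R) - ((y⁻¹ : Rˣ) : R)) =
      ((y ^ ((M : ℤ) - 2 * j) : Rˣ) : R) - ((y ^ ((M : ℤ) - 2 * (j + 1 : ℕ)) : Rˣ) : R) := by
    intro j
    have h1 : (M : ℤ) - 2 * j = ((M : ℤ) - 1 - 2 * j) + 1 := by ring
    have h2 : (M : ℤ) - 2 * (j + 1 : ℕ) = ((M : ℤ) - 1 - 2 * j) + (-1) := by push_cast; ring
    rw [h1, h2, zpow_add, zpow_add, zpow_one, zpow_neg_one, Units.val_mul, Units.val_mul]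
    ring
  rw [balancedSum, Finset.sum_mul, Finset.sum_congr rfl fun j _ => h j,
    Finset.sum_range_sub' (fun j : ℕ => ((y ^ ((M : ℤ) - 2 * j) : Rˣ) : R)),
    show (M : ℤ) - 2 * (0 : ℕ) = M by simp, show (M : ℤ) - 2 * M = -M by ring]

theorem balancedSum_inv (y : Rˣ) (M : ℕ) : balancedSum y⁻¹ M = balancedSum y M := by
  rw [balancedSum, balancedSum, ← Finset.sum_range_reflect]
  refine Finset.sum_congr rfl fun j hj => ?_
  rw [Finset.mem_range] at hj
  rw [inv_zpow']
  congr 2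
  omega

theorem balancedSum_neg (y : Rˣ) (M : ℕ) : balancedSum (-y) M = (-1) ^ (M + 1) * balancedSum y M := by
  rw [balancedSum, balancedSum, Finset.mul_sum]
  refine Finset.sum_congr rfl fun j _ => ?_
  have h : (-1 : Rˣ) ^ ((M : ℤ) - 1 - 2 * j) = (-1) ^ (M + 1) := by
    have : (M : ℤ) - 1 - 2 * j = (M + 1 : ℕ) + 2 * (-(j : ℤ) - 1) := by push_cast; ring
    rw [this, zpow_add, zpow_natCast, zpow_mul]
    simp
  rw [← neg_one_mul y, mul_zpow, h]
  simp

theorem map_balancedSum (f : R →+* S) (y : Rˣ) (M : ℕ) :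
    f (balancedSum y M) = balancedSum (Units.map f y) M := by
  rw [balancedSum, balancedSum, map_sum]
  refine Finset.sum_congr rfl fun j _ => ?_
  rw [← map_zpow]
  rfl

/-- The series `∏_j (1 - A^{-d} y^{d (M - 1 - 2 j)} t^d) / (1 - A^d y^{d (M - 1 - 2 j)} t^d)`. -/
noncomputable def unknotSeries (y A : Rˣ) (d M : ℕ) : R⟦X⟧ :=
  ∏ j ∈ Finset.range M, (1 - C (((A⁻¹ * y ^ ((M : ℤ) - 1 - 2 * j)) ^ d : Rˣ) : R) * X ^ d) *
    geom d (((A * y ^ ((M : ℤ) - 1 - 2 * j)) ^ d : Rˣ) : R)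

/-- For d = 1, y = q^{1/2}, A = a^{1/2} these power sums are {kM}{k}_a/{k}. The series itself has no
denominators, so it can be specialized to roots of unity. -/
theorem exists_isNewton_unknotSeries (y A : Rˣ) {d : ℕ} (hd : d ≠ 0) (M : ℕ) :
    ∃ P, IsNewton P (unknotSeries y A d M) ∧ ∀ k, k ≠ 0 → coeff k P = if d ∣ k then
      d * ((((A ^ k : Rˣ) : R) - ((A⁻¹ ^ k : Rˣ) : R)) * balancedSum (y ^ k) M) else 0 := by
  refine ⟨_, IsNewton.prod _ fun j _ => (isNewton_one_sub hd _).mul (isNewton_geom hd _), ?_⟩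
  intro k hk
  rw [map_sum]
  simp only [map_add, map_neg, coeff_natCast_mul_geom_sub_one _ hk]
  split_ifs with h
  · rw [balancedSum, Finset.mul_sum, Finset.mul_sum]
    refine Finset.sum_congr rfl fun j _ => ?_
    obtain ⟨n, rfl⟩ := h
    rw [Nat.mul_div_cancel_left _ (Nat.pos_of_ne_zero hd), ← Units.val_pow_eq_pow_val,
      ← Units.val_pow_eq_pow_val, ← pow_mul, ← pow_mul, mul_pow, mul_pow, Units.val_mul,
      Units.val_mul]
    have : (y ^ ((M : ℤ) - 1 - 2 * j)) ^ (d * n) = (y ^ (d * n)) ^ ((M : ℤ) - 1 - 2 * j) := by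
      rw [← zpow_natCast, ← zpow_natCast, ← zpow_mul, ← zpow_mul, mul_comm]
    rw [this]
    ring
  · simp

theorem map_geom (f : R →+* S) (d : ℕ) (c : R) :
    PowerSeries.map f (geom d c) = geom d (f c) := by
  ext n
  rw [coeff_map, geom, geom, coeff_mk, coeff_mk]
  split_ifs <;> simp

theorem map_unknotSeries (f : R →+* S) (y A : Rˣ) (d M : ℕ) :
    PowerSeries.map f (unknotSeries y A d M) =
      unknotSeries (Units.map f y) (Units.map f A) d M := by
  rw [unknotSeries, unknotSeries, map_prod]
  refine Finset.prod_congr rfl fun j _ => ?_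
  rw [map_mul, map_geom, map_sub, map_one, map_mul, map_C, map_pow, map_X, ← map_zpow, ← map_inv,
    ← map_mul, ← map_mul, ← map_pow, ← map_pow]
  rfl

theorem expand_geom {d : ℕ} (hd : d ≠ 0) (c : R) : expand d hd (geom 1 c) = geom d c := by
  ext n
  rw [coeff_expand, geom, geom, coeff_mk]
  simp

/-- Raising y, A and t to the d-th power in the series for d = 1 gives the series for d, so all
Adams images are read off at the same t^m. -/
theorem coeff_mul_unknotSeries (y A : Rˣ) {d : ℕ} (hd : d ≠ 0) (n M : ℕ) :
    coeff (d * n) (unknotSeries y A d M) = coeff n (unknotSeries (y ^ d) (A ^ d) 1 M) := by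
  have h : unknotSeries y A d M = expand d hd (unknotSeries (y ^ d) (A ^ d) 1 M) := by
    rw [unknotSeries, unknotSeries, map_prod]
    refine Finset.prod_congr rfl fun j _ => ?_
    rw [map_mul, expand_geom, map_sub, map_one, map_mul, expand_C, map_pow, expand_X]
    have h1 : (y ^ d) ^ ((M : ℤ) - 1 - 2 * j) = (y ^ ((M : ℤ) - 1 - 2 * j)) ^ d := by
      rw [← zpow_natCast, ← zpow_natCast, ← zpow_mul, ← zpow_mul, mul_comm]
    rw [h1, ← inv_pow, ← mul_pow, ← mul_pow, pow_one, pow_one, pow_one]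
  rw [h, coeff_expand_mul]

theorem unknotSeries_inv (y A : Rˣ) (d M : ℕ) :
    unknotSeries y⁻¹ A d M = unknotSeries y A d M := by
  rw [unknotSeries, unknotSeries, ← Finset.prod_range_reflect]
  refine Finset.prod_congr rfl fun j hj => ?_
  rw [Finset.mem_range] at hj
  have : (y⁻¹) ^ ((M : ℤ) - 1 - 2 * (M - 1 - j : ℕ)) = y ^ ((M : ℤ) - 1 - 2 * j) := by
    rw [inv_zpow']
    congr 1
    omega
  rw [this]

/-- The exponents M - 1 - 2j all have the parity of M + 1. -/
theorem unknotSeries_neg (y A : Rˣ) (M : ℕ) :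
    unknotSeries (-y) A 1 M = rescale ((-1) ^ (M + 1)) (unknotSeries y A 1 M) := by
  rw [unknotSeries, unknotSeries, map_prod]
  refine Finset.prod_congr rfl fun j _ => ?_
  have h : (-1 : Rˣ) ^ ((M : ℤ) - 1 - 2 * j) = (-1) ^ (M + 1) := by
    have : (M : ℤ) - 1 - 2 * j = (M + 1 : ℕ) + 2 * (-(j : ℤ) - 1) := by push_cast; ring
    rw [this, zpow_add, zpow_natCast, zpow_mul]
    simp
  have h2 : ∀ c : R, rescale ((-1) ^ (M + 1)) (geom 1 c) = geom 1 ((-1) ^ (M + 1) * c) := by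
    intro c
    ext n
    rw [coeff_rescale, geom, geom, coeff_mk, coeff_mk]
    simp [mul_pow]
  have h3 : ∀ c : R, rescale ((-1) ^ (M + 1)) (1 - C c * X ^ 1) =
      1 - C ((-1) ^ (M + 1) * c) * X ^ 1 := by
    intro c
    ext n
    rw [coeff_rescale, map_sub, map_sub, coeff_C_mul, coeff_C_mul, coeff_one, pow_one, coeff_X]
    rcases n with _ | _ | n <;> simp
  rw [map_mul, h2, h3, ← neg_one_mul y, mul_zpow, h, mul_left_comm, mul_left_comm A]
  simp only [pow_one, Units.val_mul, Units.val_pow_eq_pow_val, Units.val_neg, Units.val_one]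

/-- `∑_{d ∣ m} μ(d) (-1)^{t m / d} S_{m / d}(y^d, A^d)`, with `S_n` the coefficient of `t^n` in
the unknot series with `M = n t`. -/
noncomputable def numerator (y A : Rˣ) (m t : ℕ) : R :=
  ∑ d ∈ m.divisors, ((ArithmeticFunction.moebius d : ℤ) : R) * ((-1) ^ (m / d * t) *
    coeff m (unknotSeries y A d (m / d * t)))

theorem map_numerator (f : R →+* S) (y A : Rˣ) (m t : ℕ) :
    f (numerator y A m t) = numerator (Units.map f y) (Units.map f A) m t := by
  rw [numerator, numerator, map_sum]
  refine Finset.sum_congr rfl fun d _ => ?_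
  rw [map_mul, map_mul, map_intCast, map_pow, map_neg, map_one, ← map_unknotSeries, coeff_map]

theorem numerator_inv (y A : Rˣ) (m t : ℕ) : numerator y⁻¹ A m t = numerator y A m t := by
  simp only [numerator, unknotSeries_inv]

/-- For even d the summand is unchanged and m is even. For odd d and m = dn its sign is
(-1)^{n(nt+1)}, and n(nt+1) has the parity of m(t+1) because n(n+1) is even. -/
theorem numerator_neg (y A : Rˣ) (m t : ℕ) :
    numerator (-y) A m t = (-1) ^ (m * (t + 1)) * numerator y A m t := by
  rw [numerator, numerator, Finset.mul_sum]
  refine Finset.sum_congr rfl fun d hd => ?_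
  rw [Nat.mem_divisors] at hd
  obtain ⟨⟨n, rfl⟩, hm⟩ := hd
  have hd0 : d ≠ 0 := left_ne_zero_of_mul hm
  rw [Nat.mul_div_cancel_left _ (Nat.pos_of_ne_zero hd0), coeff_mul_unknotSeries _ _ hd0,
    coeff_mul_unknotSeries _ _ hd0]
  rcases Nat.even_or_odd d with he | ho
  · rw [he.neg_pow, (he.mul_right n |>.mul_right (t + 1)).neg_one_pow, one_mul]
  · rw [ho.neg_pow, unknotSeries_neg, coeff_rescale, ← pow_mul]
    have h : (-1 : R) ^ ((n * t + 1) * n) = (-1) ^ (d * n * (t + 1)) := by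
      have h1 : Even ((n * t + 1) * n + d * n * (t + 1)) := by
        obtain ⟨c, rfl⟩ := ho
        have h2 : (n * t + 1) * n + (2 * c + 1) * n * (t + 1) =
            t * (n * (n + 1)) + 2 * (n + c * n * (t + 1)) := by ring
        rw [h2]
        exact ((Nat.even_mul_succ_self n).mul_left t).add (even_two_mul _)
      have h3 : (-1 : R) ^ _ = 1 := h1.neg_one_pow
      rw [pow_add] at h3
      have h4 : ((-1 : R) ^ (d * n * (t + 1))) * (-1) ^ (d * n * (t + 1)) = 1 := by
        rw [← pow_add, (Even.add_self _).neg_one_pow]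
      linear_combination (-1 : R) ^ (d * n * (t + 1)) * h3 - (-1 : R) ^ ((n * t + 1) * n) * h4
    rw [h]
    ring

end Numerator

/-! ### Vanishing of the numerator at roots of unity, to first order -/

section Vanishing

open PowerSeries

variable {R : Type*} [CommRing R]

/-- Multiplying or dividing by p is an involution of the squarefree divisors that reverses the
Möbius sign. -/
theorem sum_moebius_eq_zero {m e p : ℕ} (hp : p.Prime) (hpe : p ∣ e) (hem : e ∣ m) (f : ℕ → R)
    (hf : ∀ d, p * d ∣ m → ¬ p ∣ d → f (p * d) = f d) :
    ∑ d ∈ m.divisors, ((ArithmeticFunction.moebius d : ℤ) : R) * f d = 0 := by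
  rcases eq_or_ne m 0 with rfl | hm
  · simp
  have hpm := hpe.trans hem
  have h1 : ∀ d ∈ m.divisors, ((ArithmeticFunction.moebius d : ℤ) : R) * f d ≠ 0 → Squarefree d := by
    intro d _ h
    by_contra h2
    rw [ArithmeticFunction.moebius_eq_zero_of_not_squarefree h2] at h
    simp at h
  rw [← Finset.sum_filter_of_ne h1]
  have hcop : ∀ d, ¬ p ∣ d → p.Coprime d := fun d h => (Nat.Prime.coprime_iff_not_dvd hp).2 h
  refine Finset.sum_involution (fun d _ => if p ∣ d then d / p else p * d) ?_ ?_ ?_ ?_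
  · intro d hd
    rw [Finset.mem_filter, Nat.mem_divisors] at hd
    have key : ∀ d, p * d ∣ m → Squarefree (p * d) →
        ((ArithmeticFunction.moebius (p * d) : ℤ) : R) * f (p * d) +
        ((ArithmeticFunction.moebius d : ℤ) : R) * f d = 0 := by
      intro d hd hsq
      have hpd : ¬ p ∣ d := fun h => by
        have := (Nat.squarefree_iff_prime_squarefree.1 hsq) p hp
        exact this (Nat.mul_dvd_mul_left p h)
      rw [hf d hd hpd, ArithmeticFunction.isMultiplicative_moebius.map_mul_of_coprime (hcop d hpd),
        ArithmeticFunction.moebius_apply_prime hp]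
      push_cast
      ring
    split_ifs with h
    · obtain ⟨c, rfl⟩ := h
      rw [Nat.mul_div_cancel_left _ hp.pos]
      exact key c hd.1.1 hd.2
    · rw [add_comm]
      refine key d ((hcop d h).mul_dvd_of_dvd_of_dvd hpm hd.1.1) ?_
      exact (Nat.squarefree_mul (hcop d h)).2 ⟨hp.squarefree, hd.2⟩
  · intro d hd _
    rw [Finset.mem_filter, Nat.mem_divisors] at hd
    have hd0 : 0 < d := Nat.pos_of_dvd_of_pos hd.1.1 (Nat.pos_of_ne_zero hm)
    split_ifs with h
    · exact (Nat.div_lt_self hd0 hp.one_lt).ne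
    · have := hp.two_le
      nlinarith
  · intro d hd
    rw [Finset.mem_filter, Nat.mem_divisors] at hd ⊢
    split_ifs with h
    · exact ⟨⟨(Nat.div_dvd_of_dvd h).trans hd.1.1, hm⟩,
        hd.2.squarefree_of_dvd (Nat.div_dvd_of_dvd h)⟩
    · exact ⟨⟨(hcop d h).mul_dvd_of_dvd_of_dvd hpm hd.1.1, hm⟩,
        (Nat.squarefree_mul (hcop d h)).2 ⟨hp.squarefree, hd.2⟩⟩
  · intro d hd
    rw [Finset.mem_filter, Nat.mem_divisors] at hd
    by_cases h : p ∣ d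
    · obtain ⟨c, rfl⟩ := h
      have hpc : ¬ p ∣ c := fun h => by
        have := (Nat.squarefree_iff_prime_squarefree.1 hd.2) p hp
        exact this (Nat.mul_dvd_mul_left p h)
      simp [Nat.mul_div_cancel_left _ hp.pos, hpc]
    · simp [h, Nat.mul_div_cancel_left _ hp.pos]

/-! ### First-order calculus at a root of unity -/

theorem zpow_eq_one_add {w : Rˣ} (hw : ((w : R) - 1) ^ 2 = 0) (n : ℤ) :
    ((w ^ n : Rˣ) : R) = 1 + n * ((w : R) - 1) := by
  induction n using Int.induction_on with
  | zero => simp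
  | succ n ih =>
    rw [zpow_add_one, Units.val_mul, ih]
    push_cast
    linear_combination (n : R) * hw
  | pred n ih =>
    have h1 : ((w ^ (-(n : ℤ) - 1) : Rˣ) : R) * w = ((w ^ (-(n : ℤ)) : Rˣ) : R) := by
      rw [← Units.val_mul, ← zpow_add_one]
      congr 2
      ring
    rw [ih] at h1
    refine (Units.mul_left_inj w).1 (h1.trans ?_)
    push_cast
    linear_combination ((n : R) + 1) * hw

/-- Data of a point of order `e` and a tangent direction: `y = η w`, where `η²` has order `e` and
`w - 1` is infinitesimal. -/
structure IsTangentPoint (I : Ideal R) (e : ℕ) (η w : Rˣ) : Prop where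
  mul_eq_zero : ∀ x ∈ I, ∀ x' ∈ I, x * x' = 0
  sub_one_mem : (w : R) - 1 ∈ I
  pow_eq_one : η ^ (2 * e) = 1
  pow_eq_neg_one : Even e → η ^ e = -1
  isUnit : ∀ k : ℕ, ¬ e ∣ k → IsUnit ((((η * w) ^ (2 * k) : Rˣ) : R) - 1)

variable {I : Ideal R} {e : ℕ} {η w : Rˣ}

theorem IsTangentPoint.pow_two_mul (h : IsTangentPoint I e η w) {k : ℕ} (hk : e ∣ k) :
    η ^ (2 * k) = 1 := by
  obtain ⟨c, rfl⟩ := hk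
  rw [← mul_assoc, pow_mul, h.pow_eq_one, one_pow]

theorem IsTangentPoint.sq_eq_zero (h : IsTangentPoint I e η w) : ((w : R) - 1) ^ 2 = 0 := by
  rw [sq]
  exact h.mul_eq_zero _ h.sub_one_mem _ h.sub_one_mem

theorem sub_inv_eq (v : Rˣ) : (v : R) - ((v⁻¹ : Rˣ) : R) = ((v⁻¹ : Rˣ) : R) * (((v ^ 2 : Rˣ) : R) - 1) := by
  rw [mul_sub, ← Units.val_mul, mul_one, sq, inv_mul_cancel_left]

/-- As a quotient (y^{kM} - y^{-kM}) / (y^k - y^{-k}), it has a unit denominator since e ∤ k and an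
infinitesimal numerator since e ∣ kM. -/
theorem IsTangentPoint.balancedSum_mem (h : IsTangentPoint I e η w) {k M : ℕ} (hk : ¬ e ∣ k)
    (hkM : e ∣ k * M) : balancedSum ((η * w) ^ k) M ∈ I := by
  have h1 := balancedSum_mul ((η * w) ^ k) M
  have h2 : ((((η * w) ^ k) ^ (M : ℤ) : Rˣ) : R) - ((((η * w) ^ k) ^ (-(M : ℤ)) : Rˣ) : R) ∈ I := by
    rw [zpow_neg, sub_inv_eq, zpow_natCast, ← pow_mul, ← pow_mul]
    refine Ideal.mul_mem_left _ _ ?_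
    rw [mul_comm _ 2, mul_pow, h.pow_two_mul hkM, one_mul, ← zpow_natCast,
      zpow_eq_one_add h.sq_eq_zero, add_sub_cancel_left]
    exact Ideal.mul_mem_left _ _ h.sub_one_mem
  have h3 : IsUnit ((((η * w) ^ k : Rˣ) : R) - ((((η * w) ^ k)⁻¹ : Rˣ) : R)) := by
    rw [sub_inv_eq, ← pow_mul, mul_comm k 2]
    exact (Units.isUnit _).mul (h.isUnit k hk)
  rw [← h1] at h2
  obtain ⟨u, hu⟩ := h3
  rw [← hu] at h2
  have := I.mul_mem_right ((u⁻¹ : Rˣ) : R) h2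
  rwa [mul_assoc, Units.mul_inv, mul_one] at this

theorem sum_range_sub_two_mul (M : ℕ) : ∑ j ∈ Finset.range M, ((M : ℤ) - 1 - 2 * j) = 0 := by
  have h : ∀ c : ℤ, ∑ j ∈ Finset.range M, (c - 2 * j) = M * (c + 1 - M) := by
    intro c
    induction M with
    | zero => simp
    | succ M ih => rw [Finset.sum_range_succ, ih]; push_cast; ring
  rw [h]
  ring

/-- The leading terms coincide because η^{2k} = 1, and the first-order terms cancel because the
exponents M - 1 - 2j sum to zero. -/
theorem IsTangentPoint.balancedSum_eq (h : IsTangentPoint I e η w) {k M : ℕ} (hk : e ∣ k)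
    (hM : M ≠ 0) : balancedSum ((η * w) ^ k) M = M * ((η ^ (k * (M - 1)) : Rˣ) : R) := by
  have h1 : ∀ j ∈ Finset.range M, ((((η * w) ^ k) ^ ((M : ℤ) - 1 - 2 * j) : Rˣ) : R) =
      ((η ^ (k * (M - 1)) : Rˣ) : R) *
        (1 + (k : R) * ((((M : ℤ) - 1 - 2 * j : ℤ)) : R) * ((w : R) - 1)) := by
    intro j _
    have h2 : (η ^ k) ^ ((M : ℤ) - 1 - 2 * j) = η ^ (k * (M - 1)) := by
      have h3 : (M : ℤ) - 1 - 2 * j = (M - 1 : ℕ) + 2 * (-(j : ℤ)) := by omega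
      have h4 : (η ^ k) ^ (2 : ℤ) = 1 := by
        have := h.pow_two_mul hk
        rw [mul_comm, pow_mul] at this
        exact_mod_cast this
      rw [h3, zpow_add, zpow_natCast, ← pow_mul, zpow_mul, h4, one_zpow, mul_one]
    rw [mul_pow, mul_zpow, h2, ← zpow_natCast w k, ← zpow_mul, Units.val_mul,
      zpow_eq_one_add h.sq_eq_zero]
    push_cast
    rfl
  rw [balancedSum, Finset.sum_congr rfl h1, ← Finset.mul_sum, Finset.sum_add_distrib,
    ← Finset.sum_mul, ← Finset.mul_sum, ← Int.cast_sum, sum_range_sub_two_mul]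
  simp [mul_comm]

/-- The series with power sums `N (A^k - A^{-k})` for `l ∣ k`. -/
noncomputable def powerSeriesOfPeriod (A : Rˣ) (N l : ℕ) : R⟦X⟧ :=
  ((1 - C (((A⁻¹) ^ l : Rˣ) : R) * X ^ l) * geom l ((A ^ l : Rˣ) : R)) ^ (N / l)

theorem exists_isNewton_powerSeriesOfPeriod (A : Rˣ) {N l : ℕ} (hl : l ≠ 0) (hlN : l ∣ N) :
    ∃ P, IsNewton P (powerSeriesOfPeriod A N l) ∧ ∀ k, k ≠ 0 → coeff k P =
      if l ∣ k then N * (((A ^ k : Rˣ) : R) - ((A⁻¹ ^ k : Rˣ) : R)) else 0 := by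
  have h := IsNewton.prod (Finset.range (N / l)) fun _ _ =>
    (isNewton_one_sub hl (((A⁻¹) ^ l : Rˣ) : R)).mul (isNewton_geom hl ((A ^ l : Rˣ) : R))
  rw [Finset.prod_const, Finset.card_range] at h
  refine ⟨_, h, fun k hk => ?_⟩
  rw [map_sum, Finset.sum_const, Finset.card_range, map_add, map_neg,
    coeff_natCast_mul_geom_sub_one _ hk, coeff_natCast_mul_geom_sub_one _ hk]
  split_ifs with hlk
  · obtain ⟨c, rfl⟩ := hlk
    obtain ⟨b, rfl⟩ := hlN
    rw [Nat.mul_div_cancel_left _ (Nat.pos_of_ne_zero hl),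
      Nat.mul_div_cancel_left _ (Nat.pos_of_ne_zero hl), ← Units.val_pow_eq_pow_val,
      ← Units.val_pow_eq_pow_val, ← pow_mul, ← pow_mul, nsmul_eq_mul]
    push_cast
    ring
  · simp

variable [Algebra ℚ R]

theorem IsTangentPoint.coeff_unknotSeries_mem (h : IsTangentPoint I e η w) (A : Rˣ) {m d M : ℕ}
    (hd : d ≠ 0) (he : e ∣ d * M) (hem : ¬ e ∣ m) :
    coeff m (unknotSeries (η * w) A d M) ∈ I := by
  obtain ⟨P, hP, hPc⟩ := exists_isNewton_unknotSeries (η * w) A hd M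
  have hmem : ∀ k, ¬ e ∣ k → coeff k P ∈ I := by
    intro k hk
    rw [hPc k (by rintro rfl; simp at hk)]
    split_ifs with hdk
    · refine Ideal.mul_mem_left _ _ (Ideal.mul_mem_left _ _ (h.balancedSum_mem hk ?_))
      exact he.trans (Nat.mul_dvd_mul_right hdk M)
    · exact I.zero_mem
  exact ((hP.coeff_congr hP h.mul_eq_zero hmem hmem (fun _ _ => rfl) m).1 hem).1

/-- The power sums with e ∤ k are infinitesimal and may be dropped by `IsNewton.coeff_congr`; the
others are supported on the multiples of lcm(d, e). When dM = mt, only this lcm and the sign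
η^{m(M-1)} still depend on d. -/
theorem IsTangentPoint.coeff_unknotSeries (h : IsTangentPoint I e η w) (A : Rˣ) {m d M : ℕ}
    (hd : d ≠ 0) (he0 : e ≠ 0) (hM : M ≠ 0) (he : e ∣ d * M) (hem : e ∣ m)
    (hl : d.lcm e ∣ d * M) :
    coeff m (unknotSeries (η * w) A d M) =
      ((η ^ (m * (M - 1)) : Rˣ) : R) * coeff m (powerSeriesOfPeriod A (d * M) (d.lcm e)) := by
  obtain ⟨P, hP, hPc⟩ := exists_isNewton_unknotSeries (η * w) A hd M
  obtain ⟨P', hP', hPc'⟩ := exists_isNewton_powerSeriesOfPeriod A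
    (Nat.lcm_ne_zero hd he0) hl
  have hmem : ∀ k, ¬ e ∣ k → coeff k P ∈ I := by
    intro k hk
    rw [hPc k (by rintro rfl; simp at hk)]
    split_ifs with hdk
    · refine Ideal.mul_mem_left _ _ (Ideal.mul_mem_left _ _ (h.balancedSum_mem hk ?_))
      exact he.trans (Nat.mul_dvd_mul_right hdk M)
    · exact I.zero_mem
  have h1 := (hP.coeff_congr (hP'.rescale ((η ^ (M - 1) : Rˣ) : R)) h.mul_eq_zero hmem ?_ ?_ m).2 hem
  · rw [h1, coeff_rescale, ← Units.val_pow_eq_pow_val, ← pow_mul, mul_comm m]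
  · intro k hk
    rw [coeff_rescale, hPc' k (by rintro rfl; simp at hk),
      if_neg (fun h => hk ((Nat.dvd_lcm_right d e).trans h)), mul_zero]
    exact I.zero_mem
  · intro k hk
    rcases eq_or_ne k 0 with rfl | hk0
    · rw [coeff_zero_eq_constantCoeff_apply, coeff_zero_eq_constantCoeff_apply,
        hP.constantCoeff_left, (hP'.rescale _).constantCoeff_left]
    · rw [hPc k hk0, coeff_rescale, hPc' k hk0]
      by_cases hdk : d ∣ k
      · rw [if_pos hdk, if_pos (Nat.lcm_dvd hdk hk), h.balancedSum_eq hk hM,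
          ← Units.val_pow_eq_pow_val, ← pow_mul, mul_comm k]
        push_cast
        ring
      · rw [if_neg hdk, if_neg (fun h => hdk ((Nat.dvd_lcm_left d e).trans h)), mul_zero]

theorem IsTangentPoint.numerator_mem (h : IsTangentPoint I e η w) (A : Rˣ) {m t : ℕ}
    (he : e ∣ m * t) (hem : ¬ e ∣ m) : numerator (η * w) A m t ∈ I := by
  refine Ideal.sum_mem _ fun d hd => ?_
  rw [Nat.mem_divisors] at hd
  obtain ⟨⟨n, rfl⟩, hm⟩ := hd
  have hd0 : d ≠ 0 := left_ne_zero_of_mul hm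
  refine Ideal.mul_mem_left _ _ (Ideal.mul_mem_left _ _ (h.coeff_unknotSeries_mem A hd0 ?_ hem))
  rwa [Nat.mul_div_cancel_left _ (Nat.pos_of_ne_zero hd0), ← mul_assoc]

/-- Up to the factor η^{-m}, the d-th summand depends on d only through μ(d), lcm(d, e) and
s^{(m/d)t} with s = -η^m. For a prime p ∣ e, the divisors d and pd with p ∤ d share the last two, so
the Möbius sum cancels. -/
theorem IsTangentPoint.numerator_eq_zero (h : IsTangentPoint I e η w) (A : Rˣ) {m t : ℕ}
    (he1 : e ≠ 1) (hm : m ≠ 0) (ht : t ≠ 0) (hem : e ∣ m) : numerator (η * w) A m t = 0 := by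
  have he0 : e ≠ 0 := by rintro rfl; exact hm (zero_dvd_iff.1 hem)
  obtain ⟨p, hp, hpe⟩ := Nat.exists_prime_and_dvd he1
  have hs2 : (-η ^ m : Rˣ) ^ 2 = 1 := by rw [neg_sq, ← pow_mul, mul_comm, h.pow_two_mul hem]
  have h1 : ∀ d ∈ m.divisors, ((ArithmeticFunction.moebius d : ℤ) : R) * ((-1) ^ (m / d * t) *
      coeff m (unknotSeries (η * w) A d (m / d * t))) =
      ((η⁻¹ ^ m : Rˣ) : R) * (((ArithmeticFunction.moebius d : ℤ) : R) *
        ((((-η ^ m) ^ (m / d * t) : Rˣ) : R) *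
          coeff m (powerSeriesOfPeriod A (m * t) (d.lcm e)))) := by
    intro d hd
    rw [Nat.mem_divisors] at hd
    have hdm := hd.1
    obtain ⟨⟨n, rfl⟩, -⟩ := hd
    have hd0 : d ≠ 0 := left_ne_zero_of_mul hm
    have hM : n * t ≠ 0 := mul_ne_zero (right_ne_zero_of_mul hm) ht
    rw [Nat.mul_div_cancel_left _ (Nat.pos_of_ne_zero hd0), h.coeff_unknotSeries A hd0 he0 hM
      (by rw [← mul_assoc]; exact hem.mul_right t) hem
      (by rw [← mul_assoc]; exact (Nat.lcm_dvd hdm hem).mul_right t), ← mul_assoc d]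
    have h2 : ((-1) ^ (n * t) : R) * ((η ^ (d * n * (n * t - 1)) : Rˣ) : R) =
        ((η⁻¹ ^ (d * n) : Rˣ) : R) * (((-η ^ (d * n)) ^ (n * t) : Rˣ) : R) := by
      obtain ⟨c, hc⟩ := Nat.exists_eq_succ_of_ne_zero hM
      rw [hc, Nat.succ_sub_one, ← Units.val_mul]
      have : η⁻¹ ^ (d * n) * (-η ^ (d * n)) ^ c.succ = (-1) ^ c.succ * η ^ (d * n * c) := by
        rw [neg_pow, ← pow_mul, Nat.mul_succ, pow_add, inv_pow]
        rw [mul_left_comm, mul_comm (η ^ (d * n * c)), inv_mul_cancel_left]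
      rw [this]
      simp
    rw [← mul_assoc ((-1) ^ (n * t)), h2]
    ring
  rw [numerator, Finset.sum_congr rfl h1, ← Finset.mul_sum,
    sum_moebius_eq_zero hp hpe hem, mul_zero]
  rintro d ⟨n, rfl⟩ hpd
  have hd0 : d ≠ 0 := fun h => by simp [h] at hm
  have hlcm : (p * d).lcm e = d.lcm e := by
    refine Nat.dvd_antisymm (Nat.lcm_dvd ?_ (Nat.dvd_lcm_right _ _))
      (Nat.lcm_dvd ((Nat.dvd_mul_left d p).trans (Nat.dvd_lcm_left _ _)) (Nat.dvd_lcm_right _ _))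
    exact ((Nat.Prime.coprime_iff_not_dvd hp).2 hpd).mul_dvd_of_dvd_of_dvd
      (hpe.trans (Nat.dvd_lcm_right _ _)) (Nat.dvd_lcm_left _ _)
  have hn1 : p * d * n / (p * d) = n :=
    Nat.mul_div_cancel_left _ (Nat.mul_pos hp.pos (Nat.pos_of_ne_zero hd0))
  have hn2 : p * d * n / d = p * n := by
    rw [mul_right_comm, Nat.mul_div_cancel _ (Nat.pos_of_ne_zero hd0)]
  rw [hlcm, hn1, hn2]
  congr 2
  have hsp : ∀ c, Even c → (-η ^ (p * d * n) : Rˣ) ^ c = 1 := by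
    rintro c ⟨b, rfl⟩
    rw [← two_mul, pow_mul, hs2, one_pow]
  rcases hp.eq_two_or_odd' with h2 | hodd
  · subst h2
    rcases Nat.even_or_odd (n * t) with hev | hod
    · rw [hsp _ hev, hsp _ (by rw [mul_assoc]; exact even_two_mul _)]
    -- The exponents nt and 2nt differ in parity here. But m = 2dn with dn odd and e even, so m is
    -- an odd multiple of e; then η^m = -1 and s = 1.
    · have hs1 : (-η ^ (2 * d * n) : Rˣ) = 1 := by
        obtain ⟨c, hc⟩ := hem
        have hn : Odd n := (Nat.odd_mul.1 hod).1
        have hdo : Odd d := by rw [← Nat.not_even_iff_odd, even_iff_two_dvd]; exact hpd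
        have hc1 : Odd c := by
          obtain ⟨b, rfl⟩ := hpe
          rw [mul_assoc, mul_assoc] at hc
          have hc' := Nat.eq_of_mul_eq_mul_left two_pos hc
          have := hdo.mul hn
          rw [hc'] at this
          exact (Nat.odd_mul.1 this).2
        rw [hc, pow_mul, h.pow_eq_neg_one (even_iff_two_dvd.2 hpe), hc1.neg_one_pow, neg_neg]
      rw [hs1, one_pow, one_pow]
  · have h3 : p * n * t = n * t + (p - 1) * (n * t) := by
      obtain ⟨c, hc⟩ : ∃ c, p = c + 1 := ⟨p - 1, by have := hp.pos; omega⟩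
      rw [hc, Nat.add_sub_cancel]
      ring
    have h4 : Even ((p - 1) * (n * t)) := (Nat.Odd.sub_odd hodd odd_one).mul_right _
    rw [h3, pow_add, hsp _ h4, mul_one]

end Vanishing

/-! ### Divisibility of the numerator -/

section Divisibility

open Polynomial LaurentPolynomial
open TrivSqZeroExt (inl inr fst)

/-- `T` as a unit. -/
noncomputable def unitT (B : Type*) [CommRing B] : (LaurentPolynomial B)ˣ where
  val := T 1
  inv := T (-1)
  val_inv := by rw [← T_add]; simp
  inv_val := by rw [← T_add]; simp

theorem val_unitT_zpow (B : Type*) [CommRing B] (n : ℤ) :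
    ((unitT B ^ n : (LaurentPolynomial B)ˣ) : LaurentPolynomial B) = T n := by
  induction n using Int.induction_on with
  | zero => simp
  | succ n ih => rw [zpow_add_one, Units.val_mul, ih, T_add]; rfl
  | pred n ih => rw [zpow_sub_one, Units.val_mul, ih, T_sub]; rfl

/-- A Laurent polynomial with coefficient unit, viewed as a constant. -/
noncomputable def unitC {B : Type*} [CommRing B] (A : Bˣ) : (LaurentPolynomial B)ˣ :=
  Units.map (LaurentPolynomial.C : B →+* LaurentPolynomial B) A

theorem eval₂_numerator {B S : Type*} [CommRing B] [CommRing S] (f : B →+* S) (u : Sˣ) (A : Bˣ)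
    (m t : ℕ) : LaurentPolynomial.eval₂ f u (numerator (unitT B) (unitC A) m t) =
      numerator u (Units.map f A) m t := by
  rw [map_numerator]
  congr 1
  · ext
    change LaurentPolynomial.eval₂ f u (T 1) = u
    rw [eval₂_T, zpow_one]
  · ext
    change LaurentPolynomial.eval₂ f u (LaurentPolynomial.C _) = _
    rw [LaurentPolynomial.eval₂_C]
    rfl

theorem eval₂_balancedSum {B S : Type*} [CommRing B] [CommRing S] (f : B →+* S) (u : Sˣ) (M : ℕ) :
    LaurentPolynomial.eval₂ f u (balancedSum (unitT B) M) = balancedSum u M := by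
  rw [map_balancedSum]
  congr 1
  ext
  change LaurentPolynomial.eval₂ f u (T 1) = u
  rw [eval₂_T, zpow_one]

/-- `1 + X² + ⋯ + X^{2 (M - 1)}`. -/
noncomputable def evenGeomSum (B : Type*) [CommRing B] (M : ℕ) : B[X] :=
  ∑ i ∈ Finset.range M, (X ^ 2) ^ i

theorem evenGeomSum_mul (B : Type*) [CommRing B] (M : ℕ) :
    evenGeomSum B M * (X ^ 2 - 1) = X ^ (2 * M) - 1 := by
  rw [evenGeomSum, geom_sum_mul, pow_mul]

theorem monic_evenGeomSum (B : Type*) [CommRing B] [Nontrivial B] {M : ℕ} (hM : M ≠ 0) :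
    (evenGeomSum B M).Monic :=
  (monic_X_pow 2).geom_sum (by simp) hM

theorem map_evenGeomSum {B S : Type*} [CommRing B] [CommRing S] (f : B →+* S) (M : ℕ) :
    (evenGeomSum B M).map f = evenGeomSum S M := by
  simp [evenGeomSum, Polynomial.map_sum]

theorem toLaurent_evenGeomSum (B : Type*) [CommRing B] (M : ℕ) :
    toLaurent (evenGeomSum B M) = T ((M : ℤ) - 1) * balancedSum (unitT B) M := by
  rw [← balancedSum_inv, balancedSum, evenGeomSum, map_sum, Finset.mul_sum]
  refine Finset.sum_congr rfl fun i _ => ?_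
  rw [inv_zpow', val_unitT_zpow, ← T_add, ← pow_mul, toLaurent_X_pow]
  congr 1
  push_cast
  ring

/-! ### Roots over an algebraically closed field and dual numbers -/

section Field

variable {L : Type*} [Field L]

theorem evenGeomSum_isRoot_iff [CharZero L] {M : ℕ} (hM : M ≠ 0) (a : L) :
    (evenGeomSum L M).IsRoot a ↔ a ^ 2 ≠ 1 ∧ (a ^ 2) ^ M = 1 := by
  have h1 := congrArg (Polynomial.eval a) (evenGeomSum_mul L M)
  simp only [eval_mul, eval_sub, eval_pow, eval_X, eval_one] at h1
  rw [IsRoot.def]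
  constructor
  · intro h
    refine ⟨fun h2 => ?_, ?_⟩
    · rw [evenGeomSum, eval_finsetSum] at h
      simp [h2, hM] at h
    · rw [h, zero_mul, pow_mul] at h1
      exact (sub_eq_zero.1 h1.symm)
  · rintro ⟨h2, h3⟩
    rw [← pow_mul] at h3
    rw [h3, sub_self] at h1
    exact (mul_eq_zero.1 h1).resolve_right (sub_ne_zero.2 h2)

theorem rootMultiplicity_evenGeomSum_le [CharZero L] {M : ℕ} (hM : M ≠ 0) (a : L) :
    (evenGeomSum L M).rootMultiplicity a ≤ 1 := by
  have h1 : ((2 * M : ℕ) : L) ≠ 0 := Nat.cast_ne_zero.2 (mul_ne_zero two_ne_zero hM)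
  have h2 : (X ^ (2 * M) - 1 : L[X]).Separable := X_pow_sub_one_separable_iff.2 h1
  have h3 : evenGeomSum L M ∣ X ^ (2 * M) - 1 := Dvd.intro _ (evenGeomSum_mul L M)
  exact rootMultiplicity_le_one_of_separable (h2.of_dvd h3) a

/-- The infinitesimals of the dual numbers. -/
noncomputable def infinitesimals (L : Type*) [Field L] : Ideal (DualNumber L) :=
  RingHom.ker (TrivSqZeroExt.fstHom L L L).toRingHom

theorem mem_infinitesimals {x : DualNumber L} : x ∈ infinitesimals L ↔ fst x = 0 := Iff.rfl

/-- The point `a` in the dual numbers. -/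
noncomputable def dualPoint {a : L} (ha : a ≠ 0) : (DualNumber L)ˣ :=
  Units.map (TrivSqZeroExt.inlHom L L).toMonoidHom (Units.mk0 a ha)

/-- The unit `1 + ε / a` of the dual numbers. -/
noncomputable def dualTangent (a : L) : (DualNumber L)ˣ where
  val := 1 + inr a⁻¹
  inv := 1 - inr a⁻¹
  val_inv := by ext <;> simp
  inv_val := by ext <;> simp

theorem val_dualPoint_mul_dualTangent {a : L} (ha : a ≠ 0) :
    ((dualPoint ha * dualTangent a : (DualNumber L)ˣ) : DualNumber L) = inl a + inr 1 := by
  change inl a * (1 + inr a⁻¹) = _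
  ext <;> simp [ha]

theorem isTangentPoint_dual {a : L} (ha : a ≠ 0) {e : ℕ} (he : orderOf (a ^ 2) = e) (he0 : e ≠ 0) :
    IsTangentPoint (infinitesimals L) e (dualPoint ha) (dualTangent a) where
  mul_eq_zero x hx y hy := by
    rw [mem_infinitesimals] at hx hy
    ext <;> simp [hx, hy]
  sub_one_mem := by
    rw [mem_infinitesimals]
    change fst (1 + inr a⁻¹ - 1) = 0
    simp
  pow_eq_one := by
    rw [dualPoint, ← map_pow]
    have : (Units.mk0 a ha) ^ (2 * e) = 1 := by
      ext
      rw [Units.val_pow_eq_pow_val, Units.val_mk0, pow_mul, ← he, pow_orderOf_eq_one, Units.val_one]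
    rw [this, map_one]
  pow_eq_neg_one hev := by
    have h1 : a ^ e = -1 := by
      have h2 : (a ^ e) ^ 2 = 1 := by rw [← pow_mul, mul_comm, pow_mul, ← he, pow_orderOf_eq_one]
      refine (mul_self_eq_one_iff.1 (by rwa [← sq])).resolve_left ?_
      -- If a^e were 1, then a² would have order dividing e / 2.
      intro h3
      obtain ⟨c, hc⟩ := hev
      have h4 : (a ^ 2) ^ c = 1 := by rw [← pow_mul, two_mul, ← hc, h3]
      have h5 := Nat.le_of_dvd (by omega) (orderOf_dvd_of_pow_eq_one h4)
      omega
    rw [dualPoint, ← map_pow]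
    have : (Units.mk0 a ha) ^ e = -1 := by
      ext
      rw [Units.val_pow_eq_pow_val, Units.val_mk0, h1]
      simp
    rw [this]
    ext1
    change inl (-1 : L) = -1
    ext <;> simp
  isUnit k hk := by
    rw [TrivSqZeroExt.isUnit_iff_isUnit_fst, isUnit_iff_ne_zero, Units.val_pow_eq_pow_val,
      val_dualPoint_mul_dualTangent]
    have h1 : fst ((inl a + inr 1 : DualNumber L) ^ (2 * k) - 1) = a ^ (2 * k) - 1 := by simp
    rw [h1, sub_ne_zero, pow_mul]
    intro h2
    exact hk (he ▸ orderOf_dvd_of_pow_eq_one h2)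

/-- First-order Taylor expansion: P vanishes at a + ε exactly when P and P' vanish at a, which
detects double roots. -/
theorem aeval_dual (P : L[X]) (a : L) :
    aeval (inl a + inr 1 : DualNumber L) P =
      inl (P.eval a) + inr (P.derivative.eval a) := by
  have h1 : ((inr 1 : DualNumber L)) ^ 2 = 0 := by rw [sq]; ext <;> simp
  have h2 : ∀ Q : L[X], aeval (inl a : DualNumber L) Q = inl (Q.eval a) := fun Q =>
    aeval_algebraMap_apply_eq_algebraMap_eval a Q
  rw [aeval_add_of_sq_eq_zero _ _ _ h1, h2, h2]
  ext <;> simp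

end Field

/-- Up to powers of T the divisor is monic, so divisibility descends from L, where root
multiplicities decide. Both factors have simple roots; at a root a of the second, with a² of order
e, the first vanishes only if e ∣ m. Evaluating the numerator at a + ε gives a zero in general and a
double zero if e ∣ m. -/
theorem balancedSum_mul_balancedSum_dvd_numerator {B L : Type*} [CommRing B] [Nontrivial B]
    [Field L] [CharZero L] [IsAlgClosed L] (κ : B →+* L) (hκ : Function.Injective κ) (A : Bˣ)
    {m t : ℕ} (hm : m ≠ 0) (ht : t ≠ 0) :
    balancedSum (unitT B) m * balancedSum (unitT B) (m * t) ∣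
      numerator (unitT B) (unitC A) m t := by
  obtain ⟨k, P, hP⟩ := exists_T_pow (numerator (unitT B) (unitC A) m t)
  have hN : m * t ≠ 0 := mul_ne_zero hm ht
  suffices h : evenGeomSum B m * evenGeomSum B (m * t) ∣ P by
    obtain ⟨c, rfl⟩ := h
    refine ⟨T ((m : ℤ) - 1) * T (((m * t : ℕ) : ℤ) - 1) * toLaurent c * T (-k), ?_⟩
    rw [map_mul, map_mul, toLaurent_evenGeomSum, toLaurent_evenGeomSum] at hP
    have h1 : (T k * T (-k) : LaurentPolynomial B) = 1 := by rw [← T_add, add_neg_cancel, T_zero]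
    calc numerator (unitT B) (unitC A) m t = numerator (unitT B) (unitC A) m t * T k * T (-k) := by
          rw [mul_assoc, h1, mul_one]
      _ = _ := by rw [← hP]; ring
  rw [← map_dvd_map κ hκ ((monic_evenGeomSum B hm).mul (monic_evenGeomSum B hN)),
    Polynomial.map_mul, map_evenGeomSum, map_evenGeomSum]
  have hne : evenGeomSum L m * evenGeomSum L (m * t) ≠ 0 :=
    ((monic_evenGeomSum L hm).mul (monic_evenGeomSum L hN)).ne_zero
  by_cases hP0 : P.map κ = 0
  · rw [hP0]; exact dvd_zero _
  classical
  rw [IsAlgClosed.dvd_iff_roots_le_roots hne hP0, Multiset.le_iff_count]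
  intro a
  rw [count_roots, count_roots, rootMultiplicity_mul hne]
  by_cases haN : (evenGeomSum L (m * t)).IsRoot a
  · obtain ⟨ha2, haN'⟩ := (evenGeomSum_isRoot_iff hN a).1 haN
    have ha : a ≠ 0 := by
      rintro rfl
      rw [zero_pow two_ne_zero, zero_pow hN] at haN'
      exact zero_ne_one haN'
    have he := orderOf_dvd_of_pow_eq_one haN'
    have he0 : orderOf (a ^ 2) ≠ 0 := fun h => hN (by rw [h] at he; exact zero_dvd_iff.1 he)
    have htp := isTangentPoint_dual ha rfl he0
    have hev : ∀ f : DualNumber L, LaurentPolynomial.eval₂ ((TrivSqZeroExt.inlHom L L).comp κ)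
        (dualPoint ha * dualTangent a) (numerator (unitT B) (unitC A) m t) = f →
        inl ((P.map κ).eval a) + inr ((P.map κ).derivative.eval a) =
          f * (((dualPoint ha * dualTangent a) ^ (k : ℤ) : (DualNumber L)ˣ) : DualNumber L) := by
      rintro f rfl
      rw [← aeval_dual, ← eval₂_T ((TrivSqZeroExt.inlHom L L).comp κ), ← map_mul, ← hP,
        eval₂_toLaurent, val_dualPoint_mul_dualTangent, aeval_def, eval₂_map]
      rfl
    rw [eval₂_numerator] at hev
    by_cases hem : orderOf (a ^ 2) ∣ m
    · have h1 := hev 0 (htp.numerator_eq_zero _ (fun h => ha2 (orderOf_eq_one_iff.1 h)) hm ht hem)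
      rw [zero_mul] at h1
      have h2 := congrArg fst h1
      have h3 := congrArg TrivSqZeroExt.snd h1
      simp at h2 h3
      have h4 : 1 < (P.map κ).rootMultiplicity a :=
        (one_lt_rootMultiplicity_iff_isRoot hP0).2 ⟨by simpa using h2, by simpa using h3⟩
      have h5 := rootMultiplicity_evenGeomSum_le hm a
      have h6 := rootMultiplicity_evenGeomSum_le hN a
      omega
    · have h0 := htp.numerator_mem (Units.map ((TrivSqZeroExt.inlHom L L).comp κ) A) he hem
      rw [mem_infinitesimals] at h0
      have h2 := congrArg fst (hev _ rfl)
      rw [TrivSqZeroExt.fst_mul, h0, zero_mul] at h2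
      have h3 : (P.map κ).IsRoot a := by simpa using h2
      have h4 : 0 < (P.map κ).rootMultiplicity a := (rootMultiplicity_pos hP0).2 h3
      have h5 : (evenGeomSum L m).rootMultiplicity a = 0 := by
        refine rootMultiplicity_eq_zero fun h => hem ?_
        exact orderOf_dvd_of_pow_eq_one ((evenGeomSum_isRoot_iff hm a).1 h).2
      have h6 := rootMultiplicity_evenGeomSum_le hN a
      omega
  · have ham : ¬ (evenGeomSum L m).IsRoot a := by
      intro h
      rw [evenGeomSum_isRoot_iff hm] at h
      apply haN
      rw [evenGeomSum_isRoot_iff hN]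
      exact ⟨h.1, by rw [pow_mul, h.2, one_pow]⟩
    rw [rootMultiplicity_eq_zero haN, rootMultiplicity_eq_zero ham]
    exact Nat.zero_le _

end Divisibility

/-! ### Symmetry of the quotient -/

section Symmetry

open LaurentPolynomial

variable {B : Type*} [CommRing B]

/-- The automorphism `T ↦ -T`. -/
noncomputable def negT (B : Type*) [CommRing B] : LaurentPolynomial B →+* LaurentPolynomial B :=
  LaurentPolynomial.eval₂ LaurentPolynomial.C (-unitT B)

/-- The automorphism `T ↦ T⁻¹`. -/
noncomputable def invT (B : Type*) [CommRing B] : LaurentPolynomial B →+* LaurentPolynomial B :=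
  LaurentPolynomial.eval₂ LaurentPolynomial.C (unitT B)⁻¹

theorem coeff_negT (f : LaurentPolynomial B) (n : ℤ) :
    (negT B f).coeff n = ((n.negOnePow : ℤ) : B) * f.coeff n := by
  induction f using LaurentPolynomial.induction_on' with
  | add p q hp hq => rw [map_add, AddMonoidAlgebra.coeff_add, AddMonoidAlgebra.coeff_add,
      Finsupp.add_apply, Finsupp.add_apply, hp, hq, mul_add]
  | C_mul_T k b =>
    have h : (((-unitT B) ^ k : (LaurentPolynomial B)ˣ) : LaurentPolynomial B) =
        LaurentPolynomial.C (((k.negOnePow : ℤ)) : B) * T k := by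
      rw [← neg_one_mul, mul_zpow, Units.val_mul, val_unitT_zpow, Int.negOnePow_def]
      rcases Int.even_or_odd k with hk | hk
      · rw [hk.neg_one_zpow, hk.neg_one_zpow]; simp
      · rw [hk.neg_one_zpow, hk.neg_one_zpow]; simp
    rw [negT, map_mul, LaurentPolynomial.eval₂_C, eval₂_T, h, ← mul_assoc, ← map_mul,
      ← single_eq_C_mul_T, ← single_eq_C_mul_T, AddMonoidAlgebra.coeff_single,
      AddMonoidAlgebra.coeff_single, Finsupp.single_apply, Finsupp.single_apply]
    split_ifs with hkn
    · rw [hkn, mul_comm]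
    · simp

theorem coeff_invT (f : LaurentPolynomial B) (n : ℤ) : (invT B f).coeff n = f.coeff (-n) := by
  induction f using LaurentPolynomial.induction_on' with
  | add p q hp hq => rw [map_add, AddMonoidAlgebra.coeff_add, AddMonoidAlgebra.coeff_add,
      Finsupp.add_apply, Finsupp.add_apply, hp, hq]
  | C_mul_T k b =>
    rw [invT, map_mul, LaurentPolynomial.eval₂_C, eval₂_T, inv_zpow', val_unitT_zpow,
      ← single_eq_C_mul_T, ← single_eq_C_mul_T, AddMonoidAlgebra.coeff_single,
      AddMonoidAlgebra.coeff_single, Finsupp.single_apply, Finsupp.single_apply]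
    by_cases h : k = -n
    · rw [if_pos (by omega), if_pos h]
    · rw [if_neg (by omega), if_neg h]

theorem balancedSum_unitT_ne_zero [Nontrivial B] {M : ℕ} (hM : M ≠ 0) :
    balancedSum (unitT B) M ≠ 0 := by
  intro h
  have h1 := balancedSum_mul (unitT B) M
  rw [h, zero_mul, val_unitT_zpow, val_unitT_zpow] at h1
  have h2 := congrArg (fun f : LaurentPolynomial B => f.coeff M) h1
  simp only [AddMonoidAlgebra.coeff_sub, Finsupp.sub_apply, T_apply, AddMonoidAlgebra.coeff_zero,
    Finsupp.zero_apply, if_true] at h2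
  rw [if_neg (by omega), sub_zero] at h2
  exact zero_ne_one h2

/-- The quotient of the numerator by `[m] [m t]` is an even, symmetric Laurent polynomial. -/
theorem exists_quotient {L : Type*} [IsDomain B] [CharZero B] [Field L] [CharZero L] [IsAlgClosed L]
    (κ : B →+* L) (hκ : Function.Injective κ) (A : Bˣ) {m t : ℕ} (hm : m ≠ 0) (ht : t ≠ 0) :
    ∃ E : LaurentPolynomial B, numerator (unitT B) (unitC A) m t =
        balancedSum (unitT B) m * balancedSum (unitT B) (m * t) * E ∧
      (∀ n, E.coeff (-n) = E.coeff n) ∧ ∀ n, Odd n → E.coeff n = 0 := by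
  obtain ⟨E, hE⟩ := balancedSum_mul_balancedSum_dvd_numerator κ hκ A hm ht
  have hne : balancedSum (unitT B) m * balancedSum (unitT B) (m * t) ≠ 0 :=
    mul_ne_zero (balancedSum_unitT_ne_zero hm) (balancedSum_unitT_ne_zero (mul_ne_zero hm ht))
  have h1 : invT B E = E := by
    have h2 := congrArg (invT B) hE
    rw [map_mul, map_mul, invT, eval₂_numerator, eval₂_balancedSum, eval₂_balancedSum,
      balancedSum_inv, balancedSum_inv, numerator_inv] at h2
    exact mul_left_cancel₀ hne (h2.symm.trans hE)
  -- Under T ↦ -T the two balanced sums acquire signs whose product is the sign of the numerator.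
  have h3 : negT B E = E := by
    have h2 := congrArg (negT B) hE
    rw [map_mul, map_mul, negT, eval₂_numerator, eval₂_balancedSum, eval₂_balancedSum,
      balancedSum_neg, balancedSum_neg, numerator_neg] at h2
    have h4 : ((-1) ^ (m + 1) * (-1) ^ (m * t + 1) : LaurentPolynomial B) =
        (-1) ^ (m * (t + 1)) := by
      rw [← pow_add, show m + 1 + (m * t + 1) = m * (t + 1) + 2 by ring, pow_add]
      simp
    have h5 : ((-1) ^ (m * (t + 1)) : LaurentPolynomial B) * (-1) ^ (m * (t + 1)) = 1 := by
      rw [← pow_add, (Even.add_self _).neg_one_pow]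
    refine mul_left_cancel₀ hne (Eq.trans ?_ hE)
    change _ * negT B E = _
    rw [← mul_one (numerator _ _ _ _), ← h5]
    change _ = _ * negT B E at h2
    change (-1) ^ (m * (t + 1)) * numerator (unitT B) (unitC A) m t = _ at h2
    linear_combination -((-1 : LaurentPolynomial B) ^ (m * (t + 1))) * h2 -
      (balancedSum (unitT B) m * balancedSum (unitT B) (m * t) * negT B E) * h5 +
      (-1 : LaurentPolynomial B) ^ (m * (t + 1)) * balancedSum (unitT B) m * balancedSum (unitT B) (m * t) * negT B E * h4
  refine ⟨E, hE, fun n => ?_, fun n hn => ?_⟩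
  · rw [← coeff_invT, h1]
  · have h4 := coeff_negT E n
    rw [h3, Int.negOnePow_odd n hn] at h4
    have h5 : E.coeff n + E.coeff n = 0 := by
      nth_rewrite 1 [h4]
      simp
    rw [← two_mul] at h5
    exact (mul_eq_zero.1 h5).resolve_left two_ne_zero

end Symmetry

/-! ### The explicit formula as a numerator -/

section Explicit

open PowerSeries

/-- `q^{1/2}` as a unit. -/
noncomputable def qUnit : QAˣ := Units.mk0 qHalf qHalf_ne_zero

/-- `a^{1/2}` as a unit. -/
noncomputable def aUnit : QAˣ := Units.mk0 aHalf aHalf_ne_zero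

theorem val_qUnit_zpow (n : ℤ) : ((qUnit ^ n : QAˣ) : QA) = qHalf ^ n := by
  rw [Units.val_zpow_eq_zpow_val]; rfl

theorem val_aUnit_zpow (n : ℤ) : ((aUnit ^ n : QAˣ) : QA) = aHalf ^ n := by
  rw [Units.val_zpow_eq_zpow_val]; rfl

theorem adams_algebraMap_X {d : ℕ} (hd : d ≠ 0) (i : Fin 2) :
    adams d (algebraMap (MvPolynomial (Fin 2) ℚ) QA (MvPolynomial.X i)) =
      algebraMap (MvPolynomial (Fin 2) ℚ) QA (MvPolynomial.X i) ^ d := by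
  rw [adams, dif_pos (Nat.pos_of_ne_zero hd), ← map_pow, ← MvPolynomial.expand_X]
  exact IsLocalization.map_eq _ _

theorem adams_qHalf {d : ℕ} (hd : d ≠ 0) : adams d qHalf = qHalf ^ d := adams_algebraMap_X hd 0

theorem adams_aHalf {d : ℕ} (hd : d ≠ 0) : adams d aHalf = aHalf ^ d := adams_algebraMap_X hd 1

theorem adams_bq {d : ℕ} (hd : d ≠ 0) (n : ℤ) : adams d (bq n) = bq (d * n) := by
  rw [bq, map_sub, map_zpow₀, map_zpow₀, adams_qHalf hd, ← zpow_natCast, ← zpow_mul, ← zpow_mul,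
    bq, mul_neg]

theorem adams_ba {d : ℕ} (hd : d ≠ 0) (n : ℤ) : adams d (ba n) = ba (d * n) := by
  rw [ba, map_sub, map_zpow₀, map_zpow₀, adams_aHalf hd, ← zpow_natCast, ← zpow_mul, ← zpow_mul,
    ba, mul_neg]

theorem map_adams_qUnit {d : ℕ} (hd : d ≠ 0) :
    Units.map (adams d : QA →* QA) qUnit = qUnit ^ d :=
  Units.ext (adams_qHalf hd)

theorem map_adams_aUnit {d : ℕ} (hd : d ≠ 0) :
    Units.map (adams d : QA →* QA) aUnit = aUnit ^ d :=
  Units.ext (adams_aHalf hd)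

theorem balancedSum_qUnit_pow (k M : ℕ) : balancedSum (qUnit ^ k) M * bq k = bq (k * M) := by
  have h := balancedSum_mul (qUnit ^ k) M
  rw [← zpow_natCast, ← zpow_neg, ← zpow_mul, ← zpow_mul, val_qUnit_zpow, val_qUnit_zpow,
    val_qUnit_zpow, val_qUnit_zpow, mul_neg] at h
  exact h

theorem balancedSum_qUnit (M : ℕ) : balancedSum qUnit M * bq 1 = bq M := by
  have h := balancedSum_qUnit_pow 1 M
  rw [pow_one] at h
  simpa using h

/-- For negative τ the sign of {mkτ} is moved into A ↦ A⁻¹ by {mkτ}{k}_a = {mk|τ|}{-k}_a, and that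
of {mτ} goes in front. -/
theorem explicitZ_eq_unknotSeries {τ : ℤ} (hτ : τ ≠ 0) (m : ℕ) :
    explicitZ τ m = (τ.sign : QA) * ((-1) ^ (m * τ.natAbs) *
      coeff m (unknotSeries qUnit (aUnit ^ τ.sign) 1 (m * τ.natAbs))) /
        (bq m * bq (m * τ.natAbs)) := by
  obtain ⟨P, hP, hPc⟩ :=
    exists_isNewton_unknotSeries qUnit (aUnit ^ τ.sign) one_ne_zero (m * τ.natAbs)
  rw [explicitZ_eq_coeff hτ m hP]
  · rcases lt_or_gt_of_ne hτ with h | h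
    · have h1 : τ = -(τ.natAbs : ℤ) := by omega
      rw [Int.sign_eq_neg_one_of_neg h]
      have h2 : bq ((m : ℤ) * τ) = -bq (m * τ.natAbs) := by
        rw [← bq_neg]; congr 1; rw [← mul_neg, ← h1]
      have h3 : (-1 : QA) ^ ((m : ℤ) * τ) = (-1) ^ (m * τ.natAbs) := by
        rw [h1, mul_neg, zpow_neg, ← inv_zpow, inv_neg_one, Int.natAbs_neg, Int.natAbs_natCast]
        exact_mod_cast rfl
      rw [h2, h3, mul_neg, div_neg]
      push_cast
      ring
    · have h1 : τ = (τ.natAbs : ℤ) := by omega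
      have h3 : (-1 : QA) ^ ((m : ℤ) * τ) = (-1) ^ (m * τ.natAbs) := by
        rw [h1, Int.natAbs_natCast]
        exact_mod_cast rfl
      rw [Int.sign_eq_one_of_pos h, h3, ← h1]
      simp
  · intro k hk
    rw [hPc k hk, if_pos (one_dvd k), Nat.cast_one, one_mul, eq_div_iff (bq_natCast_ne_zero hk),
      mul_assoc, balancedSum_qUnit_pow]
    have h4 : ((((aUnit ^ τ.sign) ^ k : QAˣ) : QA) - ((((aUnit ^ τ.sign)⁻¹ ^ k : QAˣ)) : QA)) =
        ba (τ.sign * k) := by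
      rw [← zpow_neg, ← zpow_natCast, ← zpow_natCast, ← zpow_mul, ← zpow_mul, val_aUnit_zpow,
        val_aUnit_zpow, ba, neg_mul]
    rw [h4]
    rcases lt_or_gt_of_ne hτ with h | h
    · have h1 : τ = -(τ.natAbs : ℤ) := by omega
      have h5 : (m : ℤ) * k * τ = -(k * (m * τ.natAbs : ℕ)) := by
        rw [Nat.cast_mul]
        linear_combination (m : ℤ) * k * h1
      have h6 : ba (-(k : ℤ)) = -ba k := by simp [ba]
      rw [Int.sign_eq_neg_one_of_neg h, h5, bq_neg, neg_one_mul, h6]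
      ring
    · have h1 : τ = (τ.natAbs : ℤ) := by omega
      have h5 : (m : ℤ) * k * τ = k * (m * τ.natAbs : ℕ) := by
        rw [Nat.cast_mul]
        linear_combination (m : ℤ) * k * h1
      rw [Int.sign_eq_one_of_pos h, h5, one_mul, mul_comm]

theorem adams_explicitZ {τ : ℤ} (hτ : τ ≠ 0) {d : ℕ} (hd : d ≠ 0) (n : ℕ) :
    adams d (explicitZ τ n) = (τ.sign : QA) * ((-1) ^ (n * τ.natAbs) *
      coeff (d * n) (unknotSeries qUnit (aUnit ^ τ.sign) d (n * τ.natAbs))) /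
        (bq (d * n : ℕ) * bq ((d * n : ℕ) * τ.natAbs)) := by
  rw [explicitZ_eq_unknotSeries hτ, map_div₀, map_mul, map_mul, map_mul, map_intCast, map_pow,
    map_neg, map_one, adams_bq hd, adams_bq hd, ← PowerSeries.coeff_map, map_unknotSeries,
    coeff_mul_unknotSeries _ _ hd, map_zpow, map_adams_qUnit hd, map_adams_aUnit hd,
    ← zpow_natCast (aUnit ^ τ.sign), ← zpow_natCast aUnit, ← zpow_mul, ← zpow_mul,
    mul_comm (d : ℤ) τ.sign, ← mul_assoc (d : ℤ)]
  push_cast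
  rfl

/-- With t = |τ| and m = dn, Ψ_d maps {n}{nt} to {m}{mt}, so all summands have one denominator. -/
theorem sum_moebius_adams_explicitZ {τ : ℤ} (hτ : τ ≠ 0) (m : ℕ) :
    ∑ d ∈ m.divisors, ((ArithmeticFunction.moebius d : ℤ) : QA) * adams d (explicitZ τ (m / d)) =
      (τ.sign : QA) * numerator qUnit (aUnit ^ τ.sign) m τ.natAbs /
        (bq m * bq (m * τ.natAbs)) := by
  rw [numerator, Finset.mul_sum, Finset.sum_div]
  refine Finset.sum_congr rfl fun d hd => ?_
  rw [Nat.mem_divisors] at hd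
  rw [adams_explicitZ hτ (fun h => hd.2 (zero_dvd_iff.1 (h ▸ hd.1))), Nat.mul_div_cancel' hd.1]
  ring

/-- Here Ψ_d 𝒵_{m/d} does not depend on d, so the Möbius sum is zero for m > 1. -/
theorem sum_moebius_adams_explicitZ_zero {m : ℕ} (hm : m ≠ 0) :
    ∑ d ∈ m.divisors, ((ArithmeticFunction.moebius d : ℤ) : QA) * adams d (explicitZ 0 (m / d)) =
      if m = 1 then ba 1 / bq 1 ^ 2 else 0 := by
  have h : ∀ d ∈ m.divisors, adams d (explicitZ 0 (m / d)) = ba m / bq m ^ 2 := by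
    intro d hd
    rw [Nat.mem_divisors] at hd
    obtain ⟨⟨n, rfl⟩, hm⟩ := hd
    have hd0 : d ≠ 0 := left_ne_zero_of_mul hm
    rw [Nat.mul_div_cancel_left _ (Nat.pos_of_ne_zero hd0),
      explicitZ_zero (right_ne_zero_of_mul hm), map_div₀, map_pow, adams_ba hd0, adams_bq hd0]
    push_cast
    rfl
  rw [Finset.sum_congr rfl fun d hd => by rw [h d hd]]
  split_ifs with h1
  · subst h1
    simp
  · obtain ⟨p, hp, hpm⟩ := Nat.exists_prime_and_dvd h1
    exact sum_moebius_eq_zero hp hpm dvd_rfl _ fun _ _ _ => rfl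

end Explicit

/-! ### Integrality -/

section Integrality

open LaurentPolynomial

/-- `z = q^{1/2} - q^{-1/2}`. -/
noncomputable def zVar : QA := qHalf - qHalf⁻¹

theorem zVar_eq : zVar = bq 1 := by
  rw [zVar, bq, zpow_one, zpow_neg_one]

theorem zVar_ne_zero : zVar ≠ 0 := by
  rw [zVar_eq]
  exact_mod_cast bq_natCast_ne_zero one_ne_zero

/-- The map sending the family `(n_{g, k})` to `∑ n_{g, k} z^{2 g - 2} a^{k / 2}`. -/
noncomputable def lmovSum : ((ℕ × ℤ) →₀ ℤ) →+ QA :=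
  Finsupp.liftAddHom fun gk =>
    (AddMonoidHom.mulRight (zVar ^ (2 * (gk.1 : ℤ) - 2) * aHalf ^ gk.2)).comp (Int.castAddHom QA)

theorem lmovSum_apply (n : (ℕ × ℤ) →₀ ℤ) : lmovSum n = n.sum fun gk c =>
    (c : QA) * (qHalf - qHalf⁻¹) ^ (2 * (gk.1 : ℤ) - 2) * aHalf ^ gk.2 := by
  rw [lmovSum, Finsupp.liftAddHom_apply]
  refine Finsupp.sum_congr fun gk _ => ?_
  rw [mul_assoc]
  rfl

/-- The ring `ℤ[a^{1/2}, a^{-1/2}]`. -/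
noncomputable def aRing : Subring QA := (LaurentPolynomial.eval₂ (Int.castRingHom QA) aUnit).range

/-- `a^{1/2}` as a unit of `ℤ[a^{1/2}, a^{-1/2}]`. -/
noncomputable def aRingUnit : aRingˣ where
  val := ⟨aHalf, T 1, by rw [eval₂_T, zpow_one]; rfl⟩
  inv := ⟨aHalf⁻¹, T (-1), by rw [eval₂_T, zpow_neg_one]; rfl⟩
  val_inv := Subtype.ext (mul_inv_cancel₀ aHalf_ne_zero)
  inv_val := Subtype.ext (inv_mul_cancel₀ aHalf_ne_zero)

/-- The ring `ℤ[a^{1/2}, a^{-1/2}, z²]`. -/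
noncomputable def azRing : Subring QA :=
  (Polynomial.eval₂RingHom aRing.subtype (zVar ^ 2)).range

theorem aRing_le_azRing : aRing ≤ azRing := fun b hb =>
  ⟨Polynomial.C ⟨b, hb⟩, by simp⟩

theorem zVar_sq_mem : zVar ^ 2 ∈ azRing := ⟨Polynomial.X, by simp⟩

theorem mul_zVar_mem_range {x : QA} (hx : x ∈ azRing) : x * zVar ^ (-2 : ℤ) ∈ lmovSum.range := by
  obtain ⟨p, rfl⟩ := hx
  induction p using Polynomial.induction_on' with
  | add p q hp hq => rw [map_add, add_mul]; exact add_mem hp hq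
  | monomial i b =>
    obtain ⟨b, f, rfl⟩ := b
    rw [Polynomial.coe_eval₂RingHom, Polynomial.eval₂_monomial]
    change LaurentPolynomial.eval₂ (Int.castRingHom QA) aUnit f * (zVar ^ 2) ^ i *
      zVar ^ (-2 : ℤ) ∈ _
    induction f using LaurentPolynomial.induction_on' with
    | add p q hp hq => rw [map_add, add_mul, add_mul]; exact add_mem hp hq
    | C_mul_T k c =>
      refine ⟨Finsupp.single (i, k) c, ?_⟩
      rw [lmovSum_apply, Finsupp.sum_single_index (by simp), map_mul, eval₂_T,
        LaurentPolynomial.eval₂_C, val_aUnit_zpow, sub_eq_add_neg (2 * _) (2 : ℤ)]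
      change (c : QA) * zVar ^ _ * _ = _
      rw [zpow_add₀ zVar_ne_zero, zpow_mul, zpow_natCast]
      change _ = (c : QA) * _ * _ * _
      rw [show zVar ^ (2 : ℤ) = zVar ^ 2 by exact_mod_cast rfl]
      ring

/-- The Chebyshev recursion u_{i+2} = (z² + 2) u_{i+1} - u_i for u_i = q^i + q^{-i}. -/
theorem qHalf_add_mem (i : ℕ) :
    qHalf ^ (2 * (i : ℤ)) + qHalf ^ (-(2 * (i : ℤ))) ∈ azRing := by
  have h1 : ∀ n : ℤ, qHalf ^ (2 * (n + 1)) = qHalf ^ (2 * n) * qHalf ^ 2 := fun n => by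
    rw [mul_add, zpow_add₀ qHalf_ne_zero]; exact_mod_cast rfl
  have h2 : zVar ^ 2 + 2 = qHalf ^ 2 + (qHalf ^ 2)⁻¹ := by
    rw [zVar]
    have := qHalf_ne_zero
    field_simp
    ring
  have h3 : zVar ^ 2 + 2 ∈ azRing := add_mem zVar_sq_mem (by exact_mod_cast natCast_mem azRing 2)
  induction i using Nat.twoStepInduction with
  | zero => simp [one_add_one_eq_two]
  | one =>
    rw [h2] at h3
    convert h3 using 2 <;> norm_cast
  | more i hi hi1 =>
    have h4 := sub_mem (mul_mem hi1 h3) hi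
    convert h4 using 1
    rw [h2]
    push_cast
    have h5 : (i : ℤ) + 2 = i + 1 + 1 := by ring
    rw [zpow_neg, zpow_neg, zpow_neg, h5, h1, h1, mul_inv, mul_inv]
    have := qHalf_ne_zero
    have h6 : qHalf ^ 2 * (qHalf ^ 2)⁻¹ = 1 := mul_inv_cancel₀ (pow_ne_zero 2 this)
    linear_combination (- qHalf ^ (2 * (i : ℤ)) - (qHalf ^ (2 * (i : ℤ)))⁻¹) * h6

theorem eval₂_eq_sum {B : Type*} [CommRing B] (f : B →+* QA) (E : LaurentPolynomial B) :
    LaurentPolynomial.eval₂ f qUnit E = ∑ n ∈ E.coeff.support, f (E.coeff n) * qHalf ^ n := by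
  change _ = E.coeff.sum fun n b => f b * qHalf ^ n
  induction E using LaurentPolynomial.induction_on' with
  | add p q hp hq =>
    rw [map_add, hp, hq, AddMonoidAlgebra.coeff_add, Finsupp.sum_add_index' (by simp)]
    intro n b c
    rw [map_add, add_mul]
  | C_mul_T k b =>
    rw [map_mul, eval₂_T, LaurentPolynomial.eval₂_C, val_qUnit_zpow, ← single_eq_C_mul_T,
      AddMonoidAlgebra.coeff_single, Finsupp.sum_single_index (by simp)]

theorem eval₂_mem_azRing {E : LaurentPolynomial aRing} (h1 : ∀ n, E.coeff (-n) = E.coeff n)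
    (h2 : ∀ n, Odd n → E.coeff n = 0) :
    LaurentPolynomial.eval₂ aRing.subtype qUnit E ∈ azRing := by
  obtain ⟨N, hN⟩ : ∃ N : ℕ, E.coeff.support ⊆ Finset.Icc (-(N : ℤ)) N := by
    refine ⟨E.coeff.support.sup Int.natAbs, fun n hn => ?_⟩
    have := Finset.le_sup (f := Int.natAbs) hn
    rw [Finset.mem_Icc]
    omega
  have h3 : LaurentPolynomial.eval₂ aRing.subtype qUnit E =
      ∑ n ∈ Finset.Icc (-(N : ℤ)) N, (E.coeff n : QA) * qHalf ^ n := by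
    rw [← Finset.sum_subset hN fun n _ hn => by rw [Finsupp.notMem_support_iff.1 hn]; simp]
    exact eval₂_eq_sum _ _
  rw [h3]
  clear h3 hN
  have h4 : ∀ n : ℤ, (E.coeff n : QA) ∈ azRing := fun n => aRing_le_azRing (E.coeff n).2
  induction N with
  | zero => simpa using h4 0
  | succ N ih =>
    rw [show ((N + 1 : ℕ) : ℤ) = (N : ℤ) + 1 by push_cast; rfl]
    -- The terms at ±(N + 1) have equal coefficients, zero for odd N + 1, and combine to a multiple
    -- of some q^i + q^{-i}.
    rw [Finset.sum_Icc_succ_eq_add_endpoints]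
    refine add_mem ?_ ih
    rw [h1, ← mul_add]
    rcases Int.even_or_odd ((N : ℤ) + 1) with he | ho
    · obtain ⟨i, hi⟩ := he
      lift i to ℕ using by omega
      rw [hi, ← two_mul]
      exact mul_mem (h4 _) (qHalf_add_mem i)
    · rw [h2 _ ho]
      simp

theorem sum_moebius_adams_mem_range (τ : ℤ) {m : ℕ} (hm : m ≠ 0) :
    ∑ d ∈ m.divisors, ((ArithmeticFunction.moebius d : ℤ) : QA) * adams d (explicitZ τ (m / d)) ∈
      lmovSum.range := by
  have hz2 : zVar ^ (-2 : ℤ) = (zVar ^ 2)⁻¹ := by rw [zpow_neg]; exact_mod_cast rfl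
  rcases eq_or_ne τ 0 with rfl | hτ
  · rw [sum_moebius_adams_explicitZ_zero hm]
    split_ifs with h
    · rw [div_eq_mul_inv, ← zVar_eq, ← hz2]
      refine mul_zVar_mem_range (aRing_le_azRing ?_)
      rw [ba, zpow_one, zpow_neg_one]
      exact sub_mem (aRingUnit : aRing).2 ((aRingUnit⁻¹ : aRingˣ) : aRing).2
    · exact zero_mem _
  · have ht : τ.natAbs ≠ 0 := Int.natAbs_ne_zero.2 hτ
    -- The division takes place over ℤ[a^{±1/2}] with an indeterminate T for q^{1/2}, and is then
    -- specialized to T = q^{1/2}.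
    obtain ⟨E, hE, hE1, hE2⟩ := exists_quotient
      ((algebraMap QA (AlgebraicClosure QA)).comp aRing.subtype)
      ((algebraMap QA (AlgebraicClosure QA)).injective.comp Subtype.val_injective)
      (aRingUnit ^ τ.sign) hm ht
    have h1 := congrArg (LaurentPolynomial.eval₂ aRing.subtype qUnit) hE
    have h2 : Units.map (aRing.subtype : aRing →* QA) aRingUnit = aUnit := Units.ext rfl
    rw [eval₂_numerator, map_mul, map_mul, eval₂_balancedSum, eval₂_balancedSum, map_zpow, h2] at h1
    rw [sum_moebius_adams_explicitZ hτ, h1, ← Nat.cast_mul, ← balancedSum_qUnit,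
      ← balancedSum_qUnit, ← zVar_eq]
    have h3 := mul_zVar_mem_range (mul_mem (intCast_mem azRing τ.sign) (eval₂_mem_azRing hE1 hE2))
    convert h3 using 1
    have h4 : balancedSum qUnit m ≠ 0 := fun h => by
      have := balancedSum_qUnit m
      rw [h, zero_mul] at this
      exact bq_natCast_ne_zero hm this.symm
    have h5 : balancedSum qUnit (m * τ.natAbs) ≠ 0 := fun h => by
      have := balancedSum_qUnit (m * τ.natAbs)
      rw [h, zero_mul] at this
      exact bq_natCast_ne_zero (mul_ne_zero hm ht) this.symm
    have h6 := zVar_ne_zero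
    rw [hz2]
    field_simp

end Integrality

/-! ### Uniqueness of the coefficients -/

section Uniqueness

open MvPolynomial

/-- P(z, a^{1/2}) becomes a polynomial in q^{1/2}, a^{1/2} after multiplication by a power of
q^{1/2}, and this persists at rational points. A relation between z and a^{1/2} can thus be tested
numerically. -/
theorem exists_clear_denominators (P : MvPolynomial (Fin 2) ℚ) :
    ∃ (D : ℕ) (Q : MvPolynomial (Fin 2) ℚ),
      aeval ![zVar, aHalf] P * qHalf ^ D = algebraMap _ QA Q ∧
      ∀ x y : ℚ, x ≠ 0 → eval ![x, y] Q = eval ![x - x⁻¹, y] P * x ^ D := by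
  have hq : ∀ D, algebraMap (MvPolynomial (Fin 2) ℚ) QA (X 0 ^ D) = qHalf ^ D := fun D =>
    map_pow _ _ _
  induction P using MvPolynomial.induction_on with
  | C c =>
    refine ⟨0, C c, ?_, fun x y _ => by simp⟩
    rw [pow_zero, mul_one, ← algebraMap_eq, AlgHom.commutes]
    exact IsScalarTower.algebraMap_apply ℚ (MvPolynomial (Fin 2) ℚ) QA c
  | add p r hp hr =>
    obtain ⟨D, Q, h1, h2⟩ := hp
    obtain ⟨D', Q', h1', h2'⟩ := hr
    refine ⟨D + D', Q * X 0 ^ D' + Q' * X 0 ^ D, ?_, fun x y hx => ?_⟩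
    · rw [map_add, map_add, map_mul, map_mul, hq, hq, ← h1, ← h1']
      ring
    · simp only [map_add, map_mul, map_pow, h2 x y hx, h2' x y hx, eval_X, Matrix.cons_val_zero]
      ring
  | mul_X p i hp =>
    obtain ⟨D, Q, h1, h2⟩ := hp
    fin_cases i
    · refine ⟨D + 1, Q * (X 0 ^ 2 - 1), ?_, fun x y hx => ?_⟩
      · rw [map_mul (aeval _), map_mul (algebraMap _ QA), map_sub (algebraMap _ QA), hq, ← h1,
          map_one, pow_succ]
        have h3 : (zVar * qHalf : QA) = qHalf ^ 2 - 1 := by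
          rw [zVar, sub_mul, inv_mul_cancel₀ qHalf_ne_zero, sq]
        rw [← h3]
        simp
        ring
      · simp only [map_mul, map_sub, map_pow, map_one, h2 x y hx, eval_X, Matrix.cons_val_zero,
          Fin.zero_eta]
        have h3 : (x - x⁻¹) * x = x ^ 2 - 1 := by field_simp
        linear_combination -(eval ![x - x⁻¹, y] p * x ^ D) * h3
    · refine ⟨D, Q * X 1, ?_, fun x y hx => ?_⟩
      · rw [map_mul (aeval _), map_mul (algebraMap _ QA), ← h1]
        simp
        change _ * aHalf * _ = _ * _ * aHalf
        ring
      · simp [h2 x y hx]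
        ring

theorem sub_inv_infinite : (Set.range fun n : ℕ => ((n : ℚ) + 1) - ((n : ℚ) + 1)⁻¹).Infinite := by
  refine Set.infinite_range_of_injective (StrictMono.injective ?_)
  refine strictMono_nat_of_lt_succ fun n => ?_
  push_cast
  have h : ((n : ℚ) + 1 + 1)⁻¹ ≤ ((n : ℚ) + 1)⁻¹ := by gcongr; linarith
  linarith

/-- A relation P forces the cleared polynomial to be 0, so P vanishes at (x - x⁻¹, y) for infinitely
many values of x - x⁻¹ and all y. -/
theorem aeval_zVar_aHalf_injective {P : MvPolynomial (Fin 2) ℚ}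
    (h : aeval ![zVar, aHalf] P = 0) : P = 0 := by
  obtain ⟨D, Q, h1, h2⟩ := exists_clear_denominators P
  rw [h, zero_mul, eq_comm, FaithfulSMul.algebraMap_eq_zero_iff] at h1
  subst h1
  refine funext_set ![Set.range fun n : ℕ => ((n : ℚ) + 1) - ((n : ℚ) + 1)⁻¹, Set.univ] ?_ ?_
  · intro i
    fin_cases i
    · exact sub_inv_infinite
    · exact Set.infinite_univ
  · intro x hx
    obtain ⟨n, hn⟩ := hx 0 (Set.mem_univ _)
    have hn0 : (n : ℚ) + 1 ≠ 0 := by positivity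
    have h3 := h2 _ (x 1) hn0
    rw [map_zero, eq_comm, mul_eq_zero, or_iff_left (pow_ne_zero _ hn0)] at h3
    have h4 : x = ![(n : ℚ) + 1 - ((n : ℚ) + 1)⁻¹, x 1] := by
      ext i
      fin_cases i
      · exact hn.symm
      · rfl
    rw [h4, h3, map_zero]

theorem lmovSum_injective : Function.Injective lmovSum := by
  rw [injective_iff_map_eq_zero]
  intro n hn
  rw [lmovSum_apply] at hn
  change (n.sum fun gk c => (c : QA) * zVar ^ (2 * (gk.1 : ℤ) - 2) * aHalf ^ gk.2) = 0 at hn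
  -- Multiplication by z² a^{N/2} makes all exponents nonnegative.
  obtain ⟨N, hN⟩ : ∃ N : ℕ, ∀ gk ∈ n.support, 0 ≤ gk.2 + N := by
    refine ⟨n.support.sup fun gk => gk.2.natAbs, fun gk hgk => ?_⟩
    have h : gk.2.natAbs ≤ _ := Finset.le_sup (f := fun gk : ℕ × ℤ => gk.2.natAbs) hgk
    omega
  let e : ℕ × ℤ → (Fin 2 →₀ ℕ) := fun gk =>
    Finsupp.single 0 (2 * gk.1) + Finsupp.single 1 (gk.2 + N).toNat
  have he0 : ∀ gk, e gk 0 = 2 * gk.1 := fun gk => by simp [e]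
  have he1 : ∀ gk, e gk 1 = (gk.2 + N).toNat := fun gk => by simp [e]
  have h1 : aeval ![zVar, aHalf] (∑ gk ∈ n.support, monomial (e gk) ((n gk : ℤ) : ℚ)) = 0 := by
    rw [map_sum]
    have h2 := congrArg (· * (zVar ^ 2 * aHalf ^ N)) hn
    simp only [zero_mul] at h2
    rw [← h2, Finsupp.sum, Finset.sum_mul]
    refine Finset.sum_congr rfl fun gk hgk => ?_
    rw [aeval_monomial, Finsupp.prod_fintype _ _ (fun _ => pow_zero _), Fin.prod_univ_two, he0, he1,
      map_intCast]
    have h3 : aHalf ^ (gk.2 + N).toNat = aHalf ^ gk.2 * aHalf ^ N := by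
      rw [← zpow_natCast, Int.toNat_of_nonneg (hN gk hgk), zpow_add₀ aHalf_ne_zero, zpow_natCast]
    have h4 : zVar ^ (2 * gk.1) = zVar ^ (2 * (gk.1 : ℤ) - 2) * zVar ^ 2 := by
      rw [← zpow_natCast, ← zpow_natCast, ← zpow_add₀ zVar_ne_zero]
      congr 1
      push_cast
      ring
    simp only [Matrix.cons_val_zero, Matrix.cons_val_one]
    rw [h3, h4]
    ring
  have h5 := aeval_zVar_aHalf_injective h1
  ext gk
  by_contra hgk
  have hgk' : gk ∈ n.support := Finsupp.mem_support_iff.2 hgk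
  have h6 := congrArg (coeff (e gk)) h5
  rw [coeff_sum, coeff_zero, Finset.sum_eq_single_of_mem gk hgk', coeff_monomial, if_pos rfl] at h6
  · exact hgk (by exact_mod_cast h6)
  · intro gk' hgk'' hne
    rw [coeff_monomial, if_neg]
    intro h
    apply hne
    have h7 := he0 gk
    have h8 := he1 gk
    rw [← h, he0] at h7
    rw [← h, he1] at h8
    have h9 := hN gk hgk'
    have h10 := hN gk' hgk''
    ext
    · omega
    · omega

end Uniqueness

/-! ### The one-hole generating function -/

theorem fHat_freeEnergyCoeff (τ : ℤ) {n m : ℕ} (hm : m ≠ 0) (mu : n.Partition)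
    (hmu : mu.parts = {m}) : fHat (freeEnergyCoeff τ) mu = explicitZ τ m / m := by
  obtain rfl : n = m := by rw [← mu.parts_sum, hmu, Multiset.sum_singleton]
  obtain rfl : mu = Nat.Partition.indiscrete n :=
    Nat.Partition.ext (by rw [hmu, Nat.Partition.indiscrete_parts hm])
  obtain ⟨k, rfl⟩ := Nat.exists_eq_succ_of_ne_zero hm
  have h := bq_natCast_ne_zero hm
  rw [fHat, hmu, prod_map_natCast, freeEnergyCoeff_indiscrete, Multiset.map_singleton,
    Multiset.prod_singleton]
  have h2 : (k : QA) + 1 ≠ 0 := by exact_mod_cast hm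
  push_cast at h ⊢
  field_simp

/-- Since F̂_(n) = 𝒵_n / n, the factor 𝔷_(m) = m cancels 1/d and the 1/n with n = m/d. -/
theorem oneHoleG_freeEnergyCoeff (τ : ℤ) {m : ℕ} (hm : m ≠ 0) :
    oneHoleG (freeEnergyCoeff τ) m = ∑ d ∈ m.divisors,
      ((ArithmeticFunction.moebius d : ℤ) : QA) * adams d (explicitZ τ (m / d)) := by
  have hp := Nat.Partition.indiscrete_parts hm
  rw [oneHoleG, gHat, Finset.filter_true_of_mem, Finset.mul_sum]
  · refine Finset.sum_congr rfl fun d hd => ?_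
    rw [Nat.mem_divisors] at hd
    obtain ⟨⟨n, rfl⟩, -⟩ := hd
    have hd0 : d ≠ 0 := left_ne_zero_of_mul hm
    have hn0 : n ≠ 0 := right_ne_zero_of_mul hm
    have hdn : d * n / d = n := Nat.mul_div_cancel_left _ (Nat.pos_of_ne_zero hd0)
    rw [fHat_freeEnergyCoeff τ hn0, hdn, map_div₀, map_natCast]
    · have h1 : zee (Nat.Partition.indiscrete (d * n)) = d * n := by
        rw [zee, hp]; simp
      rw [h1]
      have h2 : (d : QA) ≠ 0 := Nat.cast_ne_zero.2 hd0
      have h3 : (n : QA) ≠ 0 := Nat.cast_ne_zero.2 hn0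
      push_cast
      field_simp
    · rw [divPart, hp, Nat.Partition.ofMultiset]
      simp [hdn, hn0]
  · intro d hd k hk
    rw [hp, Multiset.mem_singleton] at hk
    rw [hk]
    exact Nat.dvd_of_mem_divisors hd

end FramedUnknot

/-- Let `U_τ` be the unknot with framing `τ`. The free energy `log Z_CS` of `U_τ` has a unique
power sum expansion `∑ F_μ p_μ`, and for every `m ≥ 1` the one-hole LMOV generating function
`g_m = 𝔷_{(m)} ĝ_{(m)}` built from the `F_μ` is equal to `∑_{d ∣ m} μ(d) Z_{m/d}(q^d, a^d)`, and is of
the form `∑_{g ≥ 0} ∑_Q n_{m,g,Q}(τ) z^{2g-2} a^Q`, with `z = q^{1/2} - q^{-1/2}` and `Q ∈ ½ℤ`, for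
unique integers `n_{m,g,Q}(τ)`, almost all of them `0` (below, `n (g, k)` is `n_{m,g,k/2}(τ)`). -/
theorem mainTheorem4 (τ : ℤ) :
    (∃! F : (n : ℕ) → n.Partition → FramedUnknot.QA, FramedUnknot.IsPowerSumExpansion τ F) ∧
    ∀ F : (n : ℕ) → n.Partition → FramedUnknot.QA, FramedUnknot.IsPowerSumExpansion τ F →
      ∀ m : ℕ, 1 ≤ m →
        FramedUnknot.oneHoleG F m =
          ∑ d ∈ m.divisors, ((ArithmeticFunction.moebius d : ℤ) : FramedUnknot.QA) *
            FramedUnknot.adams d (FramedUnknot.explicitZ τ (m / d)) ∧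
        ∃! n : (ℕ × ℤ) →₀ ℤ,
          FramedUnknot.oneHoleG F m =
            n.sum fun gk c => (c : FramedUnknot.QA) *
              (FramedUnknot.qHalf - FramedUnknot.qHalf⁻¹) ^ (2 * (gk.1 : ℤ) - 2) *
              FramedUnknot.aHalf ^ gk.2 := by
  refine ⟨⟨FramedUnknot.freeEnergyCoeff τ, (FramedUnknot.isPowerSumExpansion_iff τ _).2 rfl,
    fun F hF => (FramedUnknot.isPowerSumExpansion_iff τ F).1 hF⟩, fun F hF m hm => ?_⟩
  obtain rfl := (FramedUnknot.isPowerSumExpansion_iff τ F).1 hF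
  have hm0 : m ≠ 0 := Nat.one_le_iff_ne_zero.1 hm
  rw [FramedUnknot.oneHoleG_freeEnergyCoeff τ hm0]
  refine ⟨rfl, ?_⟩
  obtain ⟨n, hn⟩ := FramedUnknot.sum_moebius_adams_mem_range τ hm0
  refine ⟨n, ?_, fun n' hn' => FramedUnknot.lmovSum_injective ?_⟩
  · rw [← hn]
    exact FramedUnknot.lmovSum_apply n
  · rw [hn, FramedUnknot.lmovSum_apply]
    exact hn'.symm
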